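/- Let $K$ be a $p$-adic field, i.e. a finite extension of some $\mathbb{Q}_p$, with valuation ring $R_K$, residue field of cardinality $q$, normalized absolute value $|z|_K=q^{-\mathrm{ord}(z)}$, and $\|z\|_K=\max_i|z_i|_K$ on $K^l$. Let $|dx|$ be the Haar measure on $K^n$ giving $R_K^n$ measure $1$. For a compact open set $U\subseteq K^n$ and a map $f$ that is analytic on $U$, let $Z_U(s,f)=\int_U\|f(x)\|_K^s\,|dx|$ for $\mathrm{Re}(s)>0$, and let $Z(s,f)=Z_{R_K^n}(s,f)$. Let $f=(f_1,\dots,f_l)$ be a map to $K^l$ with $f(0)=0$, given near the origin by convergent power series $f_i=\sum_{m\in\mathbb{N}^n}c_{m,i}x^m$, not all zero. Its Newton polyhedron $\Gamma(f)$ is the convex hull of $\bigcup_m(m+\mathbb{R}_{\ge0}^n)$ over all $m\in\mathbb{N}^n$ such that $c_{m,i}\ne0$ for some $i$. For a (non-empty) face $\tau$ of $\Gamma(f)$ put $f_{i,\tau}=\sum_{m\in\tau\cap\mathbb{N}^n}c_{m,i}x^m$. We say that the rank condition holds on $\tau$ if, for every $z\in(K^\times)^n$ with $f_{1,\tau}(z)=\dots=f_{l,\tau}(z)=0$,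 the matrix $\left[\frac{\partial f_{i,\tau}}{\partial x_j}(z)\right]$ has rank $\min\{l,n\}$. The map $f$ is strongly non-degenerate at the origin with respect to $\Gamma(f)$ if the rank condition holds on every compact face of $\Gamma(f)$. A polynomial map $f$ is strongly non-degenerate with respect to $\Gamma(f)$ if it holds on every face, compact or not, including $\Gamma(f)$ itself. Let $(t_f,\dots,t_f)$ be the point where the diagonal $\{(t,\dots,t)\mid t\in\mathbb{R}\}$ meets the boundary of $\Gamma(f)$. (1) Let $f$ be analytic in a neighbourhood of the origin, with $f(0)=0$, not constant in any neighbourhood of the origin, and strongly non-degenerate at the origin with respect to $\Gamma(f)$. Suppose $t_f\ge 1/l$. Then there is a neighbourhood $V$ of the origin such that for every compact open set $U\subseteq V$ containing the origin, $Z_U(s,f)$ has a meromorphic continuation to $\mathbb{C}$, and $-1/t_f$ is the largest real part of a pole of this continuation. (2) Let $f:K^n\to K^l$ be a non-constant polynomial map with $f(0)=0$, strongly non-degenerate with respect to $\Gamma(f)$. Suppose $t_f\ge1/l$. Then $Z(s,f)$ has a meromorphic continuation to $\mathbb{C}$, and $-1/t_f$ is the largest real part of a pole of this continuation. -/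

import Mathlib

namespace IgusaZeta

open scoped NormedField Valued Topology

/-! ### `p`-adic fields -/

/-- A `p`-adic field: a finite extension of some `ℚ_[p]`, normed by the (unique) extension of the
`p`-adic absolute value.  This norm serves for the topology, for the valuation ring and for the
notion of convergent power series; the normalized absolute value of the field is `absK` below. -/
class PadicField (K : Type*) [NontriviallyNormedField K] : Prop where
  exists_finiteDimensional : ∃ (p : ℕ) (_ : Fact p.Prime) (_ : NormedAlgebra ℚ_[p] K),
    FiniteDimensional ℚ_[p] K

instance PadicField.properSpace (K : Type*) [NontriviallyNormedField K] [PadicField K] :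
    ProperSpace K := by
  obtain ⟨p, _, _, _⟩ := PadicField.exists_finiteDimensional (K := K)
  exact FiniteDimensional.proper ℚ_[p] K

instance PadicField.isUltrametricDist (K : Type*) [NontriviallyNormedField K] [PadicField K] :
    IsUltrametricDist K := by
  obtain ⟨p, _, _, _⟩ := PadicField.exists_finiteDimensional (K := K)
  refine IsUltrametricDist.isUltrametricDist_of_forall_norm_natCast_le_one fun n => ?_
  rw [← map_natCast (algebraMap ℚ_[p] K) n, norm_algebraMap']
  exact IsUltrametricDist.norm_natCast_le_one ℚ_[p] n

instance PadicField.compactSpace_integer (K : Type*) [NontriviallyNormedField K] [PadicField K] :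
    CompactSpace 𝒪[K] := by
  refine isCompact_iff_compactSpace.mp ?_
  have h : (𝒪[K] : Set K) = Metric.closedBall 0 1 := by
    ext x
    simp [Valued.integer.mem_iff]
  exact h ▸ isCompact_closedBall (0 : K) 1

instance PadicField.isDiscreteValuationRing (K : Type*) [NontriviallyNormedField K]
    [PadicField K] : IsDiscreteValuationRing 𝒪[K] := by
  have : (Valued.v : Valuation K NNReal).RankOne :=
    inferInstanceAs (NormedField.valuation (K := K)).RankOne
  exact Valued.integer.isDiscreteValuationRing_of_compactSpace

instance PadicField.finite_residueField (K : Type*) [NontriviallyNormedField K] [PadicField K] :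
    Finite 𝓀[K] := by
  have : (Valued.v : Valuation K NNReal).RankOne :=
    inferInstanceAs (NormedField.valuation (K := K)).RankOne
  exact
    (Valued.integer.compactSpace_iff_completeSpace_and_isDiscreteValuationRing_and_finite_residueField
      (K := K)).mp inferInstance |>.2.2

/-- The cardinality `q` of the residue field `𝓀[K]` of the valuation ring `𝒪[K]`. -/
noncomputable def residueCard (K : Type*) [NontriviallyNormedField K] [PadicField K] : ℕ :=
  Nat.card 𝓀[K]

theorem one_lt_residueCard (K : Type*) [NontriviallyNormedField K] [PadicField K] :
    1 < (residueCard K : NNReal) := by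
  exact_mod_cast (Finite.one_lt_card : 1 < Nat.card 𝓀[K])

/-- The normalized absolute value `|z|_K = q ^ (-ord z)`, where `ord` is the valuation of `K`
attached to the maximal ideal of the valuation ring. -/
noncomputable def absK {K : Type*} [NontriviallyNormedField K] [PadicField K] (z : K) : ℝ :=
  (IsDiscreteValuationRing.maximalIdeal 𝒪[K]).adicAbv (K := K) (one_lt_residueCard K) z

/-- `‖z‖_K = max_i |z_i|_K` for `z ∈ K^l` (equal to `0` if `l = 0`). -/
noncomputable def maxAbs {K : Type*} [NontriviallyNormedField K] [PadicField K] {l : ℕ}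
    (z : Fin l → K) : ℝ :=
  ⨆ i, absK (z i)

/-! ### Haar measure and Igusa's local zeta function -/

/-- The polydisc `R_K ^ n`, where `R_K` is the valuation ring, as a compact set with non-empty
interior. -/
def integerBox (K : Type*) [NontriviallyNormedField K] [PadicField K] (n : ℕ) :
    TopologicalSpace.PositiveCompacts (Fin n → K) where
  carrier := {x | ∀ i, x i ∈ 𝒪[K]}
  isCompact' := by
    have h : {x : Fin n → K | ∀ i, x i ∈ 𝒪[K]} = Metric.closedBall 0 1 := by
      ext x
      simp [Valued.integer.mem_iff, pi_norm_le_iff_of_nonneg]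
    exact h ▸ isCompact_closedBall (0 : Fin n → K) 1
  interior_nonempty' := by
    refine ⟨0, mem_interior_iff_mem_nhds.mpr ?_⟩
    refine Filter.mem_of_superset (Metric.closedBall_mem_nhds (0 : Fin n → K) one_pos) ?_
    intro x hx
    simpa [Valued.integer.mem_iff, pi_norm_le_iff_of_nonneg] using hx

/-- The Haar measure `|dx|` on `K ^ n`, normalized so that `R_K ^ n` has measure `1`. -/
noncomputable def haarK (K : Type*) [NontriviallyNormedField K] [PadicField K]
    [MeasurableSpace K] [BorelSpace K] (n : ℕ) : MeasureTheory.Measure (Fin n → K) :=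
  MeasureTheory.Measure.addHaarMeasure (integerBox K n)

/-- The integral `Z_U(s, f) = ∫_U ‖f(x)‖_K ^ s |dx|`; it is only used for `Re s > 0`. -/
noncomputable def zetaIntegral {K : Type*} [NontriviallyNormedField K] [PadicField K]
    [MeasurableSpace K] [BorelSpace K] {n l : ℕ} (U : Set (Fin n → K))
    (f : (Fin n → K) → (Fin l → K)) (s : ℂ) : ℂ :=
  ∫ x in U, ((maxAbs (f x) : ℝ) : ℂ) ^ s ∂(haarK K n)

/-- `W` is a meromorphic continuation to `ℂ` of the function `Z`, given for `Re s > 0`. -/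
def IsMeromorphicContinuation (Z W : ℂ → ℂ) : Prop :=
  MeromorphicOn W Set.univ ∧ ∀ s : ℂ, 0 < s.re → W s = Z s

/-- `Z` (given for `Re s > 0`) has a meromorphic continuation to `ℂ`, and `r` is the largest real
part of a pole of the continuation; in particular there is a pole with real part `r`. -/
def IsLargestPoleRealPart (Z : ℂ → ℂ) (r : ℝ) : Prop :=
  (∃ W, IsMeromorphicContinuation Z W) ∧
    ∀ W, IsMeromorphicContinuation Z W →
      IsGreatest {x : ℝ | ∃ s : ℂ, meromorphicOrderAt W s < 0 ∧ s.re = x} r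

/-! ### Newton polyhedra and strong non-degeneracy -/

/-- An exponent vector, regarded as a point of `ℝ ^ n`. -/
def realPoint {n : ℕ} (m : Fin n →₀ ℕ) : Fin n → ℝ := fun j => (m j : ℝ)

/-- The Newton polyhedron `Γ(G)`: the convex hull of `⋃_{m ∈ G} (m + ℝ_+ ^ n)`. -/
def newtonPolyhedron {n : ℕ} (G : Set (Fin n →₀ ℕ)) : Set (Fin n → ℝ) :=
  convexHull ℝ (⋃ m ∈ G, {x | realPoint m ≤ x})

/-- A face of `Γ`: a non-empty set on which a linear functional attains its maximum over `Γ`.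
The zero functional gives `Γ` itself. -/
def IsFace {n : ℕ} (Γ τ : Set (Fin n → ℝ)) : Prop :=
  τ.Nonempty ∧ IsExposed ℝ Γ τ

/-- The union of the supports of the power series `F_1, …, F_l`. -/
def unionSupport {K : Type*} [Field K] {n l : ℕ} (F : Fin l → MvPowerSeries (Fin n) K) :
    Set (Fin n →₀ ℕ) :=
  {m | ∃ i, MvPowerSeries.coeff m (F i) ≠ 0}

/-- The Newton polyhedron `Γ(F)` of a mapping with Taylor series `F_1, …, F_l` at the origin. -/
def mapPolyhedron {K : Type*} [Field K] {n l : ℕ} (F : Fin l → MvPowerSeries (Fin n) K) :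
    Set (Fin n → ℝ) :=
  newtonPolyhedron (unionSupport F)

/-- `g_τ = ∑_{m ∈ supp g ∩ τ} c_m x ^ m`, as a polynomial.  It is only used when `supp g ∩ τ` is
finite, that is, for compact `τ` or for polynomials `g`. -/
noncomputable def facePart {K : Type*} [Field K] {n : ℕ} (g : MvPowerSeries (Fin n) K)
    (τ : Set (Fin n → ℝ)) : MvPolynomial (Fin n) K :=
  ∑ᶠ (m : Fin n →₀ ℕ) (_ : realPoint m ∈ τ), MvPolynomial.monomial m (MvPowerSeries.coeff m g)

/-- The rank condition on `τ`: at every common zero `z ∈ (Kˣ) ^ n` of the `F_{i,τ}`, the Jacobian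
matrix of `(F_{1,τ}, …, F_{l,τ})` has rank `min {l, n}`. -/
def RankCondition {K : Type*} [Field K] {n l : ℕ} (F : Fin l → MvPowerSeries (Fin n) K)
    (τ : Set (Fin n → ℝ)) : Prop :=
  ∀ z : Fin n → K, (∀ j, z j ≠ 0) → (∀ i, MvPolynomial.eval z (facePart (F i) τ) = 0) →
    (Matrix.of fun (i : Fin l) (j : Fin n) =>
      MvPolynomial.eval z (MvPolynomial.pderiv j (facePart (F i) τ))).rank = min l n

/-- `f` is a non-constant mapping, analytic at the origin with Taylor series `F_1, …, F_l` there,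
and `f(0) = 0`; more precisely `f` is constant on no neighbourhood of the origin. -/
structure IsAnalyticMapAtOrigin {K : Type*} [NontriviallyNormedField K] {n l : ℕ}
    (f : (Fin n → K) → (Fin l → K)) (F : Fin l → MvPowerSeries (Fin n) K) : Prop where
  hasSum : ∀ i, ∀ᶠ x in 𝓝 (0 : Fin n → K),
    HasSum (fun m : Fin n →₀ ℕ => MvPowerSeries.coeff m (F i) * ∏ j, x j ^ m j) (f x i)
  map_zero : f 0 = 0
  not_const : ¬ ∀ᶠ x in 𝓝 (0 : Fin n → K), f x = f 0

/-- A mapping with Taylor series `F` at the origin is strongly non-degenerate at the origin with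
respect to `Γ(F)`. -/
def StronglyNondegenerateAtOrigin {K : Type*} [Field K] {n l : ℕ}
    (F : Fin l → MvPowerSeries (Fin n) K) : Prop :=
  ∀ τ, IsFace (mapPolyhedron F) τ → IsCompact τ → RankCondition F τ

/-- The mapping with Taylor series `F` at the origin (for polynomials: the polynomials themselves)
satisfies the rank condition on all faces of `Γ(F)`, compact or not, `Γ(F)` included. -/
def StronglyNondegenerate {K : Type*} [Field K] {n l : ℕ}
    (F : Fin l → MvPowerSeries (Fin n) K) : Prop :=
  ∀ τ, IsFace (mapPolyhedron F) τ → RankCondition F τ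

/-- The polynomial mapping `K ^ n → K ^ l` given by `P_1, …, P_l`. -/
noncomputable def polyMap {K : Type*} [Field K] {n l : ℕ} (P : Fin l → MvPolynomial (Fin n) K) :
    (Fin n → K) → (Fin l → K) :=
  fun x i => MvPolynomial.eval x (P i)

/-- The Taylor series at the origin of a polynomial mapping. -/
def polySeries {K : Type*} [Field K] {n l : ℕ} (P : Fin l → MvPolynomial (Fin n) K) :
    Fin l → MvPowerSeries (Fin n) K :=
  fun i => (P i : MvPowerSeries (Fin n) K)

end IgusaZeta

/-! The integral Z_U(s, f) is the Mellin transform of the distribution of ‖f‖_K on U. Such a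
transform continues when the distribution is built from point masses by finite sums and geometric
series: multiplying masses by ρ and positions by a at every step produces the factor (1 - ρ a^s)⁻¹
(`MellinContinues.geometric`). The distribution of ‖f‖_K turns out to have this shape, and all
ratios are less than 1 in absolute value for Re s > -1/t, where (t, …, t) is the diagonal point on
the boundary of Γ.

Toric coordinates. Off the coordinate hyperplanes, a null set, points are sorted by their vectors of
orders. The orthant of orders is cut into finitely many shifted cones k₀ + ∑ ℕ vᵢ on each of which a
single exponent m₀ of f minimizes m · vᵢ for all i at once; by Dickson's lemma only the signs of
finitely many linear forms matter (`exists_forms_minimizer`, `IsSubdivisible.of_isDefinite`). On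
such a cone f = θ^M g(u, θ), with u a vector of units, θᵢ = ϖ^aᵢ and Mᵢ = m₀ · vᵢ, and g still makes
sense when coordinates of θ are 0.

Compactness. The vectors with entries ϖ^a or 0 form a compact set. If the distribution of ‖g(·, θ)‖
on the torus of units is locally constant in θ on this set, it depends only on the numbers min(aᵢ,
N) for some N, and the sum over a becomes a finite combination of multiple geometric series with
ratios q^(-|vᵢ| - Mᵢ s) (`exists_mellin_conePiece`).

Non-degeneracy. At θ the map g(·, θ) is, up to an invertible monomial change, f_τ for the face τ on
which the weight ∑_{θᵢ = 0} vᵢ is least. At a zero of g the rank condition makes the derivative in u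
surjective or injective. If it is surjective, measure preserving coordinates turn g(·, θ) into one
linear map for all θ nearby, with possible poles on Re s = -l. If it is only injective, Euler's
identity shows that θ has no zero coordinate, so θ is isolated and local constancy is trivial; the
possible poles lie on Re s = -n. Near the origin compact faces suffice, because the weight is
strictly positive at all points over the origin.

The abscissa. Since (t, …, t) lies in the closure of Γ, Mᵢ ≤ t |vᵢ| and 1 ≤ t n, while t ≥ 1/l gives
-l ≤ -1/t; hence there is no pole with Re s > -1/t. Conversely a supporting hyperplane at (t, …, t)
gives a weight κ ≥ 0, and infinitely many disjoint shells of orders about i κ each contribute at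
least the same positive constant in the limit s → -1/t. The transform is therefore unbounded there
(`MellinContinues.unbounded_of_supporting_weight`) and has a pole. -/

namespace IgusaZeta

open MeasureTheory Set Filter Topology
open scoped NNReal ENNReal NormedField Valued

/-! ### Measures on the half-line whose Mellin transform continues meromorphically -/

/-- The Mellin transform `∫ x ^ s ∂ν` of a measure on `(0, ∞)` converges for `Re s > β`, where it is
equal to the analytic function `W`, and `W` is meromorphic on `ℂ`. -/
structure MellinContinues (β : ℝ) (ν : Measure ℝ) (W : ℂ → ℂ) : Prop where
  pos : ∀ᵐ x ∂ν, 0 < x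
  meromorphic : ∀ s, MeromorphicAt W s
  analytic : ∀ s : ℂ, β < s.re → AnalyticAt ℂ W s
  integrable : ∀ s : ℂ, β < s.re → Integrable (fun x : ℝ => (x : ℂ) ^ s) ν
  integral_eq : ∀ s : ℂ, β < s.re → ∫ x, ((x : ℝ) : ℂ) ^ s ∂ν = W s

/-- The measure `ρ ν(λ⁻¹ ·)`. -/
noncomputable def scaleMeasure (ρ : ℝ≥0) (a : ℝ) (ν : Measure ℝ) : Measure ℝ :=
  ρ • ν.map (fun x => a * x)

theorem scaleMeasure_scaleMeasure (ρ ρ' : ℝ≥0) (a a' : ℝ) (ν : Measure ℝ) :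
    scaleMeasure ρ a (scaleMeasure ρ' a' ν) = scaleMeasure (ρ * ρ') (a * a') ν := by
  unfold scaleMeasure
  rw [Measure.map_smul, Measure.map_map (by fun_prop) (by fun_prop), smul_smul]
  congr 2
  funext x
  simp [mul_assoc]

theorem scaleMeasure_sum {ι : Type*} (ρ : ℝ≥0) (a : ℝ) (ν : ι → Measure ℝ) :
    scaleMeasure ρ a (Measure.sum ν) = Measure.sum fun i => scaleMeasure ρ a (ν i) := by
  refine Measure.ext fun s hs => ?_
  have hm : Measurable fun x : ℝ => a * x := by fun_prop
  simp only [scaleMeasure, Measure.smul_apply, Measure.map_apply hm hs,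
    Measure.sum_apply _ (hm hs), Measure.sum_apply _ hs, ENNReal.smul_def, smul_eq_mul,
    ENNReal.tsum_mul_left]

theorem scaleMeasure_one (ν : Measure ℝ) : scaleMeasure 1 1 ν = ν := by
  simp [scaleMeasure]

theorem measure_sum_prod {ι κ : Type*} (ν : ι → κ → Measure ℝ) :
    (Measure.sum fun p : ι × κ => ν p.1 p.2) = Measure.sum fun i => Measure.sum (ν i) := by
  refine Measure.ext fun s hs => ?_
  simp only [Measure.sum_apply _ hs]
  exact ENNReal.tsum_prod (f := fun i k => ν i k s)

theorem measure_sum_equiv {ι κ : Type*} (e : ι ≃ κ) (ν : κ → Measure ℝ) :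
    (Measure.sum fun i => ν (e i)) = Measure.sum ν := by
  refine Measure.ext fun s hs => ?_
  simp only [Measure.sum_apply _ hs]
  exact e.tsum_eq fun k => ν k s

theorem measure_sum_eq_add_sum_add (ν : ℕ → Measure ℝ) (N : ℕ) :
    Measure.sum ν = ∑ i ∈ Finset.range N, ν i + Measure.sum fun i => ν (i + N) := by
  refine Measure.ext fun s hs => ?_
  simp only [Measure.sum_apply _ hs, Measure.add_apply, Measure.finsetSum_apply]
  exact (ENNReal.summable.sum_add_tsum_nat_add' (k := N)).symm

namespace MellinContinues

variable {β : ℝ} {ν ν' : Measure ℝ} {W W' : ℂ → ℂ}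

theorem zero (β : ℝ) : MellinContinues β 0 fun _ => 0 where
  pos := by simp
  meromorphic _ := MeromorphicAt.const 0 _
  analytic _ _ := analyticAt_const
  integrable _ _ := integrable_zero_measure
  integral_eq _ _ := by simp

theorem add (h : MellinContinues β ν W) (h' : MellinContinues β ν' W') :
    MellinContinues β (ν + ν') fun s => W s + W' s where
  pos := ae_add_measure_iff.mpr ⟨h.pos, h'.pos⟩
  meromorphic s := (h.meromorphic s).add (h'.meromorphic s)
  analytic s hs := (h.analytic s hs).add (h'.analytic s hs)
  integrable s hs := (h.integrable s hs).add_measure (h'.integrable s hs)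
  integral_eq s hs := by
    rw [integral_add_measure (h.integrable s hs) (h'.integrable s hs), h.integral_eq s hs,
      h'.integral_eq s hs]

theorem analyticAt_cpow {a : ℝ} (ha : 0 < a) (s : ℂ) : AnalyticAt ℂ (fun s => (a : ℂ) ^ s) s := by
  have h0 : (a : ℂ) ≠ 0 := by exact_mod_cast ha.ne'
  have h : (fun s : ℂ => (a : ℂ) ^ s) = fun s => Complex.exp (Complex.log a * s) := by
    funext s
    rw [Complex.cpow_def_of_ne_zero h0]
  rw [h]
  fun_prop

theorem scale (h : MellinContinues β ν W) (ρ : ℝ≥0) {a : ℝ} (ha : 0 < a) :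
    MellinContinues β (scaleMeasure ρ a ν) fun s => ρ * (a : ℂ) ^ s * W s := by
  have hm : Measurable fun x : ℝ => a * x := by fun_prop
  have hms (s : ℂ) : Measurable fun x : ℝ => (x : ℂ) ^ s := by fun_prop
  have key (s : ℂ) : (fun x : ℝ => ((a * x : ℝ) : ℂ) ^ s) =ᵐ[ν]
      fun x : ℝ => (a : ℂ) ^ s * (x : ℂ) ^ s := by
    filter_upwards [h.pos] with x hx
    rw [Complex.ofReal_mul, Complex.mul_cpow_ofReal_nonneg ha.le hx.le]
  refine ⟨?_, fun s => ?_, fun s hs => ?_, fun s hs => ?_, fun s hs => ?_⟩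
  · have h1 : ∀ᵐ x ∂ν.map (fun x => a * x), 0 < x := by
      rw [ae_map_iff hm.aemeasurable measurableSet_Ioi]
      filter_upwards [h.pos] with x hx using mul_pos ha hx
    exact Measure.ae_smul_measure h1 ρ
  · exact ((MeromorphicAt.const _ _).mul (analyticAt_cpow ha s).meromorphicAt).mul (h.meromorphic s)
  · exact (analyticAt_const.mul (analyticAt_cpow ha s)).mul (h.analytic s hs)
  · refine Integrable.smul_measure_nnreal ?_
    rw [integrable_map_measure (hms s).aestronglyMeasurable hm.aemeasurable]
    exact ((h.integrable s hs).const_mul _).congr (key s).symm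
  · rw [scaleMeasure, integral_smul_nnreal_measure,
      integral_map hm.aemeasurable (hms s).aestronglyMeasurable, integral_congr_ae (key s),
      integral_const_mul, h.integral_eq s hs, mul_assoc]
    simp [NNReal.smul_def]

/-- The b-th copy has transform (ρ a^s)^b W(s), and `hlt` makes this series converge for Re s > β.
Every pole of a continuation constructed below enters through the denominator produced here. -/
theorem geometric (h : MellinContinues β ν W) (ρ : ℝ≥0) {a : ℝ} (ha : 0 < a)
    (hlt : ∀ x : ℝ, β < x → ρ * a ^ x < 1) :
    MellinContinues β (Measure.sum fun b : ℕ => scaleMeasure (ρ ^ b) (a ^ b) ν)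
      fun s => (1 - ρ * (a : ℂ) ^ s)⁻¹ * W s := by
  have hb (b : ℕ) := h.scale (ρ ^ b) (pow_pos ha b)
  have hms (s : ℂ) : Measurable fun x : ℝ => (x : ℂ) ^ s := by fun_prop
  have hpow (s : ℂ) (b : ℕ) :
      ((ρ ^ b : ℝ≥0) : ℂ) * ((a ^ b : ℝ) : ℂ) ^ s = (ρ * (a : ℂ) ^ s) ^ b := by
    induction b with
    | zero => simp
    | succ b ih =>
      rw [pow_succ a, pow_succ ρ, Complex.ofReal_mul,
        Complex.mul_cpow_ofReal_nonneg (pow_pos ha b).le ha.le, pow_succ _ b, ← ih]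
      push_cast
      ring
  have hnorm (s : ℂ) (hs : β < s.re) : ‖(ρ : ℂ) * (a : ℂ) ^ s‖ < 1 := by
    rw [norm_mul, Complex.norm_cpow_eq_rpow_re_of_pos ha]
    simpa using hlt _ hs
  have hne (s : ℂ) (hs : β < s.re) : 1 - (ρ : ℂ) * (a : ℂ) ^ s ≠ 0 := fun h0 => by
    have := hnorm s hs
    rw [← sub_eq_zero.mp h0] at this
    simp at this
  have hterm (s : ℂ) (hs : β < s.re) (b : ℕ) :
      ∫ x : ℝ, (x : ℂ) ^ s ∂scaleMeasure (ρ ^ b) (a ^ b) ν = (ρ * (a : ℂ) ^ s) ^ b * W s := by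
    rw [(hb b).integral_eq s hs, hpow]
  have hint (s : ℂ) (hs : β < s.re) : Integrable (fun x : ℝ => (x : ℂ) ^ s)
      (Measure.sum fun b : ℕ => scaleMeasure (ρ ^ b) (a ^ b) ν) := by
    refine integrable_sum_measure (fun b => (hb b).integrable s hs) ?_
    have hre : β < ((s.re : ℝ) : ℂ).re := by simpa using hs
    -- For positive x the norm of x^s is x^(Re s), so absolute convergence at s follows from the
    -- same formula at the real point Re s.
    have h1 (b : ℕ) : ∫ x : ℝ, ‖(x : ℂ) ^ s‖ ∂scaleMeasure (ρ ^ b) (a ^ b) ν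
        = ‖(ρ : ℂ) * (a : ℂ) ^ ((s.re : ℝ) : ℂ)‖ ^ b * ‖W (s.re : ℝ)‖ := by
      rw [← norm_pow, ← norm_mul, ← hterm _ hre b]
      have h2 : ∫ x : ℝ, (x : ℂ) ^ ((s.re : ℝ) : ℂ) ∂scaleMeasure (ρ ^ b) (a ^ b) ν
          = ((∫ x : ℝ, ‖(x : ℂ) ^ s‖ ∂scaleMeasure (ρ ^ b) (a ^ b) ν : ℝ) : ℂ) := by
        refine Eq.trans ?_ integral_ofReal
        refine integral_congr_ae ?_
        filter_upwards [(hb b).pos] with x hx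
        rw [Complex.norm_cpow_eq_rpow_re_of_pos hx, ← Complex.ofReal_cpow hx.le]
        rfl
      rw [h2, Complex.norm_real, Real.norm_of_nonneg]
      exact integral_nonneg fun x => norm_nonneg _
    simp only [h1]
    exact (summable_geometric_of_lt_one (norm_nonneg _) (hnorm _ hre)).mul_right _
  refine ⟨?_, fun s => ?_, fun s hs => ?_, hint, fun s hs => ?_⟩
  · exact Measure.ae_sum_iff.mpr fun b => (hb b).pos
  · exact ((MeromorphicAt.const _ _).sub ((MeromorphicAt.const _ _).mul
      (analyticAt_cpow ha s).meromorphicAt)).inv.mul (h.meromorphic s)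
  · exact ((analyticAt_const.sub (analyticAt_const.mul (analyticAt_cpow ha s))).inv
      (hne s hs)).mul (h.analytic s hs)
  · rw [← (hasSum_integral_measure (hint s hs)).tsum_eq]
    simp only [hterm s hs]
    rw [tsum_mul_right, tsum_geometric_of_norm_lt_one (hnorm s hs)]

theorem dirac (β : ℝ) {x : ℝ} (hx : 0 < x) :
    MellinContinues β (Measure.dirac x) fun s => (x : ℂ) ^ s where
  pos := by rw [ae_dirac_eq]; exact hx
  meromorphic s := (analyticAt_cpow hx s).meromorphicAt
  analytic s _ := analyticAt_cpow hx s
  integrable s _ := integrable_dirac (by simp)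
  integral_eq s _ := by simp

theorem exists_smul (h : ∃ W, MellinContinues β ν W) {c : ℝ≥0∞} (hc : c ≠ ∞) :
    ∃ W, MellinContinues β (c • ν) W := by
  obtain ⟨W, h⟩ := h
  lift c to ℝ≥0 using hc
  have := h.scale c one_pos
  simp only [scaleMeasure, one_mul, Measure.map_id'] at this
  exact ⟨_, this⟩

theorem exists_finsetSum {ι : Type*} (t : Finset ι) (ν : ι → Measure ℝ)
    (h : ∀ i ∈ t, ∃ W, MellinContinues β (ν i) W) :
    ∃ W, MellinContinues β (∑ i ∈ t, ν i) W := by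
  classical
  induction t using Finset.induction_on with
  | empty => exact ⟨_, by simpa using zero β⟩
  | insert i t hi ih =>
    obtain ⟨W, hW⟩ := ih fun j hj => h j (Finset.mem_insert_of_mem hj)
    obtain ⟨W', hW'⟩ := h i (Finset.mem_insert_self _ _)
    rw [Finset.sum_insert hi]
    exact ⟨_, hW'.add hW⟩

/-- The terms with b < N form a finite sum; from N on the measures agree and the tail is one
geometric series. -/
theorem exists_sum_nat (ρ : ℝ≥0) {a : ℝ} (ha : 0 < a) (hlt : ∀ x : ℝ, β < x → ρ * a ^ x < 1)
    (G : ℕ → Measure ℝ) (N : ℕ) (hG : ∀ b, ∃ W, MellinContinues β (G b) W)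
    (hN : ∀ b, G b = G (min b N)) :
    ∃ W, MellinContinues β (Measure.sum fun b : ℕ => scaleMeasure (ρ ^ b) (a ^ b) (G b)) W := by
  have hsc (b : ℕ) : ∃ W, MellinContinues β (scaleMeasure (ρ ^ b) (a ^ b) (G b)) W := by
    obtain ⟨W, hW⟩ := hG b
    exact ⟨_, hW.scale _ (pow_pos ha b)⟩
  rw [measure_sum_eq_add_sum_add _ N]
  obtain ⟨W₁, h₁⟩ := exists_finsetSum (Finset.range N) _ fun b _ => hsc b
  obtain ⟨W₂, h₂⟩ := hsc N
  have h₃ : MellinContinues β _ _ := h₂.geometric ρ ha hlt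
  refine ⟨_, h₁.add (W' := fun s => (1 - ρ * (a : ℂ) ^ s)⁻¹ * W₂ s) ?_⟩
  convert! h₃ using 3 with b
  rw [scaleMeasure_scaleMeasure, hN (b + N), min_eq_right (Nat.le_add_left N b), pow_add, pow_add]

/-- Induction on the number of indices: with the first index b₀ fixed, the sum over the others is
covered by the induction hypothesis, and as a function of b₀ it is again constant from N on. -/
theorem exists_sum_pi {n : ℕ} (ρ : Fin n → ℝ≥0) (a : Fin n → ℝ) (ha : ∀ i, 0 < a i)
    (hlt : ∀ i, ∀ x : ℝ, β < x → ρ i * a i ^ x < 1) (G : (Fin n → ℕ) → Measure ℝ) (N : ℕ)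
    (hG : ∀ b, ∃ W, MellinContinues β (G b) W) (hN : ∀ b, G b = G fun i => min (b i) N) :
    ∃ W, MellinContinues β
      (Measure.sum fun b => scaleMeasure (∏ i, ρ i ^ b i) (∏ i, a i ^ b i) (G b)) W := by
  induction n with
  | zero =>
    obtain ⟨W, hW⟩ := hG default
    refine ⟨W, ?_⟩
    convert! hW using 1
    refine Measure.ext fun s hs => ?_
    rw [Measure.sum_apply _ hs,
      tsum_eq_single default (fun b hb => (hb (Subsingleton.elim _ _)).elim)]
    simp [scaleMeasure_one]
  | succ n ih =>
    have h1 (b₀ : ℕ) := ih (fun i => ρ i.succ) (fun i => a i.succ) (fun i => ha _)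
      (fun i => hlt _) (fun b => G (Fin.cons b₀ b)) (fun b => hG _) (fun b => by
        rw [hN, hN (Fin.cons b₀ fun i => min (b i) N)]
        congr 1
        funext i
        refine Fin.cases ?_ (fun i => ?_) i <;> simp)
    have h2 := exists_sum_nat (ρ 0) (ha 0) (hlt 0) (fun b₀ => Measure.sum fun b : Fin n → ℕ =>
        scaleMeasure (∏ i, ρ i.succ ^ b i) (∏ i, a i.succ ^ b i) (G (Fin.cons b₀ b))) N h1
      (fun b₀ => by
        congr 1
        funext b
        rw [hN, hN (Fin.cons (min b₀ N) b)]
        congr 2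
        funext i
        refine Fin.cases ?_ (fun i => ?_) i <;> simp)
    obtain ⟨W, hW⟩ := h2
    refine ⟨W, ?_⟩
    convert! hW using 1
    rw [← measure_sum_equiv (Fin.consEquiv fun _ : Fin (n + 1) => ℕ)]
    simp only [scaleMeasure_sum, scaleMeasure_scaleMeasure]
    rw [← measure_sum_prod]
    congr 1
    funext p
    simp [Fin.consEquiv, Fin.prod_univ_succ]

end MellinContinues

/-- By the identity theorem every continuation has the same orders as W, since the two agree near
the point 1. Analyticity for Re s > β excludes poles further to the right. At a point of nonnegative
order a meromorphic function has a finite limit, so unboundedness along the reals forces a pole at β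
itself. -/
theorem isLargestPoleRealPart_of_unbounded {β : ℝ} {Z W : ℂ → ℂ}
    (hmer : ∀ s, MeromorphicAt W s) (han : ∀ s : ℂ, β < s.re → AnalyticAt ℂ W s)
    (hZ : ∀ s : ℂ, 0 < s.re → W s = Z s)
    (hdiv : ∀ C : ℝ, ∀ᶠ x : ℝ in 𝓝[>] β, C ≤ ‖W x‖) : IsLargestPoleRealPart Z β := by
  refine ⟨⟨W, fun s _ => hmer s, hZ⟩, fun W' hW' => ?_⟩
  have hord (s : ℂ) : meromorphicOrderAt W' s = meromorphicOrderAt W s := by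
    refine meromorphicOrderAt_congr ?_
    have hm : MeromorphicOn (W' - W) univ := fun s hs => (hW'.1 s hs).sub (hmer s)
    have h1 : meromorphicOrderAt (W' - W) 1 = ⊤ := by
      rw [meromorphicOrderAt_eq_top_iff]
      refine eventually_nhdsWithin_of_eventually_nhds ?_
      have : ∀ᶠ s : ℂ in 𝓝 1, 0 < s.re :=
        (isOpen_lt continuous_const Complex.continuous_re).mem_nhds (by simp)
      filter_upwards [this] with s hs
      simp [hW'.2 s hs, hZ s hs]
    have h2 : meromorphicOrderAt (W' - W) s = ⊤ := by
      by_contra h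
      exact hm.meromorphicOrderAt_ne_top_of_isPreconnected isPreconnected_univ (mem_univ s)
        (mem_univ 1) h h1
    filter_upwards [meromorphicOrderAt_eq_top_iff.mp h2] with z hz
    exact sub_eq_zero.mp hz
  simp only [hord]
  refine ⟨⟨(β : ℂ), ?_, Complex.ofReal_re β⟩, ?_⟩
  · by_contra h
    obtain ⟨c, hc⟩ := tendsto_nhds_of_meromorphicOrderAt_nonneg (hmer β) (not_lt.mp h)
    have hcast : Tendsto (fun x : ℝ => (x : ℂ)) (𝓝[>] β) (𝓝[≠] (β : ℂ)) := by
      refine tendsto_nhdsWithin_iff.mpr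
        ⟨(Complex.continuous_ofReal.tendsto β).mono_left nhdsWithin_le_nhds, ?_⟩
      filter_upwards [self_mem_nhdsWithin] with x hx
      simpa using (ne_of_gt hx)
    have h1 : ∀ᶠ x : ℝ in 𝓝[>] β, ‖W x‖ < ‖c‖ + 1 :=
      (hc.comp hcast).norm.eventually_lt_const (lt_add_one _)
    obtain ⟨x, hx, hx'⟩ := (h1.and (hdiv (‖c‖ + 1))).exists
    exact absurd hx (not_lt.mpr hx')
  · rintro x ⟨s, hs, rfl⟩
    by_contra! h
    exact absurd hs (not_lt.mpr (han s h).meromorphicOrderAt_nonneg)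

/-! ### Subdivision of the positive orthant -/

section Subdivision

variable {n : ℕ}

/-- The exponent vector `k₀ + ∑ aᵢ vᵢ`. -/
def conePoint (k₀ : Fin n → ℕ) (v : Fin n → Fin n → ℕ) (a : Fin n → ℕ) : Fin n → ℕ :=
  fun j => k₀ j + ∑ i, a i * v i j

/-- The cone generators `v` with `v j` replaced by `v i + v j`. -/
def addGenerator (v : Fin n → Fin n → ℕ) (i j : Fin n) : Fin n → Fin n → ℕ :=
  Function.update v j (v i + v j)

/-- The value of the integral linear form `L` on an exponent vector. -/
def formValue (L : Fin n → ℤ) (k : Fin n → ℕ) : ℤ := ∑ j, L j * k j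

theorem formValue_add (L : Fin n → ℤ) (k k' : Fin n → ℕ) :
    formValue L (k + k') = formValue L k + formValue L k' := by
  simp [formValue, mul_add, Finset.sum_add_distrib]

theorem formValue_neg (L : Fin n → ℤ) (k : Fin n → ℕ) : formValue (-L) k = -formValue L k := by
  simp [formValue]

/-- A linear form is definite on the generators `v` if it does not change sign on them. -/
def IsDefinite (L : Fin n → ℤ) (v : Fin n → Fin n → ℕ) : Prop :=
  (∀ i, 0 ≤ formValue L (v i)) ∨ ∀ i, formValue L (v i) ≤ 0

theorem isDefinite_neg {L : Fin n → ℤ} {v : Fin n → Fin n → ℕ} :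
    IsDefinite (-L) v ↔ IsDefinite L v := by
  simp only [IsDefinite, formValue_neg, Left.nonneg_neg_iff, Left.neg_nonpos_iff]
  exact or_comm

theorem IsDefinite.addGenerator {L : Fin n → ℤ} {v : Fin n → Fin n → ℕ} (h : IsDefinite L v)
    (i j : Fin n) : IsDefinite L (addGenerator v i j) := by
  refine h.imp (fun h k => ?_) fun h k => ?_ <;>
  · by_cases hk : k = j
    · subst hk
      simp only [IgusaZeta.addGenerator, Function.update_self, formValue_add]
      linarith [h i, h k]
    · simpa [IgusaZeta.addGenerator, hk] using h k

/-- A property of pairs `(k₀, v)` which may be checked on the two halves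
`{aᵢ ≥ aⱼ}` and `{aᵢ < aⱼ}` of the cone. -/
def IsSubdivisible (Φ : (Fin n → ℕ) → (Fin n → Fin n → ℕ) → Prop) : Prop :=
  ∀ k₀ v i j, i ≠ j → Φ k₀ (addGenerator v i j) → Φ (k₀ + v j) (addGenerator v j i) → Φ k₀ v

variable {Φ : (Fin n → ℕ) → (Fin n → Fin n → ℕ) → Prop}

/-- Split along a generator of value b and one of negative value. In each half one of the two is
replaced by their sum, whose value lies in [0, b) because negative values are at least -a ≥ -b. So
the number of generators of value b or of negative value drops. The process stops when no value
equals b, so that the range has shrunk, or when none is negative, so that L is definite. -/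
theorem IsSubdivisible.of_bounded_count (hΦ : IsSubdivisible Φ) (P : (Fin n → Fin n → ℕ) → Prop)
    (hP : ∀ v i j, P v → P (addGenerator v i j)) (L : Fin n → ℤ) (a b : ℤ) (hab : a ≤ b)
    (hb : 0 < b)
    (h : ∀ k₀ v, P v → (∀ i, -a ≤ formValue L (v i)) → (∀ i, formValue L (v i) < b) → Φ k₀ v)
    (hdef : ∀ k₀ v, P v → IsDefinite L v → Φ k₀ v) (N : ℕ) :
    ∀ k₀ v, P v → (∀ i, -a ≤ formValue L (v i)) → (∀ i, formValue L (v i) ≤ b) →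
      (∑ i, if formValue L (v i) = b ∨ formValue L (v i) < 0 then 1 else 0) ≤ N → Φ k₀ v := by
  induction N with
  | zero =>
    intro k₀ v hv ha hb' hN
    refine hdef k₀ v hv (Or.inl fun i => ?_)
    have := (Finset.sum_eq_zero_iff.mp (Nat.le_zero.mp hN)) i (Finset.mem_univ i)
    by_contra! hneg
    simp [hneg] at this
  | succ N ih =>
    intro k₀ v hv ha hb' hN
    by_cases h1 : ∃ i, formValue L (v i) = b
    swap
    · push Not at h1
      exact h k₀ v hv ha fun i => lt_of_le_of_ne (hb' i) (h1 i)
    by_cases h2 : ∃ j, formValue L (v j) < 0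
    swap
    · push Not at h2
      exact hdef k₀ v hv (Or.inl h2)
    obtain ⟨i, hi⟩ := h1
    obtain ⟨j, hj⟩ := h2
    have hij : i ≠ j := by rintro rfl; omega
    have step (p p' : Fin n) (hsum : formValue L (v p + v p') = b + formValue L (v j))
        (hp' : formValue L (v p') = b ∨ formValue L (v p') < 0) (k : Fin n → ℕ) :
        Φ k (addGenerator v p p') := by
      have hval (m : Fin n) : formValue L (addGenerator v p p' m)
          = if m = p' then b + formValue L (v j) else formValue L (v m) := by
        by_cases hm : m = p'
        · subst hm; simp [addGenerator, hsum]
        · simp [addGenerator, hm]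
      have haj := ha j
      refine ih k _ (hP _ _ _ hv) (fun m => ?_) (fun m => ?_) ?_
      · rw [hval]; split_ifs
        · omega
        · exact ha m
      · rw [hval]; split_ifs
        · omega
        · exact hb' m
      · refine Nat.lt_succ_iff.mp (lt_of_lt_of_le (Finset.sum_lt_sum (fun m _ => ?_)
          ⟨p', Finset.mem_univ _, ?_⟩) hN)
        · rw [hval]
          by_cases hm : m = p'
          · subst hm
            rw [if_pos rfl, if_neg (by omega)]
            exact Nat.zero_le _
          · rw [if_neg hm]
        · rw [hval, if_pos rfl, if_neg (by omega), if_pos hp']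
          exact one_pos
    refine hΦ k₀ v i j hij (step i j ?_ (Or.inr hj) _) (step j i ?_ (Or.inl hi) _)
    · rw [formValue_add, hi]
    · rw [formValue_add, hi, add_comm]

/-- Induction on the length a + b of the range of values. Passing from L to -L exchanges a and b, so
a ≤ b may be assumed, as the counting argument requires. -/
theorem IsSubdivisible.of_bounded (hΦ : IsSubdivisible Φ) (P : (Fin n → Fin n → ℕ) → Prop)
    (hP : ∀ v i j, P v → P (addGenerator v i j)) (N : ℕ) :
    ∀ (L : Fin n → ℤ) (a b : ℕ), a + b ≤ N →
      (∀ k₀ v, P v → IsDefinite L v → Φ k₀ v) →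
      ∀ k₀ v, P v → (∀ i, -(a : ℤ) ≤ formValue L (v i)) → (∀ i, formValue L (v i) ≤ b) →
        Φ k₀ v := by
  induction N with
  | zero =>
    intro L a b hab hdef k₀ v hv _ hb
    obtain rfl : b = 0 := by omega
    exact hdef k₀ v hv (Or.inr hb)
  | succ N ih =>
    have main (L : Fin n → ℤ) (a b : ℕ) (hab : a + b ≤ N + 1) (hle : a ≤ b)
        (hdef : ∀ k₀ v, P v → IsDefinite L v → Φ k₀ v) (k₀ v) (hv : P v)
        (ha : ∀ i, -(a : ℤ) ≤ formValue L (v i)) (hb : ∀ i, formValue L (v i) ≤ b) : Φ k₀ v := by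
      rcases Nat.eq_zero_or_pos b with rfl | hpos
      · exact hdef k₀ v hv (Or.inr hb)
      · refine hΦ.of_bounded_count P hP L a b (by exact_mod_cast hle) (by exact_mod_cast hpos)
          (fun k₀ v hv ha hb => ih L a (b - 1) (by omega) hdef k₀ v hv ha fun i => ?_) hdef _
          k₀ v hv ha hb le_rfl
        have := hb i
        omega
    intro L a b hab hdef k₀ v hv ha hb
    rcases le_total a b with hle | hle
    · exact main L a b hab hle hdef k₀ v hv ha hb
    · refine main (-L) b a (by omega) hle (fun k₀ v hv h => hdef k₀ v hv (isDefinite_neg.mp h))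
        k₀ v hv (fun i => ?_) fun i => ?_
      · rw [formValue_neg]; linarith [hb i]
      · rw [formValue_neg]; linarith [ha i]

/-- The forms are made definite one after the other; further subdivision does not destroy what has
been achieved, by `IsDefinite.addGenerator`. -/
theorem IsSubdivisible.of_isDefinite (hΦ : IsSubdivisible Φ) (Ls : List (Fin n → ℤ))
    (h : ∀ k₀ v, (∀ L ∈ Ls, IsDefinite L v) → Φ k₀ v) : ∀ k₀ v, Φ k₀ v := by
  induction Ls with
  | nil => exact fun k₀ v => h k₀ v (by simp)
  | cons L Ls ih =>
    refine ih fun k₀ v hv => ?_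
    set B := ∑ i, (formValue L (v i)).natAbs
    have hB (i : Fin n) : (formValue L (v i)).natAbs ≤ B :=
      Finset.single_le_sum (f := fun i => (formValue L (v i)).natAbs) (fun _ _ => Nat.zero_le _)
        (Finset.mem_univ i)
    refine hΦ.of_bounded (fun v => ∀ L ∈ Ls, IsDefinite L v)
      (fun v i j hv L hL => (hv L hL).addGenerator i j) _ L B B le_rfl
      (fun k₀ v hv hL => h k₀ v ?_) k₀ v hv (fun i => ?_) fun i => ?_
    · rintro L' hL'
      rcases List.mem_cons.mp hL' with rfl | hL'
      · exact hL
      · exact hv L' hL'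
    · have := hB i; omega
    · have := hB i; omega

end Subdivision

/-! ### The normalized absolute value -/

section Field

variable {K : Type*} [NontriviallyNormedField K] [PadicField K]

/-- `ϖ` is a uniformizer of the `p`-adic field `K`. -/
structure IsUniformizer (ϖ : K) : Prop where
  norm_pos : 0 < ‖ϖ‖
  norm_lt_one : ‖ϖ‖ < 1
  exists_norm_eq : ∀ x : K, x ≠ 0 → ∃ k : ℤ, ‖x‖ = ‖ϖ‖ ^ k
  absK_self : absK ϖ = (residueCard K : ℝ)⁻¹

theorem one_lt_residueCard_real (K : Type*) [NontriviallyNormedField K] [PadicField K] :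
    (1 : ℝ) < residueCard K := by
  exact_mod_cast one_lt_residueCard K

theorem absK_mul (x y : K) : absK (x * y) = absK x * absK y := by
  unfold absK; exact map_mul _ _ _

theorem absK_zero : absK (0 : K) = 0 := by
  unfold absK; exact map_zero _

theorem absK_one : absK (1 : K) = 1 := by
  unfold absK; exact map_one _

theorem absK_pos {x : K} (hx : x ≠ 0) : 0 < absK x := by
  unfold absK; exact AbsoluteValue.pos _ hx

theorem absK_le_one {x : K} (hx : ‖x‖ ≤ 1) : absK x ≤ 1 := by
  unfold absK
  exact IsDedekindDomain.HeightOneSpectrum.adicAbv_coe_le_one (K := K) _ _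
    (⟨x, Valued.integer.mem_iff.mpr hx⟩ : 𝒪[K])

theorem absK_eq_one {x : K} (hx : ‖x‖ = 1) : absK x = 1 := by
  have hx0 : x ≠ 0 := norm_ne_zero_iff.mp (by simp [hx])
  refine le_antisymm (absK_le_one hx.le) ?_
  have h1 : absK x⁻¹ ≤ 1 := absK_le_one (by simp [hx])
  have h2 : absK x * absK x⁻¹ = 1 := by rw [← absK_mul, mul_inv_cancel₀ hx0, absK_one]
  nlinarith [absK_pos hx0]

variable (K) in
theorem exists_isUniformizer : ∃ ϖ : K, IsUniformizer ϖ := by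
  obtain ⟨p, hp⟩ := IsDiscreteValuationRing.exists_irreducible 𝒪[K]
  have hpos : 0 < ‖(p : K)‖ := Valued.integer.norm_irreducible_pos hp
  have hlt : ‖(p : K)‖ < 1 := Valued.integer.norm_irreducible_lt_one hp
  have hint (x : K) (hx : x ≠ 0) (hx1 : ‖x‖ ≤ 1) : ∃ k : ℕ, ‖x‖ = ‖(p : K)‖ ^ k := by
    obtain ⟨k, u, hu⟩ := IsDiscreteValuationRing.eq_unit_mul_pow_irreducible
      (x := (⟨x, Valued.integer.mem_iff.mpr hx1⟩ : 𝒪[K])) (fun h => hx (congrArg Subtype.val h)) hp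
    refine ⟨k, ?_⟩
    have := congrArg (fun y : 𝒪[K] => ‖(y : K)‖) hu
    simpa using this
  refine ⟨p, hpos, hlt, fun x hx => ?_, ?_⟩
  · rcases le_total ‖x‖ 1 with h | h
    · obtain ⟨k, hk⟩ := hint x hx h
      exact ⟨k, by simpa using hk⟩
    · obtain ⟨k, hk⟩ := hint x⁻¹ (inv_ne_zero hx) (by rw [norm_inv]; exact inv_le_one_of_one_le₀ h)
      refine ⟨-k, ?_⟩
      rw [zpow_neg, zpow_natCast, ← hk, norm_inv, inv_inv]
  · have h1 := (IsDiscreteValuationRing.maximalIdeal 𝒪[K]).intValuation_singleton hp.ne_zero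
      hp.maximalIdeal_eq
    unfold absK
    rw [show ((p : 𝒪[K]) : K) = algebraMap 𝒪[K] K p from rfl,
      IsDedekindDomain.HeightOneSpectrum.adicAbv_of_algebraMap]
    have h2 (e : ℝ≥0) (he : e ≠ 0) :
        WithZeroMulInt.toNNReal he (WithZero.exp (-1 : ℤ)) = e⁻¹ := by
      rw [WithZeroMulInt.toNNReal_neg_apply he WithZero.exp_ne_zero]
      change e ^ (-1 : ℤ) = e⁻¹
      simp
    simp only [IsDedekindDomain.HeightOneSpectrum.intAdicAbv,
      IsDedekindDomain.HeightOneSpectrum.intAdicAbvDef, AbsoluteValue.coe_mk, MulHom.coe_mk, h1, h2]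
    simp

namespace IsUniformizer

variable {ϖ : K}

theorem ne_zero (h : IsUniformizer ϖ) : ϖ ≠ 0 := norm_pos_iff.mp h.norm_pos

theorem absK_zpow (h : IsUniformizer ϖ) {x : K} {k : ℤ} (hx : ‖x‖ = ‖ϖ‖ ^ k) :
    absK x = (residueCard K : ℝ) ^ (-k) := by
  have hp (m : ℕ) : absK (ϖ ^ m) = (residueCard K : ℝ)⁻¹ ^ m := by
    induction m with
    | zero => simp [absK_one]
    | succ m ih => rw [pow_succ, absK_mul, ih, pow_succ, h.absK_self]
  have hz : absK (ϖ ^ k) = (residueCard K : ℝ)⁻¹ ^ k := by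
    cases k with
    | ofNat m => simpa using hp m
    | negSucc m =>
      have h1 : absK (ϖ ^ (Int.negSucc m)) * absK (ϖ ^ (m + 1)) = 1 := by
        rw [← absK_mul, zpow_negSucc, inv_mul_cancel₀ (pow_ne_zero _ h.ne_zero), absK_one]
      rw [hp] at h1
      rw [eq_inv_of_mul_eq_one_left h1, zpow_negSucc]
  have hu : absK (x * (ϖ ^ k)⁻¹) = 1 := by
    refine absK_eq_one ?_
    rw [norm_mul, norm_inv, norm_zpow, hx, mul_inv_cancel₀ (zpow_ne_zero _ h.norm_pos.ne')]
  have : absK x = absK (x * (ϖ ^ k)⁻¹) * absK (ϖ ^ k) := by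
    rw [← absK_mul, inv_mul_cancel_right₀ (zpow_ne_zero _ h.ne_zero)]
  rw [this, hu, hz, one_mul, inv_zpow, zpow_neg]

/-- The normalized absolute value is a power of the norm. -/
theorem exists_maxAbs_eq_rpow (h : IsUniformizer ϖ) :
    ∃ c : ℝ, 0 < c ∧ ‖ϖ‖ ^ c = (residueCard K : ℝ)⁻¹ ∧
      ∀ (l : ℕ) (z : Fin l → K), maxAbs z = ‖z‖ ^ c := by
  have hq := one_lt_residueCard_real K
  have hlog : Real.log ‖ϖ‖ < 0 := Real.log_neg h.norm_pos h.norm_lt_one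
  set c := Real.log (residueCard K) / -Real.log ‖ϖ‖ with hcdef
  have hc : 0 < c := div_pos (Real.log_pos hq) (by linarith)
  have hϖ : ‖ϖ‖ ^ c = (residueCard K : ℝ)⁻¹ := by
    rw [Real.rpow_def_of_pos h.norm_pos, hcdef,
      show Real.log ‖ϖ‖ * (Real.log (residueCard K) / -Real.log ‖ϖ‖) = -Real.log (residueCard K) by
        have := hlog.ne
        field_simp, Real.exp_neg, Real.exp_log (by linarith)]
  have habs (x : K) : absK x = ‖x‖ ^ c := by
    by_cases hx : x = 0
    · simp [hx, absK_zero, Real.zero_rpow hc.ne']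
    · obtain ⟨k, hk⟩ := h.exists_norm_eq x hx
      rw [h.absK_zpow hk, hk, ← Real.rpow_intCast ‖ϖ‖ k, ← Real.rpow_mul h.norm_pos.le, mul_comm,
        Real.rpow_mul h.norm_pos.le, hϖ, Real.rpow_intCast, inv_zpow, zpow_neg]
  refine ⟨c, hc, hϖ, fun l z => ?_⟩
  unfold maxAbs
  simp only [habs]
  have hbdd : BddAbove (Set.range fun i => ‖z i‖ ^ c) := (Set.finite_range _).bddAbove
  have hnn : 0 ≤ ⨆ i, ‖z i‖ ^ c := Real.iSup_nonneg fun i => by positivity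
  refine le_antisymm (Real.iSup_le (fun i => ?_) (by positivity)) ?_
  · exact Real.rpow_le_rpow (norm_nonneg _) (norm_le_pi_norm z i) hc.le
  · rw [← Real.le_rpow_inv_iff_of_pos (norm_nonneg _) hnn hc]
    refine (pi_norm_le_iff_of_nonneg (by positivity)).mpr fun i => ?_
    rw [Real.le_rpow_inv_iff_of_pos (norm_nonneg _) hnn hc]
    exact le_ciSup hbdd i

theorem norm_le_of_lt_one (h : IsUniformizer ϖ) {x : K} (hx : ‖x‖ < 1) : ‖x‖ ≤ ‖ϖ‖ := by
  by_cases hx0 : x = 0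
  · simp [hx0]
  obtain ⟨k, hk⟩ := h.exists_norm_eq x hx0
  rw [hk] at hx ⊢
  have : 0 < k := by
    by_contra! hk'
    exact absurd hx (not_lt.mpr (one_le_zpow_of_nonpos₀ h.norm_pos h.norm_lt_one.le hk'))
  calc ‖ϖ‖ ^ k ≤ ‖ϖ‖ ^ (1 : ℤ) :=
        zpow_le_zpow_right_of_le_one₀ h.norm_pos h.norm_lt_one.le (by omega)
    _ = ‖ϖ‖ := zpow_one _

theorem exists_norm_pi_eq (h : IsUniformizer ϖ) {l : ℕ} {z : Fin l → K} (hz : z ≠ 0) :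
    ∃ k : ℤ, ‖z‖ = ‖ϖ‖ ^ k := by
  obtain ⟨i₀, hi₀⟩ := Function.ne_iff.mp hz
  obtain ⟨i, -, hi⟩ := Finset.exists_max_image Finset.univ (fun i => ‖z i‖) ⟨i₀, Finset.mem_univ _⟩
  have hzi : ‖z‖ = ‖z i‖ := le_antisymm ((pi_norm_le_iff_of_nonneg (norm_nonneg _)).mpr
    fun j => hi j (Finset.mem_univ j)) (norm_le_pi_norm z i)
  rw [hzi]
  exact h.exists_norm_eq _ (norm_pos_iff.mp (lt_of_lt_of_le (norm_pos_iff.mpr hi₀)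
    (hi i₀ (Finset.mem_univ _))))

/-- Representatives of the residue classes. -/
theorem exists_residue_reps (h : IsUniformizer ϖ) :
    ∃ rep : 𝓀[K] → K, (∀ y, ‖rep y‖ ≤ 1) ∧
      ∀ x : K, ‖x‖ ≤ 1 → ∃ y, ∀ y', ‖x - rep y'‖ ≤ ‖ϖ‖ ↔ y' = y := by
  choose rep hrep using IsLocalRing.residue_surjective (R := 𝒪[K])
  refine ⟨fun y => rep y, fun y => Valued.integer.norm_le_one _, fun x hx =>
    ⟨IsLocalRing.residue _ (⟨x, Valued.integer.mem_iff.mpr hx⟩ : 𝒪[K]), fun y' => ?_⟩⟩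
  set x' : 𝒪[K] := ⟨x, Valued.integer.mem_iff.mpr hx⟩
  have h1 : ‖x - rep y'‖ ≤ ‖ϖ‖ ↔ ¬ IsUnit (x' - rep y') := by
    rw [Valued.integer.isUnit_iff_norm_eq_one]
    have hle : ‖x' - rep y'‖ ≤ 1 := Valued.integer.norm_le_one _
    change ‖((x' - rep y' : 𝒪[K]) : K)‖ ≤ ‖ϖ‖ ↔ ¬ ‖((x' - rep y' : 𝒪[K]) : K)‖ = 1
    constructor
    · intro h2 h3
      rw [h3] at h2
      exact absurd h.norm_lt_one (not_lt.mpr h2)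
    · intro h2
      exact h.norm_le_of_lt_one (lt_of_le_of_ne hle h2)
  rw [h1, ← mem_nonunits_iff, ← IsLocalRing.mem_maximalIdeal, ← IsLocalRing.residue_eq_zero_iff,
    map_sub, hrep, sub_eq_zero, eq_comm]

end IsUniformizer
end Field

/-! ### Haar measure -/

section Haar

variable {K : Type*} [NontriviallyNormedField K] [PadicField K] [MeasurableSpace K] [BorelSpace K]

instance (n : ℕ) : (haarK K n).IsAddHaarMeasure := by unfold haarK; infer_instance

/-- If `A` maps the subgroup `S` onto a ball in `K ^ l`, then the measure of
`{w ∈ S | ‖A w‖ ≤ ‖ϖ‖ ^ j}` is multiplied by `q ^ (-l)` when `j` is increased by one. -/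
theorem IsUniformizer.measure_norm_le_zpow {ϖ : K} (h : IsUniformizer ϖ) {n l : ℕ}
    (A : (Fin n → K) →ₗ[K] (Fin l → K)) (S : AddSubgroup (Fin n → K))
    (hS : MeasurableSet (S : Set (Fin n → K))) (j : ℤ)
    (hA : ∀ y, ‖y‖ ≤ ‖ϖ‖ ^ j → ∃ w ∈ S, A w = y) :
    haarK K n {w | w ∈ S ∧ ‖A w‖ ≤ ‖ϖ‖ ^ j} =
      (residueCard K : ℝ≥0∞) ^ l * haarK K n {w | w ∈ S ∧ ‖A w‖ ≤ ‖ϖ‖ ^ (j + 1)} := by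
  obtain ⟨rep, hrep1, hrep⟩ := h.exists_residue_reps
  have hϖj : 0 < ‖ϖ‖ ^ j := zpow_pos h.norm_pos j
  have hpos1 : 0 < ‖ϖ‖ ^ (j + 1) := zpow_pos h.norm_pos _
  -- The vectors ϖ^j · rep(y) represent the q^l cosets of the ball of radius ‖ϖ‖^(j+1) in the ball
  -- of radius ‖ϖ‖^j. Their lifts to S cut the larger set into q^l disjoint translates of the
  -- smaller one.
  have hlift (y : Fin l → 𝓀[K]) : ∃ w ∈ S, A w = fun i => ϖ ^ j * rep (y i) := by
    refine hA _ ((pi_norm_le_iff_of_nonneg hϖj.le).mpr fun i => ?_)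
    rw [norm_mul, norm_zpow]
    exact mul_le_of_le_one_right hϖj.le (hrep1 _)
  choose w hwS hw using hlift
  set D := {w | w ∈ S ∧ ‖A w‖ ≤ ‖ϖ‖ ^ (j + 1)} with hD
  have hDm : MeasurableSet D := by
    refine hS.inter ?_
    exact ((LinearMap.continuous_of_finiteDimensional A).norm.measurable) measurableSet_Iic
  have hiff (x : Fin n → K) (hx : ‖A x‖ ≤ ‖ϖ‖ ^ j) :
      ∃ y, ∀ y', ‖A (x - w y')‖ ≤ ‖ϖ‖ ^ (j + 1) ↔ y' = y := by
    have hxi (i : Fin l) : ‖(ϖ ^ j)⁻¹ * A x i‖ ≤ 1 := by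
      rw [norm_mul, norm_inv, norm_zpow, inv_mul_le_iff₀ hϖj, mul_one]
      exact (norm_le_pi_norm _ i).trans hx
    choose y hy using fun i => hrep _ (hxi i)
    refine ⟨y, fun y' => ?_⟩
    rw [pi_norm_le_iff_of_nonneg hpos1.le, funext_iff]
    refine forall_congr' fun i => ?_
    rw [← hy i (y' i), map_sub, hw]
    have : (A x - fun i => ϖ ^ j * rep (y' i)) i = ϖ ^ j * ((ϖ ^ j)⁻¹ * A x i - rep (y' i)) := by
      rw [mul_sub, mul_inv_cancel_left₀ (zpow_ne_zero _ h.ne_zero)]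
      rfl
    rw [this, norm_mul, norm_zpow, zpow_add₀ h.norm_pos.ne', zpow_one,
      mul_le_mul_iff_right₀ hϖj]
  have hunion : {w | w ∈ S ∧ ‖A w‖ ≤ ‖ϖ‖ ^ j} = ⋃ y, (fun x => x + -w y) ⁻¹' D := by
    ext x
    simp only [mem_ofPred_eq, mem_iUnion, mem_preimage, hD, ← sub_eq_add_neg]
    constructor
    · rintro ⟨hxS, hx⟩
      obtain ⟨y, hy⟩ := hiff x hx
      exact ⟨y, S.sub_mem hxS (hwS y), (hy y).mpr rfl⟩
    · rintro ⟨y, h1, h2⟩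
      refine ⟨by simpa using S.add_mem h1 (hwS y), ?_⟩
      have h3 : A x = A (x - w y) + A (w y) := by rw [← map_add, sub_add_cancel]
      rw [h3]
      refine (IsUltrametricDist.norm_add_le_max _ _).trans (max_le (h2.trans ?_) ?_)
      · exact zpow_le_zpow_right_of_le_one₀ h.norm_pos h.norm_lt_one.le (by omega)
      · rw [hw]
        refine (pi_norm_le_iff_of_nonneg hϖj.le).mpr fun i => ?_
        rw [norm_mul, norm_zpow]
        exact mul_le_of_le_one_right hϖj.le (hrep1 _)
  have hdisj : Pairwise (Function.onFun Disjoint fun y => (fun x => x + -w y) ⁻¹' D) := by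
    intro y₁ y₂ hne
    refine Set.disjoint_left.mpr fun x hx1 hx2 => hne ?_
    have hx : x ∈ {w | w ∈ S ∧ ‖A w‖ ≤ ‖ϖ‖ ^ j} := hunion ▸ mem_iUnion.mpr ⟨y₁, hx1⟩
    obtain ⟨y, hy⟩ := hiff x hx.2
    simp only [mem_preimage, hD, ← sub_eq_add_neg] at hx1 hx2
    rw [(hy y₁).mp hx1.2, (hy y₂).mp hx2.2]
  have := Fintype.ofFinite 𝓀[K]
  rw [hunion, measure_iUnion hdisj fun y => (measurable_add_const (-w y)) hDm]
  simp only [measure_preimage_add_right, tsum_fintype, Finset.sum_const, Finset.card_univ,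
    nsmul_eq_mul, Fintype.card_fun, Fintype.card_fin]
  simp [residueCard, Nat.card_eq_fintype_card]

end Haar

/-! ### Haar measure under multiplication of coordinates by powers of a uniformizer -/

section HaarScaling

variable {K : Type*} [NontriviallyNormedField K] [PadicField K]

theorem residueCard_ennreal_ne_zero (K : Type*) [NontriviallyNormedField K] [PadicField K] :
    (residueCard K : ℝ≥0∞) ≠ 0 := by
  have := one_lt_residueCard K
  simp only [ne_eq, Nat.cast_eq_zero]
  rintro h
  simp [h] at this

theorem mem_integerBox_iff {n : ℕ} {x : Fin n → K} :
    x ∈ (integerBox K n : Set (Fin n → K)) ↔ ∀ i, ‖x i‖ ≤ 1 := by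
  change (∀ i, x i ∈ 𝒪[K]) ↔ _
  simp only [Valued.integer.mem_iff]

theorem integerBox_eq_closedBall (n : ℕ) :
    (integerBox K n : Set (Fin n → K)) = Metric.closedBall 0 1 := by
  ext x
  rw [mem_integerBox_iff, mem_closedBall_zero_iff, pi_norm_le_iff_of_nonneg zero_le_one]

/-- Multiplication of the coordinates by powers of `ϖ`. -/
def monomialScale (ϖ : K) {n : ℕ} (k : Fin n → ℕ) (x : Fin n → K) : Fin n → K :=
  fun j => ϖ ^ k j * x j

theorem continuous_monomialScale (ϖ : K) {n : ℕ} (k : Fin n → ℕ) :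
    Continuous (monomialScale ϖ k) := by
  unfold monomialScale; fun_prop

variable [MeasurableSpace K] [BorelSpace K] {ϖ : K}

theorem haarK_integerBox (n : ℕ) : haarK K n (integerBox K n) = 1 :=
  Measure.addHaarMeasure_self

/-- The image is again a Haar measure, so by uniqueness only the mass it gives to the unit polydisc
matters. That is the measure of the polydisc whose j-th radius is ‖ϖ‖⁻¹, which is q by
`measure_norm_le_zpow` for the j-th coordinate. -/
theorem IsUniformizer.map_monomialScale_single (h : IsUniformizer ϖ) {n : ℕ} (j : Fin n) :
    (haarK K n).map (monomialScale ϖ (Pi.single j 1)) = (residueCard K : ℝ≥0∞) • haarK K n := by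
  have hc := continuous_monomialScale ϖ (Pi.single j 1 : Fin n → ℕ)
  have hne (i : Fin n) : ϖ ^ (Pi.single j 1 : Fin n → ℕ) i ≠ 0 := pow_ne_zero _ h.ne_zero
  let e : (Fin n → K) ≃+ (Fin n → K) :=
    { toFun := monomialScale ϖ (Pi.single j 1)
      invFun := fun x i => (ϖ ^ (Pi.single j 1 : Fin n → ℕ) i)⁻¹ * x i
      left_inv := fun x => by
        funext i
        simp only [monomialScale]
        rw [inv_mul_cancel_left₀ (hne i)]
      right_inv := fun x => by
        funext i
        simp only [monomialScale]
        rw [mul_inv_cancel_left₀ (hne i)]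
      map_add' := fun x y => by
        funext i
        simp [monomialScale, mul_add] }
  have hmap : ((haarK K n).map (monomialScale ϖ (Pi.single j 1))).IsAddHaarMeasure :=
    e.isAddHaarMeasure_map (haarK K n) hc (by
      change Continuous fun x : Fin n → K => fun i => (ϖ ^ (Pi.single j 1 : Fin n → ℕ) i)⁻¹ * x i
      fun_prop)
  rw [Measure.addHaarMeasure_unique ((haarK K n).map (monomialScale ϖ (Pi.single j 1)))
    (integerBox K n)]
  change _ • haarK K n = _
  congr 1
  rw [Measure.map_apply hc.measurable (integerBox K n).isCompact.measurableSet]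
  let S : AddSubgroup (Fin n → K) :=
    { carrier := {x | ∀ i, i ≠ j → ‖x i‖ ≤ 1}
      add_mem' := fun {x y} hx hy i hi =>
        (IsUltrametricDist.norm_add_le_max _ _).trans (max_le (hx i hi) (hy i hi))
      zero_mem' := fun i _ => by simp
      neg_mem' := fun {x} hx i hi => by simpa using hx i hi }
  have hS : IsClosed (S : Set (Fin n → K)) := by
    change IsClosed {x : Fin n → K | ∀ i, i ≠ j → ‖x i‖ ≤ 1}
    simp only [ofPred_forall]
    exact isClosed_iInter fun i => isClosed_iInter fun _ =>
      isClosed_le (by fun_prop) continuous_const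
  have key := h.measure_norm_le_zpow (l := 1) (LinearMap.pi fun _ => LinearMap.proj j) S
    hS.measurableSet (-1) (fun y _ => ⟨Pi.single j (y 0), fun i hi => by simp [hi], by
      funext i
      simp [Subsingleton.elim i 0]⟩)
  have hval (x : Fin n → K) :
      ‖(LinearMap.pi fun _ : Fin 1 => LinearMap.proj (R := K) j) x‖ = ‖x j‖ := by
    refine le_antisymm ((pi_norm_le_iff_of_nonneg (norm_nonneg _)).mpr fun i => by simp) ?_
    exact norm_le_pi_norm ((LinearMap.pi fun _ : Fin 1 => LinearMap.proj (R := K) j) x) 0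
  simp only [hval] at key
  have e1 : monomialScale ϖ (Pi.single j 1) ⁻¹' (integerBox K n : Set (Fin n → K))
      = {w | w ∈ S ∧ ‖w j‖ ≤ ‖ϖ‖ ^ (-1 : ℤ)} := by
    ext x
    rw [mem_preimage, mem_integerBox_iff]
    change _ ↔ (∀ i, i ≠ j → ‖x i‖ ≤ 1) ∧ _
    constructor
    · refine fun hx => ⟨fun i hi => by simpa [monomialScale, hi] using hx i, ?_⟩
      have := hx j
      simp only [monomialScale, Pi.single_eq_same, pow_one, norm_mul] at this
      rw [zpow_neg_one]
      exact (le_inv_mul_iff₀ h.norm_pos).mpr this |>.trans (by simp)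
    · rintro ⟨hx, hxj⟩ i
      by_cases hi : i = j
      · subst hi
        simp only [monomialScale, Pi.single_eq_same, pow_one, norm_mul]
        rw [zpow_neg_one] at hxj
        calc ‖ϖ‖ * ‖x i‖ ≤ ‖ϖ‖ * ‖ϖ‖⁻¹ := by gcongr
          _ = 1 := mul_inv_cancel₀ h.norm_pos.ne'
      · simpa [monomialScale, hi] using hx i hi
  have e2 : {w | w ∈ S ∧ ‖w j‖ ≤ ‖ϖ‖ ^ (-1 + 1 : ℤ)} = (integerBox K n : Set (Fin n → K)) := by
    ext x
    rw [mem_integerBox_iff]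
    change (∀ i, i ≠ j → ‖x i‖ ≤ 1) ∧ ‖x j‖ ≤ ‖ϖ‖ ^ (-1 + 1 : ℤ) ↔ _
    simp only [neg_add_cancel, zpow_zero]
    constructor
    · rintro ⟨hx, hxj⟩ i
      by_cases hi : i = j
      · exact hi ▸ hxj
      · exact hx i hi
    · exact fun hx => ⟨fun i _ => hx i, hx j⟩
  rw [e1, key, e2, haarK_integerBox, pow_one, mul_one]

theorem IsUniformizer.map_monomialScale (h : IsUniformizer ϖ) {n : ℕ} (k : Fin n → ℕ) :
    (haarK K n).map (monomialScale ϖ k) = (residueCard K : ℝ≥0∞) ^ (∑ j, k j) • haarK K n := by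
  induction hN : ∑ j, k j generalizing k with
  | zero =>
    obtain rfl : k = 0 := by
      funext j
      exact (Finset.sum_eq_zero_iff.mp hN) j (Finset.mem_univ j)
    have : monomialScale ϖ (0 : Fin n → ℕ) = id := by funext x j; simp [monomialScale]
    rw [this, Measure.map_id, pow_zero, one_smul]
  | succ N ih =>
    obtain ⟨j, hj⟩ : ∃ j, k j ≠ 0 := by
      by_contra! h0
      simp [h0] at hN
    obtain ⟨k', rfl⟩ : ∃ k' : Fin n → ℕ, k = k' + (Pi.single j 1 : Fin n → ℕ) := by
      refine ⟨fun i => k i - (Pi.single j 1 : Fin n → ℕ) i, ?_⟩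
      funext i
      change k i = (k i - (Pi.single j 1 : Fin n → ℕ) i) + (Pi.single j 1 : Fin n → ℕ) i
      by_cases hi : i = j
      · subst hi
        rw [Pi.single_eq_same]
        omega
      · simp [hi]
    have hcomp : monomialScale ϖ (k' + Pi.single j 1)
        = monomialScale ϖ k' ∘ monomialScale ϖ (Pi.single j 1) := by
      funext x i
      simp only [monomialScale, Function.comp, Pi.add_apply, pow_add]
      ring
    rw [hcomp, ← Measure.map_map (continuous_monomialScale ϖ _).measurable
      (continuous_monomialScale ϖ _).measurable, h.map_monomialScale_single, Measure.map_smul,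
      ih k' (by simpa [Finset.sum_add_distrib] using hN), smul_smul, pow_succ']

theorem IsUniformizer.restrict_image_monomialScale (h : IsUniformizer ϖ) {n : ℕ} (k : Fin n → ℕ)
    (E : Set (Fin n → K)) :
    (haarK K n).restrict (monomialScale ϖ k '' E) =
      ((residueCard K : ℝ≥0∞)⁻¹) ^ (∑ j, k j) •
        ((haarK K n).restrict E).map (monomialScale ϖ k) := by
  have hinj : Function.Injective (monomialScale ϖ k) := fun x y hxy => by
    funext j
    exact mul_left_cancel₀ (pow_ne_zero _ h.ne_zero) (congrFun hxy j)
  have hcl : MeasurableEmbedding (monomialScale ϖ k) :=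
    (continuous_monomialScale ϖ k).measurableEmbedding hinj
  have h1 : (haarK K n).restrict (monomialScale ϖ k '' E) =
      ((residueCard K : ℝ≥0∞)⁻¹) ^ (∑ j, k j) •
        ((haarK K n).map (monomialScale ϖ k)).restrict (monomialScale ϖ k '' E) := by
    rw [h.map_monomialScale, Measure.restrict_smul, smul_smul, ← ENNReal.inv_pow,
      ENNReal.inv_mul_cancel (pow_ne_zero _ (residueCard_ennreal_ne_zero K))
        (ENNReal.pow_ne_top (ENNReal.natCast_ne_top _)), one_smul]
  rw [h1, hcl.restrict_map, preimage_image_eq _ hinj]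

end HaarScaling

/-! ### Perturbations of the identity in ultrametric spaces -/

section NearIdentity

variable {E : Type*} [NormedAddCommGroup E] [IsUltrametricDist E]

theorem norm_sub_le_max_of_ultrametric (x y : E) : ‖x - y‖ ≤ max ‖x‖ ‖y‖ := by
  rw [sub_eq_add_neg, ← norm_neg y]
  exact IsUltrametricDist.norm_add_le_max _ _

theorem norm_eq_of_norm_sub_lt {x y : E} (h : ‖x - y‖ < ‖y‖) : ‖x‖ = ‖y‖ := by
  refine le_antisymm ?_ ?_
  · calc ‖x‖ = ‖(x - y) + y‖ := by rw [sub_add_cancel]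
      _ ≤ max ‖x - y‖ ‖y‖ := IsUltrametricDist.norm_add_le_max _ _
      _ = ‖y‖ := max_eq_right h.le
  · by_contra! hlt
    have : ‖y‖ ≤ max ‖x‖ ‖x - y‖ := by
      calc ‖y‖ = ‖x - (x - y)‖ := by rw [sub_sub_cancel]
        _ ≤ max ‖x‖ ‖x - y‖ := norm_sub_le_max_of_ultrametric _ _
    exact absurd this (not_le.mpr (max_lt hlt h))

/-- `ψ` differs from the identity on the ball by a map with Lipschitz constant less than one. -/
def IsNearIdentityOn (ψ : E → E) (c : E) (δ : ℝ) : Prop :=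
  ∀ x ∈ Metric.ball c δ, ∀ y ∈ Metric.ball c δ,
    ‖ψ x - ψ y - (x - y)‖ ≤ (1 / 2 : ℝ) * ‖x - y‖

variable {ψ : E → E} {c : E} {δ : ℝ}

/-- Ultrametrically, an error smaller than ‖x - y‖ does not change the norm; so ψ is an isometry on
the ball. -/
theorem IsNearIdentityOn.norm_sub (h : IsNearIdentityOn ψ c δ) {x y : E}
    (hx : x ∈ Metric.ball c δ) (hy : y ∈ Metric.ball c δ) : ‖ψ x - ψ y‖ = ‖x - y‖ := by
  by_cases hxy : x = y
  · simp [hxy]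
  have hpos : 0 < ‖x - y‖ := norm_pos_iff.mpr (sub_ne_zero.mpr hxy)
  exact norm_eq_of_norm_sub_lt ((h x hx y hy).trans_lt (by linarith))

/-- Solutions of ψ x = y are the fixed points of x ↦ y - (ψ x - x), a contraction of the ball. Open
ultrametric balls are closed, hence complete here. -/
theorem IsNearIdentityOn.surjOn [CompleteSpace E] (h : IsNearIdentityOn ψ c δ) :
    SurjOn ψ (Metric.ball c δ) (Metric.ball (ψ c) δ) := by
  intro y hy
  have hδ : 0 < δ := Metric.pos_of_mem_ball hy
  have hc : c ∈ Metric.ball c δ := Metric.mem_ball_self hδ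
  set T : E → E := fun x => y - (ψ x - x) with hT
  have hmaps : MapsTo T (Metric.ball c δ) (Metric.ball c δ) := by
    intro x hx
    rw [mem_ball_iff_norm] at hx hy ⊢
    have : T x - c = (y - ψ c) - (ψ x - ψ c - (x - c)) := by simp only [hT]; abel
    rw [this]
    refine (norm_sub_le_max_of_ultrametric _ _).trans_lt (max_lt hy ?_)
    refine (h x (by rwa [mem_ball_iff_norm]) c hc).trans_lt ?_
    linarith [norm_nonneg (x - c)]
  have hcontr : ContractingWith (1 / 2 : ℝ≥0) (hmaps.restrict T _ _) := by
    refine ⟨by norm_num, LipschitzWith.of_dist_le_mul fun x x' => ?_⟩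
    rw [Subtype.dist_eq, Subtype.dist_eq, dist_eq_norm, dist_eq_norm]
    have h2 : T x - T x' = -(ψ x - ψ x' - (x - x' : E)) := by simp only [hT]; abel
    change ‖T x - T x'‖ ≤ _
    rw [h2, norm_neg]
    simpa using h x x.2 x' x'.2
  obtain ⟨x, hx, hfix, -⟩ := hcontr.exists_fixedPoint'
    (IsUltrametricDist.isClosed_ball c δ).isComplete hmaps hc (edist_ne_top _ _)
  refine ⟨x, hx, ?_⟩
  have : y - (ψ x - x) = x := hfix
  have h3 : y - ψ x = 0 := by
    have : y - ψ x = (y - (ψ x - x)) - x := by abel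
    rw [this, ‹y - (ψ x - x) = x›, sub_self]
  exact (sub_eq_zero.mp h3).symm

theorem IsNearIdentityOn.continuousOn (h : IsNearIdentityOn ψ c δ) :
    ContinuousOn ψ (Metric.ball c δ) := by
  refine LipschitzOnWith.continuousOn (K := 1) (LipschitzOnWith.of_dist_le_mul fun x hx y hy => ?_)
  rw [dist_eq_norm, dist_eq_norm, h.norm_sub hx hy]
  simp

theorem IsNearIdentityOn.image_ball [CompleteSpace E] (h : IsNearIdentityOn ψ c δ) {x : E}
    (hx : x ∈ Metric.ball c δ) {ρ : ℝ} (hρ : ρ ≤ δ) :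
    Metric.ball c δ ∩ ψ ⁻¹' Metric.ball (ψ x) ρ = Metric.ball x ρ := by
  ext z
  simp only [mem_inter_iff, mem_preimage]
  constructor
  · rintro ⟨hz, hz'⟩
    rwa [mem_ball_iff_norm, h.norm_sub hz hx, ← mem_ball_iff_norm] at hz'
  · intro hz
    have hz1 : z ∈ Metric.ball c δ := by
      rw [IsUltrametricDist.ball_eq_of_mem hx]
      exact Metric.ball_subset_ball hρ hz
    refine ⟨hz1, ?_⟩
    rwa [mem_ball_iff_norm, h.norm_sub hz1 hx, ← mem_ball_iff_norm]

theorem isPiSystem_balls : IsPiSystem {s : Set E | ∃ x ρ, s = Metric.ball x ρ} := by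
  rintro _ ⟨x, ρ, rfl⟩ _ ⟨y, ρ', rfl⟩ -
  rcases IsUltrametricDist.ball_subset_trichotomy (x := x) (y := y) (r := ρ) (s := ρ')
    with h | h | h
  · exact ⟨x, ρ, inter_eq_left.mpr h⟩
  · exact ⟨y, ρ', inter_eq_right.mpr h⟩
  · exact ⟨x, 0, by rw [h.inter_eq, Metric.ball_zero]⟩

theorem borel_eq_generateFrom_balls {E : Type*} [PseudoMetricSpace E] [MeasurableSpace E]
    [BorelSpace E] [SecondCountableTopology E] : (inferInstance : MeasurableSpace E) =
      .generateFrom {s : Set E | ∃ x ρ, s = Metric.ball x ρ} := by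
  have hb : TopologicalSpace.IsTopologicalBasis {s : Set E | ∃ x ρ, s = Metric.ball x ρ} := by
    refine TopologicalSpace.isTopologicalBasis_of_isOpen_of_nhds ?_ ?_
    · rintro _ ⟨x, ρ, rfl⟩
      exact Metric.isOpen_ball
    · intro x s hx hs
      obtain ⟨ρ, hρ, h⟩ := Metric.isOpen_iff.mp hs x hx
      exact ⟨_, ⟨x, ρ, rfl⟩, Metric.mem_ball_self hρ, h⟩
  rw [‹BorelSpace E›.measurable_eq]
  exact hb.borel_eq_generateFrom

/-- Maps close to the identity preserve every translation invariant measure. -/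
theorem IsNearIdentityOn.map_restrict_ball [CompleteSpace E] [MeasurableSpace E] [BorelSpace E]
    [SecondCountableTopology E] (μ : Measure E) [μ.IsAddRightInvariant]
    (h : IsNearIdentityOn ψ c δ) (hδ : 0 < δ) (hfin : μ (Metric.ball c δ) ≠ ∞) :
    (μ.restrict (Metric.ball c δ)).map ψ = μ.restrict (Metric.ball (ψ c) δ) := by
  have hball (x y : E) (ρ : ℝ) : μ (Metric.ball x ρ) = μ (Metric.ball y ρ) := by
    rw [← measure_preimage_add_right μ (y - x) (Metric.ball y ρ)]
    congr 1
    ext z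
    rw [mem_preimage, mem_ball_iff_norm, mem_ball_iff_norm]
    congr! 2
    abel
  have hcm : c ∈ Metric.ball c δ := Metric.mem_ball_self hδ
  have hψ : AEMeasurable ψ (μ.restrict (Metric.ball c δ)) :=
    h.continuousOn.aemeasurable Metric.isOpen_ball.measurableSet
  have : IsFiniteMeasure (μ.restrict (Metric.ball c δ)) := ⟨by simpa using hfin.lt_top⟩
  -- Balls form a π-system generating the Borel sets, so it suffices to compare measures of balls.
  -- Preimages of balls under ψ are balls of the same radius, and by translation invariance the
  -- radius determines the measure.
  refine ext_of_generate_finite _ borel_eq_generateFrom_balls isPiSystem_balls ?_ ?_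
  · rintro _ ⟨y, ρ, rfl⟩
    rw [Measure.map_apply_of_aemeasurable hψ measurableSet_ball,
      Measure.restrict_apply₀ (hψ.nullMeasurable measurableSet_ball),
      Measure.restrict_apply measurableSet_ball, inter_comm]
    rcases IsUltrametricDist.ball_subset_trichotomy (x := y) (y := ψ c) (r := ρ) (s := δ)
      with hs | hs | hs
    · rcases le_or_gt ρ 0 with hρ | hρ
      · simp [Metric.ball_eq_empty.mpr hρ]
      obtain ⟨x, hx, rfl⟩ := h.surjOn (hs (Metric.mem_ball_self hρ))
      rcases le_or_gt ρ δ with hle | hlt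
      · rw [h.image_ball hx hle, inter_eq_left.mpr hs]
        exact hball _ _ _
      · have he : Metric.ball (ψ x) ρ = Metric.ball (ψ c) δ := by
          refine subset_antisymm hs ?_
          rw [IsUltrametricDist.ball_eq_of_mem (hs (Metric.mem_ball_self hρ))]
          exact Metric.ball_subset_ball hlt.le
        rw [he, h.image_ball hcm le_rfl, inter_self]
        exact hball _ _ _
    · rw [inter_eq_right.mpr hs, inter_eq_left.mpr]
      · exact hball _ _ _
      · intro z hz
        refine hs ?_
        rwa [mem_ball_iff_norm, h.norm_sub hz hcm, ← mem_ball_iff_norm]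
    · rw [hs.inter_eq]
      have : Metric.ball c δ ∩ ψ ⁻¹' Metric.ball y ρ = ∅ := by
        refine eq_empty_iff_forall_notMem.mpr fun z hz => ?_
        refine Set.disjoint_left.mp hs hz.2 ?_
        rw [mem_ball_iff_norm, h.norm_sub hz.1 hcm, ← mem_ball_iff_norm]
        exact hz.1
      rw [this]
  · rw [Measure.map_apply_of_aemeasurable hψ .univ]
    simpa using hball _ _ _

end NearIdentity

/-- A compact set covered by balls of an ultrametric space, one for each of its points, is covered
by finitely many disjoint ones among them. -/
theorem exists_finset_disjoint_balls {X : Type*} [PseudoMetricSpace X] [IsUltrametricDist X]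
    {S : Set X} (hS : IsCompact S) (δ : X → ℝ) (hδ : ∀ x ∈ S, 0 < δ x) :
    ∃ t : Finset X, ↑t ⊆ S ∧ S ⊆ ⋃ x ∈ t, Metric.ball x (δ x) ∧
      (t : Set X).PairwiseDisjoint fun x => Metric.ball x (δ x) := by
  classical
  obtain ⟨u, huS, hu⟩ := hS.elim_nhds_subcover (fun x => Metric.ball x (δ x))
    fun x hx => Metric.ball_mem_nhds x (hδ x hx)
  have key : ∀ u : Finset X, (∀ x ∈ u, x ∈ S) → ∃ t ⊆ u,
      (⋃ x ∈ u, Metric.ball x (δ x)) ⊆ (⋃ x ∈ t, Metric.ball x (δ x)) ∧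
      (t : Set X).PairwiseDisjoint fun x => Metric.ball x (δ x) := by
    intro u
    induction u using Finset.strongInduction with
    | H u ih =>
      intro huS
      by_cases hd : (u : Set X).PairwiseDisjoint fun x => Metric.ball x (δ x)
      · exact ⟨u, subset_rfl, subset_rfl, hd⟩
      have hex : ∃ x ∈ u, ∃ y ∈ u, x ≠ y ∧ Metric.ball x (δ x) ⊆ Metric.ball y (δ y) := by
        simp only [Set.PairwiseDisjoint, Set.Pairwise, not_forall] at hd
        obtain ⟨x, hx, y, hy, hne, h⟩ := hd
        rcases IsUltrametricDist.ball_subset_trichotomy (x := x) (y := y) (r := δ x) (s := δ y)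
          with h' | h' | h'
        · exact ⟨x, hx, y, hy, hne, h'⟩
        · exact ⟨y, hy, x, hx, hne.symm, h'⟩
        · exact absurd h' h
      obtain ⟨x, hx, y, hy, hne, hsub⟩ := hex
      obtain ⟨t, htu, ht, htd⟩ := ih (u.erase x) (Finset.erase_ssubset hx)
        fun z hz => huS z (Finset.mem_of_mem_erase hz)
      refine ⟨t, htu.trans (Finset.erase_subset _ _), subset_trans ?_ ht, htd⟩
      refine iUnion₂_subset fun z hz => ?_
      by_cases hzx : z = x
      · subst hzx
        exact hsub.trans (subset_biUnion_of_mem (u := fun x => Metric.ball x (δ x))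
          (Finset.mem_erase.mpr ⟨hne.symm, hy⟩))
      · exact subset_biUnion_of_mem (u := fun x => Metric.ball x (δ x))
          (Finset.mem_erase.mpr ⟨hzx, hz⟩)
  obtain ⟨t, htu, ht, htd⟩ := key u huS
  exact ⟨t, fun x hx => huS x (htu hx), hu.trans ht, htd⟩

/-! ### Distribution of the absolute value of a linear map -/

section Distribution

variable {K : Type*} [NontriviallyNormedField K] [PadicField K] {ϖ : K}

theorem IsUniformizer.maxAbs_eq_zpow (h : IsUniformizer ϖ) {l : ℕ} {z : Fin l → K} {j : ℤ}
    (hz : ‖z‖ = ‖ϖ‖ ^ j) : maxAbs z = (residueCard K : ℝ)⁻¹ ^ j := by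
  obtain ⟨c, -, hc, hmax⟩ := h.exists_maxAbs_eq_rpow
  rw [hmax, hz, ← Real.rpow_intCast ‖ϖ‖ j, ← Real.rpow_mul h.norm_pos.le, mul_comm,
    Real.rpow_mul h.norm_pos.le, hc, Real.rpow_intCast]

theorem IsUniformizer.exists_le_zpow (h : IsUniformizer ϖ) (C : ℝ) : ∃ j : ℤ, C ≤ ‖ϖ‖ ^ j := by
  obtain ⟨m, hm⟩ := pow_unbounded_of_one_lt C ((one_lt_inv₀ h.norm_pos).mpr h.norm_lt_one)
  exact ⟨-m, by rw [zpow_neg, zpow_natCast, ← inv_pow]; exact hm.le⟩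

theorem IsUniformizer.exists_zpow_lt (h : IsUniformizer ϖ) {C : ℝ} (hC : 0 < C) :
    ∃ j₀ : ℤ, ∀ j ≥ j₀, ‖ϖ‖ ^ j < C := by
  obtain ⟨m, hm⟩ := exists_pow_lt_of_lt_one hC h.norm_lt_one
  refine ⟨m, fun j hj => lt_of_le_of_lt ?_ hm⟩
  rw [← zpow_natCast]
  exact zpow_le_zpow_right_of_le_one₀ h.norm_pos h.norm_lt_one.le hj

variable [MeasurableSpace K] [BorelSpace K]

theorem measurable_maxAbs {l : ℕ} : Measurable (maxAbs : (Fin l → K) → ℝ) := by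
  obtain ⟨ϖ, h⟩ := exists_isUniformizer K
  obtain ⟨c, -, -, hmax⟩ := h.exists_maxAbs_eq_rpow
  have : (maxAbs : (Fin l → K) → ℝ) = fun z => ‖z‖ ^ c := funext fun z => hmax l z
  rw [this]
  fun_prop

/-- By `htail` the measure of {‖F‖ ≤ ‖ϖ‖^j} is divided by q^d at each step from j₀ on. Hence F ≠ 0
almost everywhere, and the distribution of |F|_K is a sum of point masses at q^(-j) which is
eventually geometric with ratio q^(-d - s). Possible poles therefore lie on Re s = -d. -/
theorem IsUniformizer.exists_mellin_of_tail (h : IsUniformizer ϖ) {X : Type*} [MeasurableSpace X]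
    (μ : Measure X) [IsFiniteMeasure μ] {l : ℕ} {F : X → Fin l → K} (hF : Measurable F)
    (j₁ : ℤ) (hj₁ : ∀ᵐ x ∂μ, ‖F x‖ ≤ ‖ϖ‖ ^ j₁) (j₀ : ℤ) {d : ℕ} (hd : 0 < d)
    (htail : ∀ j ≥ j₀, μ {x | ‖F x‖ ≤ ‖ϖ‖ ^ j} =
      (residueCard K : ℝ≥0∞) ^ d * μ {x | ‖F x‖ ≤ ‖ϖ‖ ^ (j + 1)})
    {β : ℝ} (hβ : -(d : ℝ) ≤ β) :
    ∃ W, MellinContinues β (μ.map fun x => maxAbs (F x)) W := by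
  have hq1 := one_lt_residueCard_real K
  have hq0 : (0 : ℝ) < residueCard K := by linarith
  have hQ0 := residueCard_ennreal_ne_zero K
  have hQt : (residueCard K : ℝ≥0∞) ≠ ∞ := ENNReal.natCast_ne_top _
  set Q : ℝ≥0∞ := (residueCard K : ℝ≥0∞)
  set D : ℤ → Set X := fun j => {x | ‖F x‖ ≤ ‖ϖ‖ ^ j} with hDdef
  have hDm (j : ℤ) : MeasurableSet (D j) := measurableSet_le hF.norm measurable_const
  have hDanti : Antitone D := fun i j hij x hx =>
    le_trans hx (zpow_le_zpow_right_of_le_one₀ h.norm_pos h.norm_lt_one.le hij)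
  set Sh : ℕ → Set X := fun b => D (j₁ + b) \ D (j₁ + b + 1) with hShdef
  have hShm (b : ℕ) : MeasurableSet (Sh b) := (hDm _).diff (hDm _)
  have hShval (b : ℕ) (x : X) (hx : x ∈ Sh b) : ‖F x‖ = ‖ϖ‖ ^ (j₁ + b) := by
    have hne : F x ≠ 0 := by
      intro h0
      refine hx.2 ?_
      simp only [hDdef, mem_ofPred_eq, h0, norm_zero]
      exact zpow_nonneg h.norm_pos.le _
    obtain ⟨k, hk⟩ := h.exists_norm_pi_eq hne
    have h1 := hx.1
    have h2 := hx.2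
    simp only [hDdef, mem_ofPred_eq, hk] at h1 h2
    rw [zpow_le_zpow_iff_right_of_lt_one₀ h.norm_pos h.norm_lt_one] at h1 h2
    rw [hk]
    congr 1
    omega
  have hdisj : Pairwise (Function.onFun Disjoint Sh) := by
    intro b b' hbb
    refine Set.disjoint_left.mpr fun x hx hx' => hbb ?_
    have := (hShval b x hx).symm.trans (hShval b' x hx')
    have := zpow_right_injective₀ h.norm_pos h.norm_lt_one.ne this
    omega
  -- the zero set of `F` is a null set
  have hpow (b : ℕ) : μ (D (j₀ + b)) = (Q⁻¹) ^ (d * b) * μ (D j₀) := by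
    induction b with
    | zero => simp
    | succ b ih =>
      have h1 := htail (j₀ + b) (by omega)
      change μ (D (j₀ + b)) = _ * μ (D (j₀ + b + 1)) at h1
      have h2 : μ (D (j₀ + b + 1)) = (Q⁻¹) ^ d * μ (D (j₀ + b)) := by
        rw [h1, ← mul_assoc, ← mul_pow, ENNReal.inv_mul_cancel hQ0 hQt, one_pow, one_mul]
      push_cast
      rw [← add_assoc, h2, ih, ← mul_assoc, ← pow_add]
      congr 2
      ring
  have hQinv : Q⁻¹ ^ d < 1 := by
    refine pow_lt_one₀ zero_le ?_ hd.ne'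
    rw [ENNReal.inv_lt_one]
    have h1 : 1 < residueCard K := by exact_mod_cast hq1
    change (1 : ℝ≥0∞) < (residueCard K : ℝ≥0∞)
    exact_mod_cast h1
  have hnull : μ {x | F x = 0} = 0 := by
    have hle (b : ℕ) : μ {x | F x = 0} ≤ (Q⁻¹ ^ d) ^ b * μ (D j₀) := by
      rw [← pow_mul, ← hpow]
      refine measure_mono fun x hx => ?_
      simp only [mem_ofPred_eq] at hx
      simp only [hDdef, mem_ofPred_eq, hx, norm_zero]
      exact zpow_nonneg h.norm_pos.le _
    have htend : Tendsto (fun b : ℕ => (Q⁻¹ ^ d) ^ b * μ (D j₀)) atTop (𝓝 (0 * μ (D j₀))) :=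
      ENNReal.Tendsto.mul_const (ENNReal.tendsto_pow_atTop_nhds_zero_of_lt_one hQinv)
        (Or.inr (measure_ne_top _ _))
    rw [zero_mul] at htend
    exact le_antisymm (ge_of_tendsto' htend hle) zero_le
  have hcover : ∀ᵐ x ∂μ, x ∈ ⋃ b, Sh b := by
    have hne : ∀ᵐ x ∂μ, F x ≠ 0 := by rw [ae_iff]; simpa using hnull
    filter_upwards [hj₁, hne] with x hx1 hx0
    obtain ⟨k, hk⟩ := h.exists_norm_pi_eq hx0
    rw [hk, zpow_le_zpow_iff_right_of_lt_one₀ h.norm_pos h.norm_lt_one] at hx1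
    refine mem_iUnion.mpr ⟨(k - j₁).toNat, ?_⟩
    simp only [hShdef, hDdef, Set.mem_sdiff, mem_ofPred_eq, hk,
      zpow_le_zpow_iff_right_of_lt_one₀ h.norm_pos h.norm_lt_one]
    omega
  have hmF : Measurable fun x => maxAbs (F x) := measurable_maxAbs.comp hF
  -- the distribution is a geometric sum of point masses
  have hdist : μ.map (fun x => maxAbs (F x)) = Measure.sum fun b : ℕ =>
      μ (Sh b) • Measure.dirac ((residueCard K : ℝ)⁻¹ ^ (j₁ + b)) := by
    refine Measure.ext fun T hT => ?_
    rw [Measure.map_apply hmF hT, Measure.sum_apply _ hT]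
    have hTm := hmF hT
    rw [← Measure.restrict_eq_self_of_ae_mem hcover, Measure.restrict_apply hTm, inter_iUnion,
      measure_iUnion (fun b b' hbb => (hdisj hbb).mono inter_subset_right inter_subset_right)
        fun b => hTm.inter (hShm b)]
    refine tsum_congr fun b => ?_
    rw [Measure.smul_apply, Measure.dirac_apply' _ hT, Measure.restrict_eq_self_of_ae_mem hcover]
    by_cases hb : (residueCard K : ℝ)⁻¹ ^ (j₁ + (b : ℤ)) ∈ T
    · rw [Set.indicator_of_mem hb]
      simp only [Pi.one_apply, smul_eq_mul, mul_one]
      congr 1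
      refine inter_eq_right.mpr fun x hx => ?_
      change maxAbs (F x) ∈ T
      rwa [h.maxAbs_eq_zpow (hShval b x hx)]
    · rw [Set.indicator_of_notMem hb]
      simp only [smul_eq_mul, mul_zero]
      have : (fun x => maxAbs (F x)) ⁻¹' T ∩ Sh b = ∅ := by
        refine eq_empty_iff_forall_notMem.mpr fun x hx => hb ?_
        rw [← h.maxAbs_eq_zpow (hShval b x hx.2)]
        exact hx.1
      rw [this, measure_empty]
  have hShtail (b : ℕ) (hb : j₀ ≤ j₁ + b) : μ (Sh b) = Q ^ d * μ (Sh (b + 1)) := by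
    simp only [hShdef]
    rw [measure_sdiff (hDanti (by omega)) (hDm _).nullMeasurableSet (measure_ne_top _ _),
      measure_sdiff (hDanti (by omega)) (hDm _).nullMeasurableSet (measure_ne_top _ _),
      ENNReal.mul_sub (fun _ _ => ENNReal.pow_ne_top hQt)]
    have h1 := htail (j₁ + b) hb
    have h2 := htail (j₁ + b + 1) (by omega)
    push_cast
    rw [← add_assoc]
    exact congrArg₂ _ h1 h2
  set N := (j₀ - j₁).toNat
  have hconst (b : ℕ) : Q ^ (d * (N + b)) * μ (Sh (N + b)) = Q ^ (d * N) * μ (Sh N) := by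
    induction b with
    | zero => rfl
    | succ b ih =>
      rw [← ih, hShtail (N + b) (by omega), ← mul_assoc, ← pow_add]
      rfl
  rw [hdist]
  -- The mass of the b-th shell is multiplied by q^(d b) to undo the geometric decay; the result is
  -- constant for b ≥ N, as `exists_sum_nat` requires.
  obtain ⟨W, hW⟩ := MellinContinues.exists_sum_nat (β := β) ((residueCard K : ℝ≥0)⁻¹ ^ d)
    (inv_pos.mpr hq0) (fun x hx => by
      push_cast
      rw [← Real.rpow_natCast, ← Real.rpow_add (inv_pos.mpr hq0)]
      exact Real.rpow_lt_one (inv_pos.mpr hq0).le (inv_lt_one_of_one_lt₀ hq1) (by linarith))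
    (fun b => (Q ^ (d * b) * μ (Sh b)) • Measure.dirac ((residueCard K : ℝ)⁻¹ ^ j₁)) N
    (fun b => MellinContinues.exists_smul
      ⟨_, MellinContinues.dirac β (zpow_pos (inv_pos.mpr hq0) _)⟩
      (ENNReal.mul_ne_top (ENNReal.pow_ne_top hQt) (measure_ne_top _ _)))
    (fun b => by
      rcases le_total b N with hb | hb
      · rw [min_eq_left hb]
      · rw [min_eq_right hb]
        obtain ⟨b, rfl⟩ := Nat.exists_eq_add_of_le hb
        rw [hconst])
  refine ⟨W, ?_⟩
  convert! hW using 3 with b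
  rw [scaleMeasure, Measure.map_smul, Measure.map_dirac' (by fun_prop), ← smul_assoc,
    zpow_add₀ (inv_pos.mpr hq0).ne', zpow_natCast, mul_comm (((residueCard K : ℝ)⁻¹) ^ b)]
  congr 1
  rw [ENNReal.smul_def, smul_eq_mul, ← mul_assoc]
  have : (((residueCard K : ℝ≥0)⁻¹ ^ d) ^ b : ℝ≥0) * Q ^ (d * b) = (1 : ℝ≥0∞) := by
    rw [← pow_mul, ENNReal.coe_pow, ENNReal.coe_inv (by exact_mod_cast hq0.ne'),
      ENNReal.coe_natCast, ← mul_pow, ENNReal.inv_mul_cancel hQ0 hQt, one_pow]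
  rw [this, one_mul]

/-- The distribution of a linear map of maximal rank on a ball meeting its kernel. -/
theorem exists_mellin_linearMap {n l : ℕ} (A : (Fin n → K) →ₗ[K] (Fin l → K)) {c : Fin n → K}
    (hc : A c = 0) {δ : ℝ} (hδ : 0 < δ) {β : ℝ}
    (hA : (Function.Surjective A ∧ 0 < l ∧ -(l : ℝ) ≤ β) ∨
      (Function.Injective A ∧ 0 < n ∧ -(n : ℝ) ≤ β)) :
    ∃ W, MellinContinues β
      (((haarK K n).restrict (Metric.ball c δ)).map fun w => maxAbs (A w)) W := by
  obtain ⟨ϖ, h⟩ := exists_isUniformizer K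
  have hAc : Continuous A := LinearMap.continuous_of_finiteDimensional A
  -- reduction to the ball around the origin
  have htrans : ((haarK K n).restrict (Metric.ball c δ)).map (fun w => maxAbs (A w)) =
      ((haarK K n).restrict (Metric.ball 0 δ)).map fun w => maxAbs (A w) := by
    have hψ : IsNearIdentityOn (fun w : Fin n → K => w - c) c δ := fun x _ y _ => by
      have : (x - c) - (y - c) - (x - y) = 0 := by abel
      simp only [this, norm_zero]
      positivity
    have h1 := hψ.map_restrict_ball (haarK K n) hδ measure_ball_lt_top.ne
    rw [sub_self] at h1
    have hm : Measurable fun w => maxAbs (A w) := measurable_maxAbs.comp hAc.measurable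
    rw [← h1, Measure.map_map hm (by fun_prop)]
    congr 1
    funext w
    simp only [Function.comp, map_sub, hc, sub_zero]
  rw [htrans]
  set μ := (haarK K n).restrict (Metric.ball (0 : Fin n → K) δ) with hμ
  have : IsFiniteMeasure μ := ⟨by rw [hμ, Measure.restrict_apply_univ]; exact measure_ball_lt_top⟩
  let A' : (Fin n → K) →L[K] (Fin l → K) := ⟨A, hAc⟩
  obtain ⟨j₁, hj₁⟩ := h.exists_le_zpow (‖A'‖ * δ)
  have hb : ∀ᵐ w ∂μ, ‖A w‖ ≤ ‖ϖ‖ ^ j₁ := by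
    refine ae_restrict_of_forall_mem measurableSet_ball fun w hw => ?_
    rw [mem_ball_zero_iff] at hw
    exact ((A'.le_opNorm w).trans (by gcongr)).trans hj₁
  have hDm (j : ℤ) : MeasurableSet {w | ‖A w‖ ≤ ‖ϖ‖ ^ j} :=
    measurableSet_le hAc.norm.measurable measurable_const
  have hμD (j : ℤ) : μ {w | ‖A w‖ ≤ ‖ϖ‖ ^ j} =
      haarK K n {w | w ∈ Metric.ball (0 : Fin n → K) δ ∧ ‖A w‖ ≤ ‖ϖ‖ ^ j} := by
    rw [hμ, Measure.restrict_apply (hDm j), inter_comm]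
    rfl
  rcases hA with ⟨hsurj, hl, hβ⟩ | ⟨hinj, hn, hβ⟩
  -- A right inverse sends small vectors into the ball of radius δ, so small targets have preimages
  -- in it and `measure_norm_le_zpow` applies with d = l.
  · obtain ⟨B, hB⟩ := A.exists_rightInverse_of_surjective (LinearMap.range_eq_top.mpr hsurj)
    let B' : (Fin l → K) →L[K] (Fin n → K) := ⟨B, LinearMap.continuous_of_finiteDimensional B⟩
    obtain ⟨j₀, hj₀⟩ := h.exists_zpow_lt (C := δ / (‖B'‖ + 1)) (by positivity)
    refine h.exists_mellin_of_tail μ hAc.measurable j₁ hb j₀ hl (fun j hj => ?_) hβ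
    rw [hμD, hμD]
    refine h.measure_norm_le_zpow A
      (IsUltrametricDist.ball_openAddSubgroup (Fin n → K) hδ).toAddSubgroup measurableSet_ball j
      fun y hy => ⟨B y, ?_, by rw [← LinearMap.comp_apply, hB, LinearMap.id_apply]⟩
    change B y ∈ Metric.ball (0 : Fin n → K) δ
    rw [mem_ball_zero_iff]
    calc ‖B' y‖ ≤ ‖B'‖ * ‖y‖ := B'.le_opNorm y
      _ ≤ (‖B'‖ + 1) * ‖ϖ‖ ^ j := by gcongr; linarith
      _ < (‖B'‖ + 1) * (δ / (‖B'‖ + 1)) := by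
        have := hj₀ j hj
        gcongr
      _ = δ := by field_simp
  -- A left inverse bounds w by A w, so small sublevel sets of ‖A w‖ lie in the ball. Multiplication
  -- by ϖ carries each of them onto the next, and d = n.
  · obtain ⟨B, hB⟩ := A.exists_leftInverse_of_injective (LinearMap.ker_eq_bot.mpr hinj)
    let B' : (Fin l → K) →L[K] (Fin n → K) := ⟨B, LinearMap.continuous_of_finiteDimensional B⟩
    obtain ⟨j₀, hj₀⟩ := h.exists_zpow_lt (C := δ / (‖B'‖ + 1)) (by positivity)
    have hball (j : ℤ) (hj : j₀ ≤ j) (w : Fin n → K) (hw : ‖A w‖ ≤ ‖ϖ‖ ^ j) :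
        w ∈ Metric.ball (0 : Fin n → K) δ := by
      rw [mem_ball_zero_iff]
      calc ‖w‖ = ‖B' (A w)‖ := by
            change _ = ‖B (A w)‖
            rw [← LinearMap.comp_apply, hB, LinearMap.id_apply]
        _ ≤ ‖B'‖ * ‖A w‖ := B'.le_opNorm _
        _ ≤ (‖B'‖ + 1) * ‖ϖ‖ ^ j := by gcongr; linarith
        _ < (‖B'‖ + 1) * (δ / (‖B'‖ + 1)) := by
          have := hj₀ j hj
          gcongr
        _ = δ := by field_simp
    refine h.exists_mellin_of_tail μ hAc.measurable j₁ hb j₀ hn (fun j hj => ?_) hβ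
    have hμD' (j : ℤ) (hj : j₀ ≤ j) :
        μ {w | ‖A w‖ ≤ ‖ϖ‖ ^ j} = haarK K n {w | ‖A w‖ ≤ ‖ϖ‖ ^ j} := by
      rw [hμD]
      congr 1
      ext w
      exact ⟨fun hw => hw.2, fun hw => ⟨hball j hj w hw, hw⟩⟩
    rw [hμD' j hj, hμD' (j + 1) (by omega)]
    have h1 := congrArg (fun ν => ν {w | ‖A w‖ ≤ ‖ϖ‖ ^ (j + 1)})
      (h.map_monomialScale (n := n) fun _ => 1)
    simp only [Measure.map_apply (continuous_monomialScale ϖ _).measurable (hDm _),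
      Measure.smul_apply, Finset.sum_const, Finset.card_univ, Fintype.card_fin, smul_eq_mul,
      mul_one] at h1
    rw [← h1]
    congr 1
    ext w
    have h2 : monomialScale ϖ (fun _ => 1) w = ϖ • w := by
      funext i
      simp [monomialScale]
    simp only [mem_preimage, mem_ofPred_eq, h2, map_smul, norm_smul]
    rw [zpow_add₀ h.norm_pos.ne', zpow_one, mul_comm ‖ϖ‖, mul_le_mul_iff_left₀ h.norm_pos]

end Distribution

/-! ### Estimates for convergent power series -/

section Series

theorem norm_prod_le_one {K ι : Type*} [NormedField K] (s : Finset ι) (a : ι → K)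
    (ha : ∀ i ∈ s, ‖a i‖ ≤ 1) : ‖∏ i ∈ s, a i‖ ≤ 1 := by
  rw [norm_prod]
  exact Finset.prod_le_one (fun _ _ => norm_nonneg _) ha

variable {K : Type*} [NontriviallyNormedField K] [IsUltrametricDist K]

theorem norm_prod_sub_prod_le {ι : Type*} (s : Finset ι) (a b : ι → K) {d : ℝ} (hd : 0 ≤ d)
    (ha : ∀ i ∈ s, ‖a i‖ ≤ 1) (hb : ∀ i ∈ s, ‖b i‖ ≤ 1) (hab : ∀ i ∈ s, ‖a i - b i‖ ≤ d) :
    ‖∏ i ∈ s, a i - ∏ i ∈ s, b i‖ ≤ d := by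
  classical
  induction s using Finset.induction_on with
  | empty => simpa using hd
  | insert i s hi ih =>
    rw [Finset.prod_insert hi, Finset.prod_insert hi]
    have ha' : ∀ j ∈ s, ‖a j‖ ≤ 1 := fun j hj => ha j (Finset.mem_insert_of_mem hj)
    have hb' : ∀ j ∈ s, ‖b j‖ ≤ 1 := fun j hj => hb j (Finset.mem_insert_of_mem hj)
    have e : a i * ∏ j ∈ s, a j - b i * ∏ j ∈ s, b j =
        (a i - b i) * ∏ j ∈ s, a j + b i * (∏ j ∈ s, a j - ∏ j ∈ s, b j) := by ring
    rw [e]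
    refine (IsUltrametricDist.norm_add_le_max _ _).trans (max_le ?_ ?_) <;> rw [norm_mul]
    · exact (mul_le_of_le_one_right (norm_nonneg _) (norm_prod_le_one s a ha')).trans
        (hab i (Finset.mem_insert_self i s))
    · exact (mul_le_of_le_one_left (norm_nonneg _) (hb i (Finset.mem_insert_self i s))).trans
        (ih ha' hb' fun j hj => hab j (Finset.mem_insert_of_mem hj))

/-- The value of the monomial with exponents `e`. -/
def monomialValue {n : ℕ} (e : Fin n → ℕ) (x : Fin n → K) : K := ∏ j, x j ^ e j

variable {n l : ℕ}

theorem norm_monomialValue_le_one {K : Type*} [NontriviallyNormedField K]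
    (e : Fin n → ℕ) {x : Fin n → K} (hx : ‖x‖ ≤ 1) :
    ‖monomialValue e x‖ ≤ 1 := by
  refine norm_prod_le_one _ _ fun j _ => ?_
  rw [norm_pow]
  exact pow_le_one₀ (norm_nonneg _) ((norm_le_pi_norm x j).trans hx)

/-- Ultrametrically the exponents do not enter the Lipschitz constant, so the bound is uniform over
all terms of a series. -/
theorem norm_monomialValue_sub_le (e : Fin n → ℕ) {x y : Fin n → K} (hx : ‖x‖ ≤ 1)
    (hy : ‖y‖ ≤ 1) : ‖monomialValue e x - monomialValue e y‖ ≤ ‖x - y‖ := by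
  have hx' (j : Fin n) : ‖x j‖ ≤ 1 := (norm_le_pi_norm x j).trans hx
  have hy' (j : Fin n) : ‖y j‖ ≤ 1 := (norm_le_pi_norm y j).trans hy
  refine norm_prod_sub_prod_le _ _ _ (norm_nonneg _) (fun j _ => ?_) (fun j _ => ?_) fun j _ => ?_
  · rw [norm_pow]; exact pow_le_one₀ (norm_nonneg _) (hx' j)
  · rw [norm_pow]; exact pow_le_one₀ (norm_nonneg _) (hy' j)
  · have := norm_prod_sub_prod_le (Finset.range (e j)) (fun _ => x j) (fun _ => y j)
      (norm_nonneg (x - y)) (fun _ _ => hx' j) (fun _ _ => hy' j)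
      fun _ _ => norm_le_pi_norm (x - y) j
    simpa using this

/-- The estimates satisfied by convergent power series in two sets of variables on the unit
polydisc. -/
structure IsAnalyticFamily (g : (Fin n → K) → (Fin n → K) → Fin l → K) (C : ℝ) : Prop where
  nonneg : 0 ≤ C
  norm_sub_le : ∀ u u' θ θ', ‖u‖ ≤ 1 → ‖u'‖ ≤ 1 → ‖θ‖ ≤ 1 → ‖θ'‖ ≤ 1 →
    ‖g u θ - g u' θ'‖ ≤ C * max ‖u - u'‖ ‖θ - θ'‖
  norm_mixed_le : ∀ u u' θ θ', ‖u‖ ≤ 1 → ‖u'‖ ≤ 1 → ‖θ‖ ≤ 1 → ‖θ'‖ ≤ 1 →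
    ‖g u θ - g u θ' - (g u' θ - g u' θ')‖ ≤ C * (‖u - u'‖ * ‖θ - θ'‖)

theorem summable_smul_of_tendsto [CompleteSpace K] {M : Type*} {b : M → Fin l → K}
    (hb : Tendsto b cofinite (𝓝 0)) (a : M → K) (ha : ∀ m, ‖a m‖ ≤ 1) :
    Summable fun m => a m • b m := by
  refine NonarchimedeanAddGroup.summable_of_tendsto_cofinite_zero ?_
  refine squeeze_zero_norm (fun m => ?_) (tendsto_norm_zero.comp hb)
  rw [norm_smul]
  exact mul_le_of_le_one_left (norm_nonneg _) (ha m)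

theorem exists_norm_le_of_tendsto {M E : Type*} [NormedAddCommGroup E] {b : M → E}
    (hb : Tendsto b cofinite (𝓝 0)) : ∃ C, 0 ≤ C ∧ ∀ m, ‖b m‖ ≤ C := by
  have h1 : {m | ¬ ‖b m‖ < 1}.Finite := by
    have := (tendsto_norm_zero.comp hb).eventually_lt_const (zero_lt_one (α := ℝ))
    simpa using eventually_cofinite.mp this
  obtain ⟨C, hC⟩ := (h1.image fun m => ‖b m‖).bddAbove
  refine ⟨max C 1, by positivity, fun m => ?_⟩
  by_cases hm : ‖b m‖ < 1
  · exact hm.le.trans (le_max_right _ _)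
  · exact (hC ⟨m, hm, rfl⟩).trans (le_max_left _ _)

/-- The family `∑ b_m u ^ α_m θ ^ ε_m`. -/
noncomputable def seriesFamily {M : Type*} (b : M → Fin l → K) (α ε : M → Fin n → ℕ)
    (u θ : Fin n → K) : Fin l → K :=
  ∑' m, (monomialValue (α m) u * monomialValue (ε m) θ) • b m

theorem norm_monomialValue_mul_le_one {K : Type*} [NontriviallyNormedField K]
    (α ε : Fin n → ℕ) {u θ : Fin n → K} (hu : ‖u‖ ≤ 1)
    (hθ : ‖θ‖ ≤ 1) : ‖monomialValue α u * monomialValue ε θ‖ ≤ 1 := by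
  rw [norm_mul]
  exact mul_le_one₀ (norm_monomialValue_le_one _ hu) (norm_nonneg _)
    (norm_monomialValue_le_one _ hθ)

/-- C is a bound for the coefficients. Each monomial is a product of a function of u and one of θ,
so its mixed difference is the product of two differences, and the ultrametric inequality passes
termwise bounds to the sum. -/
theorem exists_isAnalyticFamily [CompleteSpace K] {M : Type*} {b : M → Fin l → K}
    (hb : Tendsto b cofinite (𝓝 0)) (α ε : M → Fin n → ℕ) :
    ∃ C, IsAnalyticFamily (seriesFamily b α ε) C := by
  obtain ⟨C, hC0, hC⟩ := exists_norm_le_of_tendsto hb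
  have hs (u θ : Fin n → K) (hu : ‖u‖ ≤ 1) (hθ : ‖θ‖ ≤ 1) :
      Summable fun m => (monomialValue (α m) u * monomialValue (ε m) θ) • b m :=
    summable_smul_of_tendsto hb _ fun m => norm_monomialValue_mul_le_one _ _ hu hθ
  have hbound (a : M → K) (D : ℝ) (hD : 0 ≤ D) (ha : ∀ m, ‖a m‖ ≤ D) :
      ‖∑' m, a m • b m‖ ≤ C * D := by
    refine IsUltrametricDist.norm_tsum_le_of_forall_le_of_nonneg (by positivity) fun m => ?_
    rw [norm_smul, mul_comm]
    exact mul_le_mul (hC m) (ha m) (norm_nonneg _) hC0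
  refine ⟨C, hC0, fun u u' θ θ' hu hu' hθ hθ' => ?_, fun u u' θ θ' hu hu' hθ hθ' => ?_⟩
  · unfold seriesFamily
    rw [← (hs u θ hu hθ).tsum_sub (hs u' θ' hu' hθ')]
    simp only [← sub_smul]
    refine hbound _ _ (by positivity) fun m => ?_
    have e : monomialValue (α m) u * monomialValue (ε m) θ -
        monomialValue (α m) u' * monomialValue (ε m) θ' =
        (monomialValue (α m) u - monomialValue (α m) u') * monomialValue (ε m) θ +
        monomialValue (α m) u' * (monomialValue (ε m) θ - monomialValue (ε m) θ') := by ring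
    rw [e]
    refine (IsUltrametricDist.norm_add_le_max _ _).trans (max_le_max ?_ ?_) <;> rw [norm_mul]
    · exact (mul_le_of_le_one_right (norm_nonneg _) (norm_monomialValue_le_one _ hθ)).trans
        (norm_monomialValue_sub_le _ hu hu')
    · exact (mul_le_of_le_one_left (norm_nonneg _) (norm_monomialValue_le_one _ hu')).trans
        (norm_monomialValue_sub_le _ hθ hθ')
  · unfold seriesFamily
    rw [← (hs u θ hu hθ).tsum_sub (hs u θ' hu hθ'), ← (hs u' θ hu' hθ).tsum_sub (hs u' θ' hu' hθ'),
      ← ((hs u θ hu hθ).sub (hs u θ' hu hθ')).tsum_sub ((hs u' θ hu' hθ).sub (hs u' θ' hu' hθ'))]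
    simp only [← sub_smul]
    refine hbound _ _ (by positivity) fun m => ?_
    have e : monomialValue (α m) u * monomialValue (ε m) θ -
        monomialValue (α m) u * monomialValue (ε m) θ' -
        (monomialValue (α m) u' * monomialValue (ε m) θ -
        monomialValue (α m) u' * monomialValue (ε m) θ') =
        (monomialValue (α m) u - monomialValue (α m) u') *
        (monomialValue (ε m) θ - monomialValue (ε m) θ') := by ring
    rw [e, norm_mul]
    exact mul_le_mul (norm_monomialValue_sub_le _ hu hu') (norm_monomialValue_sub_le _ hθ hθ')
      (norm_nonneg _) (norm_nonneg _)

/-- Near `(u₀, θ₀)` the maps `g(·, θ)` are close to a linear map with right inverse `B`. -/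
def IsSubmersiveAt (g : (Fin n → K) → (Fin n → K) → Fin l → K) (u₀ θ₀ : Fin n → K) : Prop :=
  ∃ (A : (Fin n → K) →L[K] (Fin l → K)) (B : (Fin l → K) →L[K] (Fin n → K)),
    (∀ y, A (B y) = y) ∧ ∃ ε > 0, ∀ u ∈ Metric.ball u₀ ε, ∀ u' ∈ Metric.ball u₀ ε,
      ∀ θ ∈ Metric.ball θ₀ ε, ‖θ‖ ≤ 1 →
        ‖B (g u θ - g u' θ - A (u - u'))‖ ≤ (1 / 2 : ℝ) * ‖u - u'‖

/-- Each point of an ultrametric ball is a centre of it, so the same A, B and ε serve at all nearby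
points: submersivity is an open condition. -/
theorem IsSubmersiveAt.exists_ball {g : (Fin n → K) → (Fin n → K) → Fin l → K}
    {u₀ θ₀ : Fin n → K} (h : IsSubmersiveAt g u₀ θ₀) :
    ∃ ε > 0, ∀ u ∈ Metric.ball u₀ ε, ∀ θ ∈ Metric.ball θ₀ ε, IsSubmersiveAt g u θ := by
  obtain ⟨A, B, hAB, ε, hε, H⟩ := h
  refine ⟨ε, hε, fun u hu θ hθ => ⟨A, B, hAB, ε, hε, ?_⟩⟩
  rwa [← IsUltrametricDist.ball_eq_of_mem hu, ← IsUltrametricDist.ball_eq_of_mem hθ]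

variable {g : (Fin n → K) → (Fin n → K) → Fin l → K} {C : ℝ} {u₀ θ₀ : Fin n → K}

theorem norm_le_one_of_mem_ball {x y : Fin n → K} (hx : ‖x‖ ≤ 1) (hy : y ∈ Metric.ball x 1) :
    ‖y‖ ≤ 1 := by
  have : y = (y - x) + x := by abel
  rw [this]
  rw [mem_ball_iff_norm] at hy
  exact (IsUltrametricDist.norm_add_le_max _ _).trans (max_le hy.le hx)

/-- Strict differentiability at u₀ controls g(·, θ₀); the mixed estimate transfers this to all θ
near θ₀. The constant η is chosen with ‖B‖ η ≤ 1/2. -/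
theorem IsAnalyticFamily.isSubmersiveAt [CompleteSpace K] (hg : IsAnalyticFamily g C)
    (hu₀ : ‖u₀‖ ≤ 1) (hθ₀ : ‖θ₀‖ ≤ 1) {A : (Fin n → K) →L[K] (Fin l → K)}
    (hA : HasStrictFDerivAt (fun u => g u θ₀) A u₀) (hsurj : Function.Surjective A) :
    IsSubmersiveAt g u₀ θ₀ := by
  obtain ⟨B₀, hB₀⟩ := (A : (Fin n → K) →ₗ[K] (Fin l → K)).exists_rightInverse_of_surjective
    (LinearMap.range_eq_top.mpr hsurj)
  let B : (Fin l → K) →L[K] (Fin n → K) := ⟨B₀, LinearMap.continuous_of_finiteDimensional B₀⟩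
  have hAB (y : Fin l → K) : A (B y) = y := LinearMap.congr_fun hB₀ y
  set η : ℝ := 1 / (2 * (‖B‖ + 1)) with hη
  have hη0 : 0 < η := by positivity
  have hBη : ‖B‖ * η ≤ 1 / 2 := by
    rw [hη, mul_one_div, div_le_div_iff₀ (by positivity) (by positivity)]
    nlinarith [norm_nonneg B]
  obtain ⟨s, hs, happ⟩ := hA.approximates_deriv_on_nhds (c := ⟨η, hη0.le⟩) (Or.inr hη0)
  obtain ⟨ε₁, hε₁, hball⟩ := Metric.mem_nhds_iff.mp hs
  refine ⟨A, B, hAB, min (min ε₁ 1) (η / (C + 1)), ?_, ?_⟩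
  · have := hg.nonneg
    positivity
  intro u hu u' hu' θ hθ hθ1
  have hu1 : ‖u‖ ≤ 1 := norm_le_one_of_mem_ball hu₀
    (Metric.ball_subset_ball ((min_le_left _ _).trans (min_le_right _ _)) hu)
  have hu1' : ‖u'‖ ≤ 1 := norm_le_one_of_mem_ball hu₀
    (Metric.ball_subset_ball ((min_le_left _ _).trans (min_le_right _ _)) hu')
  have hus := hball (Metric.ball_subset_ball ((min_le_left _ _).trans (min_le_left _ _)) hu)
  have hus' := hball (Metric.ball_subset_ball ((min_le_left _ _).trans (min_le_left _ _)) hu')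
  have h1 : ‖g u θ₀ - g u' θ₀ - A (u - u')‖ ≤ η * ‖u - u'‖ := happ u hus u' hus'
  have h2 : ‖g u θ - g u θ₀ - (g u' θ - g u' θ₀)‖ ≤ η * ‖u - u'‖ := by
    refine (hg.norm_mixed_le u u' θ θ₀ hu1 hu1' hθ1 hθ₀).trans ?_
    have h3 : ‖θ - θ₀‖ ≤ η / (C + 1) := by
      rw [mem_ball_iff_norm] at hθ
      exact hθ.le.trans (min_le_right _ _)
    have hC := hg.nonneg
    calc C * (‖u - u'‖ * ‖θ - θ₀‖) ≤ (C + 1) * (‖u - u'‖ * (η / (C + 1))) := by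
          gcongr; linarith
      _ = η * ‖u - u'‖ := by field_simp
  have h3 : ‖g u θ - g u' θ - A (u - u')‖ ≤ η * ‖u - u'‖ := by
    have e : g u θ - g u' θ - A (u - u') =
      (g u θ₀ - g u' θ₀ - A (u - u')) + (g u θ - g u θ₀ - (g u' θ - g u' θ₀)) := by abel
    rw [e]
    exact (IsUltrametricDist.norm_add_le_max _ _).trans (max_le h1 h2)
  calc _ ≤ ‖B‖ * (η * ‖u - u'‖) := (B.le_opNorm _).trans (by gcongr)
    _ = ‖B‖ * η * ‖u - u'‖ := by ring
    _ ≤ _ := by gcongr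

end Series

/-! ### Local constancy of the distribution of a family -/

section Tame

variable {K : Type*} [NontriviallyNormedField K] [PadicField K] {n l : ℕ}

theorem maxAbs_eq_of_norm_eq {z w : Fin l → K} (h : ‖z‖ = ‖w‖) : maxAbs z = maxAbs w := by
  obtain ⟨ϖ, hϖ⟩ := exists_isUniformizer K
  obtain ⟨c, -, -, hc⟩ := hϖ.exists_maxAbs_eq_rpow
  rw [hc, hc, h]

theorem maxAbs_pos {z : Fin l → K} (h : z ≠ 0) : 0 < maxAbs z := by
  obtain ⟨ϖ, hϖ⟩ := exists_isUniformizer K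
  obtain ⟨c, -, -, hc⟩ := hϖ.exists_maxAbs_eq_rpow
  rw [hc]
  exact Real.rpow_pos_of_pos (norm_pos_iff.mpr h) _

variable [MeasurableSpace K] [BorelSpace K]

/-- The distribution of `maxAbs (g(·, θ))` on `S`. -/
noncomputable def fiberDist (g : (Fin n → K) → (Fin n → K) → Fin l → K) (S : Set (Fin n → K))
    (θ : Fin n → K) : Measure ℝ :=
  ((haarK K n).restrict S).map fun u => maxAbs (g u θ)

/-- On small balls around `u₀` the distribution of `g(·, θ)` has a Mellin transform with a
continuation, and does not depend on `θ ∈ T` close to `θ₀`. -/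
def IsTameAt (β : ℝ) (T : Set (Fin n → K)) (g : (Fin n → K) → (Fin n → K) → Fin l → K)
    (u₀ θ₀ : Fin n → K) : Prop :=
  ∀ ε > 0, ∃ δ, 0 < δ ∧ δ ≤ ε ∧ (∃ W, MellinContinues β (fiberDist g (Metric.ball u₀ δ) θ₀) W) ∧
    ∃ ε' > 0, ∀ θ ∈ T, ‖θ - θ₀‖ < ε' →
      fiberDist g (Metric.ball u₀ δ) θ = fiberDist g (Metric.ball u₀ δ) θ₀

variable {g : (Fin n → K) → (Fin n → K) → Fin l → K} {C β : ℝ} {u₀ θ₀ : Fin n → K}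
  {T : Set (Fin n → K)}

theorem fiberDist_congr {S : Set (Fin n → K)} (hS : MeasurableSet S)
    {g' : (Fin n → K) → (Fin n → K) → Fin l → K} {θ θ' : Fin n → K}
    (h : ∀ u ∈ S, maxAbs (g u θ) = maxAbs (g' u θ')) : fiberDist g S θ = fiberDist g' S θ' :=
  Measure.map_congr (ae_restrict_of_forall_mem hS h)

/-- Near a point where g does not vanish, its absolute value is constant in both variables, so the
distribution is a multiple of a point mass. -/
theorem IsAnalyticFamily.isTameAt_of_ne_zero (hg : IsAnalyticFamily g C) (hT : ∀ θ ∈ T, ‖θ‖ ≤ 1)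
    (hu₀ : ‖u₀‖ ≤ 1) (hθ₀ : θ₀ ∈ T) (h0 : g u₀ θ₀ ≠ 0) : IsTameAt β T g u₀ θ₀ := by
  intro ε hε
  have hC := hg.nonneg
  have hpos : 0 < ‖g u₀ θ₀‖ := norm_pos_iff.mpr h0
  set η := ‖g u₀ θ₀‖ / (C + 1) with hη
  have hη0 : 0 < η := by positivity
  have hconst (u : Fin n → K) (hu : u ∈ Metric.ball u₀ (min (min ε 1) η)) (θ : Fin n → K)
      (hθ : θ ∈ T) (hθ' : ‖θ - θ₀‖ < η) : maxAbs (g u θ) = maxAbs (g u₀ θ₀) := by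
    have hu1 : ‖u‖ ≤ 1 := norm_le_one_of_mem_ball hu₀
      (Metric.ball_subset_ball ((min_le_left _ _).trans (min_le_right _ _)) hu)
    refine maxAbs_eq_of_norm_eq (norm_eq_of_norm_sub_lt ?_)
    refine (hg.norm_sub_le u u₀ θ θ₀ hu1 hu₀ (hT θ hθ) (hT θ₀ hθ₀)).trans_lt ?_
    rw [mem_ball_iff_norm] at hu
    have hmax : max ‖u - u₀‖ ‖θ - θ₀‖ < η := max_lt (hu.trans_le (min_le_right _ _)) hθ'
    calc C * max ‖u - u₀‖ ‖θ - θ₀‖ ≤ (C + 1) * max ‖u - u₀‖ ‖θ - θ₀‖ := by gcongr; linarith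
      _ < (C + 1) * η := by gcongr
      _ = ‖g u₀ θ₀‖ := by rw [hη]; field_simp
  have hself : ‖θ₀ - θ₀‖ < η := by simpa using hη0
  refine ⟨min (min ε 1) η, by positivity, (min_le_left _ _).trans (min_le_left _ _), ?_, η, hη0,
    fun θ hθ hθ' => fiberDist_congr measurableSet_ball fun u hu =>
      (hconst u hu θ hθ hθ').trans (hconst u hu θ₀ hθ₀ hself).symm⟩
  have : fiberDist g (Metric.ball u₀ (min (min ε 1) η)) θ₀ =
      haarK K n (Metric.ball u₀ (min (min ε 1) η)) • Measure.dirac (maxAbs (g u₀ θ₀)) := by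
    rw [fiberDist, Measure.map_congr (g := fun _ => maxAbs (g u₀ θ₀))
      (ae_restrict_of_forall_mem measurableSet_ball fun u hu => hconst u hu θ₀ hθ₀ hself),
      Measure.map_const, Measure.restrict_apply_univ]
  rw [this]
  exact MellinContinues.exists_smul ⟨_, MellinContinues.dirac β (maxAbs_pos h0)⟩
    measure_ball_lt_top.ne

/-- The map ψ_θ(u) = u + B(g(u, θ) - A u) satisfies A ∘ ψ_θ = g(·, θ) and is close to the identity,
hence preserves Haar measure. So the distribution of g(·, θ) is that of the linear map A on a ball,
which does not change with θ close to θ₀. -/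
theorem IsAnalyticFamily.isTameAt_of_isSubmersiveAt (hg : IsAnalyticFamily g C)
    (hT : ∀ θ ∈ T, ‖θ‖ ≤ 1) (hu₀ : ‖u₀‖ ≤ 1) (hθ₀ : θ₀ ∈ T) (h0 : g u₀ θ₀ = 0)
    (hsub : IsSubmersiveAt g u₀ θ₀) (hl : 0 < l) (hβ : -(l : ℝ) ≤ β) : IsTameAt β T g u₀ θ₀ := by
  intro ε₀ hε₀
  obtain ⟨A, B, hAB, ε, hε, H⟩ := hsub
  have hC := hg.nonneg
  set δ := min ε ε₀ with hδdef
  have hδ : 0 < δ := by positivity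
  -- For θ within η of θ₀ the centre ψ_θ(u₀) moves by less than δ, so the image ball stays the same.
  set η := δ / ((‖B‖ + 1) * (C + 1)) with hη
  have hη0 : 0 < η := by positivity
  set ψ : (Fin n → K) → (Fin n → K) → (Fin n → K) := fun θ u => u + B (g u θ - A u) with hψ
  have hψg (θ u : Fin n → K) : A (ψ θ u) = g u θ := by
    simp only [hψ, map_add, hAB]
    abel
  have hnear (θ : Fin n → K) (hθ : θ ∈ T) (hθ' : ‖θ - θ₀‖ < ε) :
      IsNearIdentityOn (ψ θ) u₀ δ := by
    intro x hx y hy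
    have e : ψ θ x - ψ θ y - (x - y) = B (g x θ - g y θ - A (x - y)) := by
      simp only [hψ, map_sub]
      abel
    rw [e]
    exact H x (Metric.ball_subset_ball (min_le_left _ _) hx) y
      (Metric.ball_subset_ball (min_le_left _ _) hy) θ (by rwa [mem_ball_iff_norm]) (hT θ hθ)
  have hdist (θ : Fin n → K) (hθ : θ ∈ T) (hθ' : ‖θ - θ₀‖ < min ε η) :
      fiberDist g (Metric.ball u₀ δ) θ =
        ((haarK K n).restrict (Metric.ball (ψ θ₀ u₀) δ)).map fun w => maxAbs (A w) := by
    have hn := hnear θ hθ (hθ'.trans_le (min_le_left _ _))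
    have hcenter : Metric.ball (ψ θ u₀) δ = Metric.ball (ψ θ₀ u₀) δ := by
      refine (IsUltrametricDist.ball_eq_of_mem ?_).symm
      rw [mem_ball_iff_norm]
      have e : ψ θ u₀ - ψ θ₀ u₀ = B (g u₀ θ - g u₀ θ₀) := by
        simp only [hψ, map_sub]
        abel
      rw [e]
      have h1 := hg.norm_sub_le u₀ u₀ θ θ₀ hu₀ hu₀ (hT θ hθ) (hT θ₀ hθ₀)
      rw [sub_self, norm_zero, max_eq_right (norm_nonneg _)] at h1
      have h2 : ‖θ - θ₀‖ < η := hθ'.trans_le (min_le_right _ _)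
      calc ‖B (g u₀ θ - g u₀ θ₀)‖ ≤ ‖B‖ * (C * ‖θ - θ₀‖) := (B.le_opNorm _).trans (by gcongr)
        _ ≤ (‖B‖ + 1) * ((C + 1) * ‖θ - θ₀‖) := by gcongr <;> linarith
        _ < (‖B‖ + 1) * ((C + 1) * η) := by gcongr
        _ = δ := by rw [hη]; field_simp
    have hm : Measurable fun w => maxAbs (A w) := measurable_maxAbs.comp A.continuous.measurable
    rw [← hcenter, ← hn.map_restrict_ball (haarK K n) hδ measure_ball_lt_top.ne,
      AEMeasurable.map_map_of_aemeasurable hm.aemeasurable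
        (hn.continuousOn.aemeasurable measurableSet_ball)]
    unfold fiberDist
    congr 1
    funext u
    simp only [Function.comp, hψg]
  have hself : ‖θ₀ - θ₀‖ < min ε η := by
    rw [sub_self, norm_zero]; positivity
  refine ⟨δ, hδ, min_le_right _ _, ?_, min ε η, by positivity, fun θ hθ hθ' =>
    (hdist θ hθ hθ').trans (hdist θ₀ hθ₀ hself).symm⟩
  rw [hdist θ₀ hθ₀ hself]
  exact exists_mellin_linearMap (A : (Fin n → K) →ₗ[K] (Fin l → K)) ((hψg θ₀ u₀).trans h0) hδ
    (Or.inl ⟨fun y => ⟨B y, hAB y⟩, hl, hβ⟩)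

/-- Without surjectivity g is not straightened, but ‖g(u, θ₀)‖ = ‖A(u - u₀)‖ near u₀, which is
enough for the distribution at θ₀. Nothing is learnt about other θ, so θ₀ has to be isolated in T.
-/
theorem isTameAt_of_injective (hu : g u₀ θ₀ = 0) {A : (Fin n → K) →L[K] (Fin l → K)}
    (hA : HasStrictFDerivAt (fun u => g u θ₀) A u₀) (hinj : Function.Injective A)
    (hT : ∃ ε > 0, ∀ θ ∈ T, ‖θ - θ₀‖ < ε → θ = θ₀) (hn : 0 < n) (hβ : -(n : ℝ) ≤ β) :
    IsTameAt β T g u₀ θ₀ := by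
  intro ε₀ hε₀
  obtain ⟨B₀, hB₀⟩ := (A : (Fin n → K) →ₗ[K] (Fin l → K)).exists_leftInverse_of_injective
    (LinearMap.ker_eq_bot.mpr hinj)
  let B : (Fin l → K) →L[K] (Fin n → K) := ⟨B₀, LinearMap.continuous_of_finiteDimensional B₀⟩
  have hBA (x : Fin n → K) : B (A x) = x := LinearMap.congr_fun hB₀ x
  -- With ‖u - u₀‖ ≤ (‖B‖ + 1) ‖A(u - u₀)‖ this makes the linearization error at most half of ‖A(u -
  -- u₀)‖.
  set η : ℝ := 1 / (2 * (‖B‖ + 1)) with hη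
  have hη0 : 0 < η := by positivity
  obtain ⟨s, hs, happ⟩ := hA.approximates_deriv_on_nhds (c := ⟨η, hη0.le⟩) (Or.inr hη0)
  obtain ⟨ε₁, hε₁, hball⟩ := Metric.mem_nhds_iff.mp hs
  set δ := min ε₁ ε₀
  have hδ : 0 < δ := by positivity
  have hnorm (u : Fin n → K) (huδ : u ∈ Metric.ball u₀ δ) : ‖g u θ₀‖ = ‖A (u - u₀)‖ := by
    by_cases h0 : u = u₀
    · simp [h0, hu]
    have hpos : 0 < ‖u - u₀‖ := norm_pos_iff.mpr (sub_ne_zero.mpr h0)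
    have h1 : ‖g u θ₀ - g u₀ θ₀ - A (u - u₀)‖ ≤ η * ‖u - u₀‖ :=
      happ u (hball (Metric.ball_subset_ball (min_le_left _ _) huδ)) u₀ (mem_of_mem_nhds hs)
    rw [hu, sub_zero] at h1
    refine norm_eq_of_norm_sub_lt (h1.trans_lt ?_)
    have h2 : ‖u - u₀‖ ≤ (‖B‖ + 1) * ‖A (u - u₀)‖ := by
      calc ‖u - u₀‖ = ‖B (A (u - u₀))‖ := by rw [hBA]
        _ ≤ ‖B‖ * ‖A (u - u₀)‖ := B.le_opNorm _
        _ ≤ _ := by gcongr; linarith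
    have h3 : η * ‖u - u₀‖ ≤ 1 / 2 * ‖A (u - u₀)‖ := by
      calc η * ‖u - u₀‖ ≤ η * ((‖B‖ + 1) * ‖A (u - u₀)‖) := by gcongr
        _ = 1 / 2 * ‖A (u - u₀)‖ := by rw [hη]; field_simp
    have h4 : 0 < ‖A (u - u₀)‖ := by
      by_contra! h5
      have : ‖A (u - u₀)‖ = 0 := le_antisymm h5 (norm_nonneg _)
      rw [this, mul_zero] at h2
      exact absurd hpos (not_lt.mpr h2)
    linarith
  obtain ⟨ε', hε', hT'⟩ := hT
  refine ⟨δ, hδ, min_le_right _ _, ?_, ε', hε', fun θ hθ hθ' => by rw [hT' θ hθ hθ']⟩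
  have hψ : IsNearIdentityOn (fun w : Fin n → K => w - u₀) u₀ δ := fun x _ y _ => by
    have : (x - u₀) - (y - u₀) - (x - y) = 0 := by abel
    simp only [this, norm_zero]
    positivity
  have h1 := hψ.map_restrict_ball (haarK K n) hδ measure_ball_lt_top.ne
  rw [sub_self] at h1
  have h2 : fiberDist g (Metric.ball u₀ δ) θ₀ =
      ((haarK K n).restrict (Metric.ball 0 δ)).map fun w => maxAbs (A w) := by
    have hm : Measurable fun w => maxAbs (A w) := measurable_maxAbs.comp A.continuous.measurable
    rw [← h1, Measure.map_map hm (by fun_prop)]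
    exact Measure.map_congr (ae_restrict_of_forall_mem measurableSet_ball fun u hu =>
      maxAbs_eq_of_norm_eq (hnorm u hu))
  rw [h2]
  exact exists_mellin_linearMap (A : (Fin n → K) →ₗ[K] (Fin l → K)) (map_zero _) hδ
    (Or.inr ⟨hinj, hn, hβ⟩)

end Tame

/-! ### The torus of units and the compact set of parameters -/

section Torus

variable {K : Type*} [NontriviallyNormedField K] [PadicField K] {n l : ℕ}

/-- The compact torus of vectors of units. -/
def unitTorus (K : Type*) [NontriviallyNormedField K] (n : ℕ) : Set (Fin n → K) :=
  {u | ∀ j, ‖u j‖ = 1}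

theorem norm_le_one_of_mem_unitTorus {K : Type*} [NontriviallyNormedField K] {u : Fin n → K}
    (hu : u ∈ unitTorus K n) : ‖u‖ ≤ 1 :=
  (pi_norm_le_iff_of_nonneg zero_le_one).mpr fun j => (hu j).le

theorem isClosed_unitTorus : IsClosed (unitTorus K n) := by
  have : unitTorus K n = ⋂ j, {u | ‖u j‖ = 1} := by
    ext u
    simp [unitTorus]
  rw [this]
  exact isClosed_iInter fun j => isClosed_eq (by fun_prop) continuous_const

theorem isCompact_unitTorus : IsCompact (unitTorus K n) :=
  (isCompact_closedBall (0 : Fin n → K) 1).of_isClosed_subset isClosed_unitTorus fun u hu => by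
    rw [mem_closedBall_zero_iff]
    exact norm_le_one_of_mem_unitTorus hu

theorem ball_subset_unitTorus {u : Fin n → K} (hu : u ∈ unitTorus K n) {δ : ℝ} (hδ : δ ≤ 1) :
    Metric.ball u δ ⊆ unitTorus K n := by
  intro x hx j
  rw [← hu j]
  refine norm_eq_of_norm_sub_lt ?_
  rw [hu j]
  rw [mem_ball_iff_norm] at hx
  exact (norm_le_pi_norm (x - u) j).trans_lt (hx.trans_le hδ)

/-- The vectors all of whose entries are zero or a power of `ϖ`. -/
def powerVectors (ϖ : K) (n : ℕ) : Set (Fin n → K) :=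
  Set.pi univ fun _ => insert 0 (range fun a : ℕ => ϖ ^ a)

variable {ϖ : K}

theorem IsUniformizer.isCompact_powerVectors (h : IsUniformizer ϖ) :
    IsCompact (powerVectors ϖ n) :=
  isCompact_univ_pi fun _ =>
    (tendsto_pow_atTop_nhds_zero_of_norm_lt_one h.norm_lt_one).isCompact_insert_range

theorem IsUniformizer.norm_le_one_of_mem_powerVectors (h : IsUniformizer ϖ) {θ : Fin n → K}
    (hθ : θ ∈ powerVectors ϖ n) : ‖θ‖ ≤ 1 := by
  refine (pi_norm_le_iff_of_nonneg zero_le_one).mpr fun j => ?_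
  rcases hθ j (mem_univ j) with h0 | ⟨a, ha⟩
  · simp [h0]
  · rw [← ha]
    simp only [norm_pow]
    exact pow_le_one₀ h.norm_pos.le h.norm_lt_one.le

theorem pow_mem_powerVectors {K : Type*} [NontriviallyNormedField K] {ϖ : K}
    (a : Fin n → ℕ) : (fun i => ϖ ^ a i) ∈ powerVectors ϖ n :=
  fun i _ => Or.inr ⟨a i, rfl⟩

/-- A locally constant function on `powerVectors ϖ n` depends on exponents up to a bound only. -/
theorem IsUniformizer.exists_eq_min (h : IsUniformizer ϖ) {X : Type*} (D : (Fin n → K) → X)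
    (hD : ∀ θ₀ ∈ powerVectors ϖ n, ∃ ε > 0, ∀ θ ∈ powerVectors ϖ n, ‖θ - θ₀‖ < ε → D θ = D θ₀) :
    ∃ N : ℕ, ∀ a : Fin n → ℕ, D (fun i => ϖ ^ a i) = D fun i => ϖ ^ min (a i) N := by
  choose! ε hε hDε using hD
  -- Let δ be a Lebesgue number of the cover by balls of constancy. If ‖ϖ‖^N < δ, truncating
  -- exponents at N moves the vector by less than δ, so both vectors lie in one ball of the cover.
  obtain ⟨δ, hδ, hcov⟩ := lebesgue_number_lemma_of_metric (ι := powerVectors ϖ n)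
    (c := fun θ => Metric.ball θ.1 (ε θ.1)) h.isCompact_powerVectors (fun θ => Metric.isOpen_ball)
    fun θ hθ => mem_iUnion.mpr ⟨⟨θ, hθ⟩, Metric.mem_ball_self (hε θ hθ)⟩
  obtain ⟨N, hN⟩ := exists_pow_lt_of_lt_one hδ h.norm_lt_one
  refine ⟨N, fun a => ?_⟩
  obtain ⟨θ₀, hθ₀⟩ := hcov _ (pow_mem_powerVectors (ϖ := ϖ) a)
  have hmem : (fun i => ϖ ^ min (a i) N) ∈ Metric.ball (fun i => ϖ ^ a i) δ := by
    rw [mem_ball_iff_norm, pi_norm_lt_iff hδ]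
    intro i
    change ‖ϖ ^ min (a i) N - ϖ ^ a i‖ < δ
    rcases le_total (a i) N with hi | hi
    · simpa [min_eq_left hi] using hδ
    · rw [min_eq_right hi]
      refine (norm_sub_le_max_of_ultrametric _ _).trans_lt (max_lt ?_ ?_) <;> rw [norm_pow]
      · exact hN
      · exact (pow_le_pow_of_le_one h.norm_pos.le h.norm_lt_one.le hi).trans_lt hN
  have h1 := hθ₀ (Metric.mem_ball_self hδ)
  have h2 := hθ₀ hmem
  rw [mem_ball_iff_norm] at h1 h2
  rw [hDε θ₀ θ₀.2 _ (pow_mem_powerVectors a) h1,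
    hDε θ₀ θ₀.2 _ (pow_mem_powerVectors fun i => min (a i) N) h2]

/-- A power ϖ^b has distance at least ‖ϖ^b‖ from 0 and from every other power; parameters can
accumulate only where a coordinate is 0. -/
theorem IsUniformizer.exists_isolated (h : IsUniformizer ϖ) {θ₀ : Fin n → K}
    (hθ₀ : ∀ i, θ₀ i ≠ 0) (hmem : θ₀ ∈ powerVectors ϖ n) :
    ∃ ε > 0, ∀ θ ∈ powerVectors ϖ n, ‖θ - θ₀‖ < ε → θ = θ₀ := by
  have hinj (a b : ℕ) (hab : ‖ϖ ^ a - ϖ ^ b‖ < ‖ϖ ^ b‖) : a = b := by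
    have := norm_eq_of_norm_sub_lt hab
    rw [norm_pow, norm_pow] at this
    exact pow_right_injective₀ h.norm_pos h.norm_lt_one.ne this
  have hev : ∀ᶠ ε : ℝ in 𝓝[>] 0, ∀ i ∈ (Finset.univ : Finset (Fin n)), ε < ‖θ₀ i‖ :=
    (Filter.eventually_all_finset _).mpr fun i _ =>
      (Filter.Tendsto.eventually_lt_const (norm_pos_iff.mpr (hθ₀ i))
        (tendsto_id.mono_left nhdsWithin_le_nhds))
  obtain ⟨ε, hε, hε0⟩ := (hev.and self_mem_nhdsWithin).exists
  refine ⟨ε, hε0, fun θ hθ hlt => funext fun i => ?_⟩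
  have hi : ‖θ i - θ₀ i‖ < ‖θ₀ i‖ :=
    ((norm_le_pi_norm (θ - θ₀) i).trans_lt hlt).trans (hε i (Finset.mem_univ i))
  rcases hmem i (mem_univ i) with h0 | ⟨b, hb⟩
  · exact absurd h0 (hθ₀ i)
  rcases hθ i (mem_univ i) with h0 | ⟨a, ha⟩
  · rw [h0, zero_sub, norm_neg] at hi
    exact absurd hi (lt_irrefl _)
  · simp only at ha hb
    rw [← ha, ← hb] at hi ⊢
    rw [hinj a b hi]

theorem IsAnalyticFamily.continuousOn {g : (Fin n → K) → (Fin n → K) → Fin l → K} {C : ℝ}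
    (hg : IsAnalyticFamily g C) {θ : Fin n → K} (hθ : ‖θ‖ ≤ 1) :
    ContinuousOn (fun u => g u θ) (Metric.closedBall 0 1) := by
  refine LipschitzOnWith.continuousOn (K := ⟨C, hg.nonneg⟩)
    (LipschitzOnWith.of_dist_le_mul fun x hx y hy => ?_)
  rw [mem_closedBall_zero_iff] at hx hy
  rw [dist_eq_norm, dist_eq_norm]
  have := hg.norm_sub_le x y θ θ hx hy hθ hθ
  rwa [sub_self, norm_zero, max_eq_left (norm_nonneg _)] at this

variable [MeasurableSpace K] [BorelSpace K]

theorem IsAnalyticFamily.fiberDist_biUnion {g : (Fin n → K) → (Fin n → K) → Fin l → K} {C : ℝ}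
    (hg : IsAnalyticFamily g C) {θ : Fin n → K} (hθ : ‖θ‖ ≤ 1) {ι : Type*} (t : Finset ι)
    (S : ι → Set (Fin n → K)) (hS : ∀ i, MeasurableSet (S i))
    (hd : (t : Set ι).PairwiseDisjoint S) (hsub : ∀ i ∈ t, S i ⊆ Metric.closedBall 0 1) :
    fiberDist g (⋃ i ∈ t, S i) θ = ∑ i ∈ t, fiberDist g (S i) θ := by
  unfold fiberDist
  have hr : (haarK K n).restrict (⋃ i ∈ t, S i) = ∑ i ∈ t, (haarK K n).restrict (S i) := by
    rw [Measure.restrict_biUnion_finset hd hS]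
    exact Measure.sum_coe_finset t fun i => (haarK K n).restrict (S i)
  rw [hr, Measure.map_finset_sum]
  rw [← hr]
  have hm : MeasurableSet (⋃ i ∈ t, S i) := Finset.measurableSet_biUnion t fun i _ => hS i
  exact measurable_maxAbs.comp_aemeasurable
    (((hg.continuousOn hθ).mono (iUnion₂_subset hsub)).aemeasurable hm)

/-- If `g` is tame at all points of a compact open part of the torus over `θ₀`, then the
distribution on the torus is locally constant at `θ₀`. -/
theorem IsAnalyticFamily.exists_fiberDist_eq {g : (Fin n → K) → (Fin n → K) → Fin l → K} {C β : ℝ}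
    (hg : IsAnalyticFamily g C) {T : Set (Fin n → K)} (hT : ∀ θ ∈ T, ‖θ‖ ≤ 1)
    {U : Set ((Fin n → K) × (Fin n → K))} (hU : IsClopen U) {θ₀ : Fin n → K} (hθ₀ : θ₀ ∈ T)
    (htame : ∀ u ∈ unitTorus K n, (u, θ₀) ∈ U → IsTameAt β T g u θ₀) :
    (∃ W, MellinContinues β (fiberDist g {u ∈ unitTorus K n | (u, θ₀) ∈ U} θ₀) W) ∧
    ∃ ε > 0, ∀ θ ∈ T, ‖θ - θ₀‖ < ε →
      fiberDist g {u ∈ unitTorus K n | (u, θ) ∈ U} θ =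
        fiberDist g {u ∈ unitTorus K n | (u, θ₀) ∈ U} θ₀ := by
  classical
  -- Since U is clopen, membership is locally constant in (u, θ); cutting out U therefore does not
  -- disturb local constancy in θ.
  have hloc (u : Fin n → K) : ∃ ε > 0, ∀ u' ∈ Metric.ball u ε, ∀ θ ∈ Metric.ball θ₀ ε,
      ((u', θ) ∈ U ↔ (u, θ₀) ∈ U) := by
    by_cases hu : (u, θ₀) ∈ U
    · obtain ⟨ε, hε, h⟩ := Metric.isOpen_iff.mp hU.isOpen _ hu
      refine ⟨ε, hε, fun u' hu' θ hθ => iff_of_true (h ?_) hu⟩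
      rw [← ball_prod_same]
      exact ⟨hu', hθ⟩
    · obtain ⟨ε, hε, h⟩ := Metric.isOpen_iff.mp hU.compl.isOpen (u, θ₀) hu
      refine ⟨ε, hε, fun u' hu' θ hθ => iff_of_false (h ?_) hu⟩
      rw [← ball_prod_same]
      exact ⟨hu', hθ⟩
  have hdata (u : Fin n → K) (hu : u ∈ unitTorus K n) : ∃ δ ε : ℝ, 0 < δ ∧ δ ≤ 1 ∧ 0 < ε ∧
      (∀ u' ∈ Metric.ball u δ, ∀ θ, ‖θ - θ₀‖ < ε → ((u', θ) ∈ U ↔ (u, θ₀) ∈ U)) ∧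
      ((u, θ₀) ∈ U → (∃ W, MellinContinues β (fiberDist g (Metric.ball u δ) θ₀) W) ∧
        ∀ θ ∈ T, ‖θ - θ₀‖ < ε →
          fiberDist g (Metric.ball u δ) θ = fiberDist g (Metric.ball u δ) θ₀) := by
    obtain ⟨ε₁, hε₁, h₁⟩ := hloc u
    by_cases huU : (u, θ₀) ∈ U
    · obtain ⟨δ, hδ, hδle, hW, ε₂, hε₂, h₂⟩ := htame u hu huU (min ε₁ 1) (by positivity)
      refine ⟨δ, min ε₁ ε₂, hδ, hδle.trans (min_le_right _ _), by positivity,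
        fun u' hu' θ hθ => h₁ u' (Metric.ball_subset_ball (hδle.trans (min_le_left _ _)) hu') θ ?_,
        fun _ => ⟨hW, fun θ hθT hθ => h₂ θ hθT (hθ.trans_le (min_le_right _ _))⟩⟩
      rw [mem_ball_iff_norm]
      exact hθ.trans_le (min_le_left _ _)
    · refine ⟨min ε₁ 1, ε₁, by positivity, min_le_right _ _, hε₁,
        fun u' hu' θ hθ => h₁ u' (Metric.ball_subset_ball (min_le_left _ _) hu') θ ?_,
        fun h => absurd h huU⟩
      rwa [mem_ball_iff_norm]
  choose! δ ε hδ hδ1 hε hUiff hgood using hdata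
  obtain ⟨t, htS, hcov, hdisj⟩ := exists_finset_disjoint_balls isCompact_unitTorus δ hδ
  have hev : ∀ᶠ e : ℝ in 𝓝[>] 0, ∀ u ∈ t, e < ε u :=
    (Filter.eventually_all_finset _).mpr fun u hu =>
      (Filter.Tendsto.eventually_lt_const (hε u (htS hu))
        (tendsto_id.mono_left nhdsWithin_le_nhds))
  obtain ⟨e, he, he0⟩ := (hev.and self_mem_nhdsWithin).exists
  set t' := t.filter fun u => (u, θ₀) ∈ U with ht'
  have hset (θ : Fin n → K) (hθ : ‖θ - θ₀‖ < e) :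
      {u ∈ unitTorus K n | (u, θ) ∈ U} = ⋃ u ∈ t', Metric.ball u (δ u) := by
    ext u
    simp only [mem_iUnion, ht', Finset.mem_filter]
    constructor
    · rintro ⟨hu, huU⟩
      obtain ⟨x, hx, hux⟩ := mem_iUnion₂.mp (hcov hu)
      exact ⟨x, ⟨hx, (hUiff x (htS hx) u hux θ (hθ.trans (he x hx))).mp huU⟩, hux⟩
    · rintro ⟨x, ⟨hx, hxU⟩, hux⟩
      exact ⟨ball_subset_unitTorus (htS hx) (hδ1 x (htS hx)) hux,
        (hUiff x (htS hx) u hux θ (hθ.trans (he x hx))).mpr hxU⟩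
  have hsum (θ : Fin n → K) (hθT : θ ∈ T) (hθ : ‖θ - θ₀‖ < e) :
      fiberDist g {u ∈ unitTorus K n | (u, θ) ∈ U} θ =
        ∑ u ∈ t', fiberDist g (Metric.ball u (δ u)) θ := by
    rw [hset θ hθ]
    refine hg.fiberDist_biUnion (hT θ hθT) t' _ (fun u => measurableSet_ball)
      (hdisj.subset (Finset.coe_subset.mpr (Finset.filter_subset _ _))) fun u hu => ?_
    have hut := htS (Finset.mem_of_mem_filter u hu)
    intro x hx
    rw [mem_closedBall_zero_iff]
    exact norm_le_one_of_mem_unitTorus (ball_subset_unitTorus hut (hδ1 u hut) hx)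
  have hself : ‖θ₀ - θ₀‖ < e := by simpa using he0
  constructor
  · rw [hsum θ₀ hθ₀ hself]
    exact MellinContinues.exists_finsetSum t' _ fun u hu =>
      (hgood u (htS (Finset.mem_of_mem_filter u hu)) (Finset.mem_filter.mp hu).2).1
  · refine ⟨e, he0, fun θ hθT hθ => ?_⟩
    rw [hsum θ hθT hθ, hsum θ₀ hθ₀ hself]
    refine Finset.sum_congr rfl fun u hu => ?_
    have hut := Finset.mem_filter.mp hu
    exact (hgood u (htS hut.1) hut.2).2 θ hθT (hθ.trans (he u hut.1))

end Torus

/-! ### The contribution of one cone -/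

section Piece

variable {K : Type*} [NontriviallyNormedField K] [PadicField K] {n l : ℕ} {ϖ : K}

/-- The points whose vector of orders lies in the cone `k₀ + ∑ ℕ vᵢ`. -/
def conePiece (ϖ : K) (k₀ : Fin n → ℕ) (v : Fin n → Fin n → ℕ) : Set (Fin n → K) :=
  {x | ∃ a, ∀ j, ‖x j‖ = ‖ϖ‖ ^ conePoint k₀ v a j}

/-- The monomial parametrization of a cone piece. -/
def toricPoint (ϖ : K) (k₀ : Fin n → ℕ) (v : Fin n → Fin n → ℕ) (u θ : Fin n → K) : Fin n → K :=
  fun j => ϖ ^ k₀ j * u j * ∏ i, θ i ^ v i j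

theorem toricPoint_pow {K : Type*} [NontriviallyNormedField K] (ϖ : K) (k₀ : Fin n → ℕ)
    (v : Fin n → Fin n → ℕ) (u : Fin n → K) (a : Fin n → ℕ) :
    toricPoint ϖ k₀ v u (fun i => ϖ ^ a i) = monomialScale ϖ (conePoint k₀ v a) u := by
  funext j
  simp only [toricPoint, monomialScale, conePoint, ← pow_mul, Finset.prod_pow_eq_pow_sum, pow_add]
  ring

theorem continuous_toricPoint (ϖ : K) (k₀ : Fin n → ℕ) (v : Fin n → Fin n → ℕ) :
    Continuous fun p : (Fin n → K) × (Fin n → K) => toricPoint ϖ k₀ v p.1 p.2 := by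
  unfold toricPoint
  fun_prop

theorem image_monomialScale_unitTorus (h : IsUniformizer ϖ) (k : Fin n → ℕ) :
    monomialScale ϖ k '' unitTorus K n = {x | ∀ j, ‖x j‖ = ‖ϖ‖ ^ k j} := by
  ext x
  constructor
  · rintro ⟨u, hu, rfl⟩ j
    rw [monomialScale, norm_mul, hu j, norm_pow, mul_one]
  · intro hx
    refine ⟨fun j => (ϖ ^ k j)⁻¹ * x j, fun j => ?_, ?_⟩
    · rw [norm_mul, norm_inv, norm_pow, hx j, inv_mul_cancel₀ (pow_ne_zero _ h.norm_pos.ne')]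
    · funext j
      rw [monomialScale, mul_inv_cancel_left₀ (pow_ne_zero _ h.ne_zero)]

theorem IsUniformizer.maxAbs_pow_smul (h : IsUniformizer ϖ) (k : ℕ) (z : Fin l → K) :
    maxAbs (ϖ ^ k • z) = ((residueCard K : ℝ)⁻¹) ^ k * maxAbs z := by
  obtain ⟨c, -, hc, hmax⟩ := h.exists_maxAbs_eq_rpow
  rw [hmax, hmax, norm_smul, norm_pow, Real.mul_rpow (by positivity) (norm_nonneg _),
    ← Real.rpow_natCast ‖ϖ‖ k, ← Real.rpow_mul h.norm_pos.le, mul_comm (k : ℝ),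
    Real.rpow_mul h.norm_pos.le, hc, Real.rpow_natCast]

variable [MeasurableSpace K] [BorelSpace K]

/-- The piece is the disjoint union over a of the images of unit vectors u under multiplication by
ϖ^(k₀ + ∑ aᵢ vᵢ). This scaling multiplies Haar measure by q^(-|k₀|) ∏ q^(-aᵢ |vᵢ|), and `hfg`
contributes the factor ∏ q^(-aᵢ Mᵢ) to |f|_K. What remains is the distribution of g(·, ϖ^a), a
function of the truncated exponents by tameness and compactness, so `exists_sum_pi` sums over a.
Tameness is needed also at the limit points θ₀ with zero coordinates. -/
theorem exists_mellin_conePiece (h : IsUniformizer ϖ) (k₀ : Fin n → ℕ) (v : Fin n → Fin n → ℕ)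
    (hinj : Function.Injective (conePoint k₀ v)) (M : Fin n → ℕ) {β : ℝ}
    (hM : ∀ i, ∀ x : ℝ, β < x → 0 < (∑ j, v i j : ℕ) + (M i : ℝ) * x)
    {g : (Fin n → K) → (Fin n → K) → Fin l → K} {C : ℝ} (hg : IsAnalyticFamily g C)
    {U : Set (Fin n → K)} (hU : IsClopen U) {f : (Fin n → K) → Fin l → K} (hf : ContinuousOn f U)
    (hfg : ∀ a : Fin n → ℕ, ∀ u ∈ unitTorus K n,
      monomialScale ϖ (conePoint k₀ v a) u ∈ U →
      f (monomialScale ϖ (conePoint k₀ v a) u) = ϖ ^ (∑ i, a i * M i) • g u fun i => ϖ ^ a i)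
    (htame : ∀ θ₀ ∈ powerVectors ϖ n, ∀ u ∈ unitTorus K n, toricPoint ϖ k₀ v u θ₀ ∈ U →
      IsTameAt β (powerVectors ϖ n) g u θ₀) :
    ∃ W, MellinContinues β
      (((haarK K n).restrict (U ∩ conePiece ϖ k₀ v)).map fun x => maxAbs (f x)) W := by
  have hq1 := one_lt_residueCard_real K
  have hq0 : (0 : ℝ) < (residueCard K : ℝ)⁻¹ := inv_pos.mpr (by linarith)
  set U' : Set ((Fin n → K) × (Fin n → K)) := (fun p => toricPoint ϖ k₀ v p.1 p.2) ⁻¹' U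
  have hU' : IsClopen U' := hU.preimage (continuous_toricPoint ϖ k₀ v)
  have hT : ∀ θ ∈ powerVectors ϖ n, ‖θ‖ ≤ 1 := fun θ hθ => h.norm_le_one_of_mem_powerVectors hθ
  set D : (Fin n → K) → Measure ℝ := fun θ => fiberDist g {u ∈ unitTorus K n | (u, θ) ∈ U'} θ
  have hD (θ₀ : Fin n → K) (hθ₀ : θ₀ ∈ powerVectors ϖ n) :=
    hg.exists_fiberDist_eq hT hU' hθ₀ (htame θ₀ hθ₀)
  obtain ⟨N, hN⟩ := h.exists_eq_min D fun θ₀ hθ₀ => (hD θ₀ hθ₀).2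
  obtain ⟨W, hW⟩ := MellinContinues.exists_sum_pi (β := β)
    (fun i => (residueCard K : ℝ≥0)⁻¹ ^ (∑ j, v i j)) (fun i => ((residueCard K : ℝ)⁻¹) ^ M i)
    (fun i => pow_pos hq0 _) (fun i x hx => by
      push_cast
      rw [← Real.rpow_natCast, ← Real.rpow_natCast, ← Real.rpow_mul hq0.le, ← Real.rpow_add hq0]
      exact Real.rpow_lt_one hq0.le (inv_lt_one_of_one_lt₀ hq1) (hM i x hx))
    (fun a => D fun i => ϖ ^ a i) N (fun a => (hD _ (pow_mem_powerVectors a)).1) hN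
  obtain ⟨W', hW'⟩ := MellinContinues.exists_smul ⟨W, hW⟩
    (c := ((residueCard K : ℝ≥0∞)⁻¹) ^ ∑ j, k₀ j)
    (ENNReal.pow_ne_top (ENNReal.inv_ne_top.mpr (residueCard_ennreal_ne_zero K)))
  refine ⟨W', ?_⟩
  convert! hW' using 1
  set E : (Fin n → ℕ) → Set (Fin n → K) := fun a =>
    {u ∈ unitTorus K n | (u, fun i => ϖ ^ a i) ∈ U'} with hE
  have hEmem (a : Fin n → ℕ) (u : Fin n → K) :
      u ∈ E a ↔ u ∈ unitTorus K n ∧ monomialScale ϖ (conePoint k₀ v a) u ∈ U := by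
    simp only [hE, mem_ofPred_eq, ← toricPoint_pow]
    rfl
  have hEm (a : Fin n → ℕ) : MeasurableSet (E a) := by
    have : E a = unitTorus K n ∩ monomialScale ϖ (conePoint k₀ v a) ⁻¹' U := by
      ext u
      exact hEmem a u
    rw [this]
    exact isClosed_unitTorus.measurableSet.inter
      ((continuous_monomialScale ϖ _).measurable hU.isOpen.measurableSet)
  have himage (a : Fin n → ℕ) : monomialScale ϖ (conePoint k₀ v a) '' E a =
      U ∩ {x | ∀ j, ‖x j‖ = ‖ϖ‖ ^ conePoint k₀ v a j} := by
    rw [← image_monomialScale_unitTorus h]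
    ext x
    constructor
    · rintro ⟨u, hu, rfl⟩
      exact ⟨((hEmem a u).mp hu).2, u, hu.1, rfl⟩
    · rintro ⟨hxU, u, hu, rfl⟩
      exact ⟨u, (hEmem a u).mpr ⟨hu, hxU⟩, rfl⟩
  have hIm (a : Fin n → ℕ) : MeasurableSet (monomialScale ϖ (conePoint k₀ v a) '' E a) := by
    rw [himage]
    refine hU.isOpen.measurableSet.inter ?_
    rw [ofPred_forall]
    exact MeasurableSet.iInter fun j =>
      measurableSet_eq_fun (measurable_pi_apply j).norm measurable_const
  have hunion : U ∩ conePiece ϖ k₀ v = ⋃ a, monomialScale ϖ (conePoint k₀ v a) '' E a := by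
    simp only [himage, ← inter_iUnion]
    congr 1
    ext x
    simp [conePiece]
  have hdisj : Pairwise (Function.onFun Disjoint fun a =>
      monomialScale ϖ (conePoint k₀ v a) '' E a) := by
    intro a b hab
    refine Set.disjoint_left.mpr fun x hxa hxb => hab (hinj (funext fun j => ?_))
    simp only [himage] at hxa hxb
    have := (hxa.2 j).symm.trans (hxb.2 j)
    exact pow_right_injective₀ h.norm_pos h.norm_lt_one.ne this
  have hsum : (haarK K n).restrict (U ∩ conePiece ϖ k₀ v) = Measure.sum fun a =>
      (haarK K n).restrict (monomialScale ϖ (conePoint k₀ v a) '' E a) := by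
    rw [hunion, Measure.restrict_iUnion hdisj hIm]
  have hfm : AEMeasurable (fun x => maxAbs (f x))
      ((haarK K n).restrict (U ∩ conePiece ϖ k₀ v)) := by
    refine measurable_maxAbs.comp_aemeasurable ((hf.mono inter_subset_left).aemeasurable ?_)
    rw [hunion]
    exact MeasurableSet.iUnion hIm
  rw [hsum] at hfm ⊢
  rw [Measure.map_sum hfm]
  have hsmul : ∀ (c : ℝ≥0∞) (ν : (Fin n → ℕ) → Measure ℝ),
      c • Measure.sum ν = Measure.sum fun a => c • ν a := fun c ν => by
    refine Measure.ext fun s hs => ?_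
    simp only [Measure.smul_apply, Measure.sum_apply _ hs, smul_eq_mul, ENNReal.tsum_mul_left]
  rw [hsmul]
  congr 1
  funext a
  have hfma := hfm.mono_measure (Measure.le_sum _ a)
  have hsm : Measurable (monomialScale ϖ (conePoint k₀ v a)) :=
    (continuous_monomialScale ϖ _).measurable
  rw [h.restrict_image_monomialScale] at hfma ⊢
  have hne : ((residueCard K : ℝ≥0∞)⁻¹) ^ (∑ j, conePoint k₀ v a j) ≠ 0 :=
    pow_ne_zero _ (ENNReal.inv_ne_zero.mpr (ENNReal.natCast_ne_top _))
  rw [Measure.map_smul, AEMeasurable.map_map_of_aemeasurable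
    ((aemeasurable_smul_measure_iff hne).mp hfma) hsm.aemeasurable]
  have hcongr : ((haarK K n).restrict (E a)).map
      ((fun x => maxAbs (f x)) ∘ monomialScale ϖ (conePoint k₀ v a)) =
      (D fun i => ϖ ^ a i).map fun x => (∏ i, (((residueCard K : ℝ)⁻¹) ^ M i) ^ a i) * x := by
    have hgm : AEMeasurable (fun u => maxAbs (g u fun i => ϖ ^ a i))
        ((haarK K n).restrict (E a)) := by
      refine measurable_maxAbs.comp_aemeasurable (((hg.continuousOn
        (hT _ (pow_mem_powerVectors a))).mono fun u hu => ?_).aemeasurable (hEm a))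
      rw [mem_closedBall_zero_iff]
      exact norm_le_one_of_mem_unitTorus hu.1
    simp only [D, fiberDist]
    rw [AEMeasurable.map_map_of_aemeasurable (by fun_prop) hgm]
    refine Measure.map_congr (ae_restrict_of_forall_mem (hEm a) fun u hu => ?_)
    have hu' := (hEmem a u).mp hu
    simp only [Function.comp, hfg a u hu'.1 hu'.2, h.maxAbs_pow_smul]
    congr 1
    rw [← Finset.prod_pow_eq_pow_sum]
    exact Finset.prod_congr rfl fun i _ => by rw [← pow_mul, mul_comm]
  rw [hcongr, scaleMeasure, ENNReal.smul_def, smul_smul]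
  congr 1
  have hexp : ∑ j, conePoint k₀ v a j = ∑ j, k₀ j + ∑ i, a i * ∑ j, v i j := by
    simp only [conePoint, Finset.sum_add_distrib, Finset.mul_sum]
    rw [Finset.sum_comm]
  have hQ : (((residueCard K : ℝ≥0)⁻¹ : ℝ≥0) : ℝ≥0∞) = (residueCard K : ℝ≥0∞)⁻¹ := by
    rw [ENNReal.coe_inv, ENNReal.coe_natCast]
    have := one_lt_residueCard K
    exact (zero_lt_one.trans this).ne'
  rw [hexp, pow_add]
  congr 1
  rw [← Finset.prod_pow_eq_pow_sum, ENNReal.ofNNReal_finsetProd]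
  refine Finset.prod_congr rfl fun i _ => ?_
  rw [ENNReal.coe_pow, ENNReal.coe_pow, hQ, ← pow_mul, mul_comm]

end Piece

/-! ### Face polynomials and their Jacobian matrices -/

section Polynomial

theorem hasStrictFDerivAt_eval {K : Type*} [NontriviallyNormedField K] {n : ℕ}
    (P : MvPolynomial (Fin n) K) (z : Fin n → K) :
    HasStrictFDerivAt (fun x => MvPolynomial.eval x P)
      (∑ j, MvPolynomial.eval z (MvPolynomial.pderiv j P) •
        (ContinuousLinearMap.proj j : (Fin n → K) →L[K] K)) z := by
  induction P using MvPolynomial.induction_on with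
  | C a =>
    simp only [MvPolynomial.eval_C]
    refine (hasStrictFDerivAt_const (𝕜 := K) a z).congr_fderiv ?_
    ext x
    simp
  | add p q hp hq =>
    simp only [map_add]
    refine (hp.add hq).congr_fderiv ?_
    ext x
    simp [add_mul, Finset.sum_add_distrib]
  | mul_X p i hp =>
    have hX : HasStrictFDerivAt (fun x : Fin n → K => x i)
        (ContinuousLinearMap.proj i : (Fin n → K) →L[K] K) z :=
      (ContinuousLinearMap.proj i : (Fin n → K) →L[K] K).hasStrictFDerivAt
    have := hp.mul hX
    simp only [map_mul, MvPolynomial.eval_X]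
    refine this.congr_fderiv ?_
    ext x
    simp only [add_apply, smul_apply,
      ContinuousLinearMap.proj_apply, sum_apply, smul_eq_mul,
      MvPolynomial.pderiv_mul, map_add, map_mul, MvPolynomial.eval_X, add_mul,
      Finset.sum_add_distrib, Finset.mul_sum]
    rw [add_comm]
    congr 1
    · exact Finset.sum_congr rfl fun j _ => by ring
    · rw [Finset.sum_eq_single i]
      · simp
      · intro j _ hj
        simp [MvPolynomial.pderiv_X_of_ne hj.symm]
      · simp

variable {K : Type*} [Field K] {n l : ℕ}

/-- The vector of coefficients of `x ^ m`. -/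
def coeffVec (F : Fin l → MvPowerSeries (Fin n) K) (m : Fin n →₀ ℕ) : Fin l → K :=
  fun i => MvPowerSeries.coeff m (F i)

theorem mem_unionSupport_iff {F : Fin l → MvPowerSeries (Fin n) K} {m : Fin n →₀ ℕ} :
    m ∈ unionSupport F ↔ coeffVec F m ≠ 0 := by
  simp [unionSupport, coeffVec, funext_iff]

/-- The pairing of an exponent vector and a weight vector. -/
def expDot (m : Fin n →₀ ℕ) (k : Fin n → ℕ) : ℕ := ∑ j, m j * k j

theorem expDot_sum {ι : Type*} (m : Fin n →₀ ℕ) (s : Finset ι) (v : ι → Fin n → ℕ) :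
    expDot m (∑ i ∈ s, v i) = ∑ i ∈ s, expDot m (v i) := by
  simp only [expDot, Finset.sum_apply, Finset.mul_sum]
  exact Finset.sum_comm

theorem facePart_eq_sum {F : Fin l → MvPowerSeries (Fin n) K} {τ : Set (Fin n → ℝ)}
    {S : Finset (Fin n →₀ ℕ)} (hS : ∀ m, m ∈ S ↔ m ∈ unionSupport F ∧ realPoint m ∈ τ)
    (i : Fin l) : facePart (F i) τ = ∑ m ∈ S, MvPolynomial.monomial m (coeffVec F m i) := by
  have := finsum_mem_eq_sum_of_inter_support_eq (s := {m | realPoint m ∈ τ}) (t := S)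
    (fun m : Fin n →₀ ℕ => MvPolynomial.monomial m (coeffVec F m i)) ?_
  · exact this
  · ext m
    simp only [mem_inter_iff, mem_ofPred_eq, Function.mem_support, ne_eq, Finset.mem_coe, hS,
      MvPolynomial.monomial_eq_zero, mem_unionSupport_iff]
    have : ¬ coeffVec F m i = 0 → coeffVec F m ≠ 0 := fun h h' => h (by simp [h'])
    tauto

theorem eval_facePart {K : Type*} [NontriviallyNormedField K]
    {F : Fin l → MvPowerSeries (Fin n) K} {τ : Set (Fin n → ℝ)}
    {S : Finset (Fin n →₀ ℕ)} (hS : ∀ m, m ∈ S ↔ m ∈ unionSupport F ∧ realPoint m ∈ τ)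
    (z : Fin n → K) : (fun i => MvPolynomial.eval z (facePart (F i) τ)) =
      ∑ m ∈ S, monomialValue m z • coeffVec F m := by
  funext i
  simp only [facePart_eq_sum hS, map_sum, MvPolynomial.eval_monomial, Finset.sum_apply,
    Pi.smul_apply, smul_eq_mul, monomialValue]
  refine Finset.sum_congr rfl fun m _ => ?_
  rw [mul_comm, Finsupp.prod_fintype _ _ fun _ => pow_zero _]

/-- The Jacobian matrix of the face polynomials. -/
noncomputable def faceJacobian (F : Fin l → MvPowerSeries (Fin n) K) (τ : Set (Fin n → ℝ))
    (z : Fin n → K) : Matrix (Fin l) (Fin n) K :=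
  Matrix.of fun i j => MvPolynomial.eval z (MvPolynomial.pderiv j (facePart (F i) τ))

/-- Euler's identity at a zero: a weight for which the face polynomials are homogeneous gives a
vector in the kernel of the Jacobian matrix. -/
theorem faceJacobian_mulVec_eq_zero {F : Fin l → MvPowerSeries (Fin n) K} {τ : Set (Fin n → ℝ)}
    {S : Finset (Fin n →₀ ℕ)} (hS : ∀ m, m ∈ S ↔ m ∈ unionSupport F ∧ realPoint m ∈ τ)
    {w : Fin n → ℕ} {d : ℕ} (hw : ∀ m ∈ S, expDot m w = d) {z : Fin n → K}
    (hz : ∀ i, MvPolynomial.eval z (facePart (F i) τ) = 0) :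
    (faceJacobian F τ z).mulVec (fun j => (w j : K) * z j) = 0 := by
  funext i
  have hom : (facePart (F i) τ).IsWeightedHomogeneous w d := by
    rw [facePart_eq_sum hS]
    refine (MvPolynomial.weightedHomogeneousSubmodule K w d).sum_mem fun m hm => ?_
    refine MvPolynomial.isWeightedHomogeneous_monomial w m _ ?_
    rw [← hw m hm, Finsupp.weight_apply, Finsupp.sum_fintype _ _ fun _ => by simp]
    rfl
  have := congrArg (MvPolynomial.eval z) hom.sum_weight_X_mul_pderiv
  simp only [map_sum, map_nsmul, map_mul, MvPolynomial.eval_X, hz, smul_zero] at this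
  rw [Matrix.mulVec, dotProduct, Pi.zero_apply, ← this]
  refine Finset.sum_congr rfl fun j _ => ?_
  rw [faceJacobian, Matrix.of_apply, nsmul_eq_mul]
  ring

theorem surjective_or_injective_of_rank {A : Matrix (Fin l) (Fin n) K} (h : A.rank = min l n) :
    Function.Surjective A.mulVec ∨ n < l ∧ Function.Injective A.mulVec := by
  rcases le_or_gt l n with hln | hln
  · refine Or.inl ?_
    have : LinearMap.range A.mulVecLin = ⊤ :=
      Submodule.eq_top_of_finrank_eq (by
        rw [← Matrix.rank, h, min_eq_left hln, Module.finrank_fin_fun])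
    exact LinearMap.range_eq_top.mp this
  · refine Or.inr ⟨hln, ?_⟩
    have hk := A.mulVecLin.finrank_range_add_finrank_ker
    rw [← Matrix.rank, h, min_eq_right hln.le, Module.finrank_fin_fun] at hk
    have : LinearMap.ker A.mulVecLin = ⊥ := Submodule.finrank_eq_zero.mp (by omega)
    exact LinearMap.ker_eq_bot.mp this

end Polynomial

/-! ### The map in toric coordinates and its restriction to strata -/

section Toric

theorem PadicField.charZero (K : Type*) [NontriviallyNormedField K] [PadicField K] :
    CharZero K := by
  obtain ⟨p, _, _, _⟩ := PadicField.exists_finiteDimensional (K := K)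
  exact charZero_of_injective_algebraMap (algebraMap ℚ_[p] K).injective

variable {K : Type*} [NontriviallyNormedField K] [IsUltrametricDist K] {n l : ℕ} {ϖ : K}

/-- The series `F` in the toric coordinates of a cone, divided by the monomial `θ ^ M`. -/
noncomputable def toricFamily (F : Fin l → MvPowerSeries (Fin n) K) (ϖ : K) (k₀ : Fin n → ℕ)
    (v : Fin n → Fin n → ℕ) (M : Fin n → ℕ) : (Fin n → K) → (Fin n → K) → Fin l → K :=
  seriesFamily (fun m : Fin n →₀ ℕ => ϖ ^ expDot m k₀ • coeffVec F m)
    (fun m => m) fun m i => expDot m (v i) - M i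

theorem monomialValue_toricPoint {K : Type*} [NontriviallyNormedField K] {ϖ : K}
    {k₀ : Fin n → ℕ} {v : Fin n → Fin n → ℕ} {M : Fin n → ℕ}
    {m : Fin n →₀ ℕ} (hm : ∀ i, M i ≤ expDot m (v i)) (u θ : Fin n → K) :
    monomialValue m (toricPoint ϖ k₀ v u θ) = monomialValue M θ *
      (ϖ ^ expDot m k₀ * (monomialValue m u *
        monomialValue (fun i => expDot m (v i) - M i) θ)) := by
  have h1 : monomialValue (fun i => expDot m (v i)) θ =
      monomialValue M θ * monomialValue (fun i => expDot m (v i) - M i) θ := by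
    simp only [monomialValue, ← Finset.prod_mul_distrib, ← pow_add]
    exact Finset.prod_congr rfl fun i _ => by rw [Nat.add_sub_cancel' (hm i)]
  have h2 : monomialValue (fun i => expDot m (v i)) θ = ∏ j, (∏ i, θ i ^ v i j) ^ m j := by
    simp only [monomialValue, expDot, ← Finset.prod_pow, ← pow_mul]
    rw [Finset.prod_comm]
    simp only [Finset.prod_pow_eq_pow_sum, mul_comm]
  calc monomialValue m (toricPoint ϖ k₀ v u θ)
      = ϖ ^ expDot m k₀ * monomialValue m u * ∏ j, (∏ i, θ i ^ v i j) ^ m j := by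
        simp only [monomialValue, toricPoint, mul_pow, Finset.prod_mul_distrib, expDot,
          ← Finset.prod_pow_eq_pow_sum, ← pow_mul, mul_comm]
    _ = _ := by rw [← h2, h1]; ring

variable {F : Fin l → MvPowerSeries (Fin n) K} {k₀ : Fin n → ℕ} {v : Fin n → Fin n → ℕ}
  {M : Fin n → ℕ}

theorem toricFamily_eq (hM : ∀ m ∈ unionSupport F, ∀ i, M i ≤ expDot m (v i))
    (u θ : Fin n → K) :
    monomialValue M θ • toricFamily F ϖ k₀ v M u θ =
      ∑' m : Fin n →₀ ℕ, monomialValue m (toricPoint ϖ k₀ v u θ) • coeffVec F m := by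
  rw [toricFamily, seriesFamily, ← tsum_const_smul'']
  refine tsum_congr fun m => ?_
  by_cases hm : m ∈ unionSupport F
  · rw [monomialValue_toricPoint (hM m hm), smul_smul, smul_smul]
    congr 1
    ring
  · rw [mem_unionSupport_iff, not_not] at hm
    simp [hm]

/-- The replacement of the coordinates that vanish by `1`. -/
noncomputable def fillOnes (θ : Fin n → K) : Fin n → K := by
  classical exact fun i => if θ i = 0 then 1 else θ i

theorem fillOnes_ne_zero {K : Type*} [NontriviallyNormedField K]
    (θ : Fin n → K) (i : Fin n) : fillOnes θ i ≠ 0 := by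
  unfold fillOnes
  split_ifs with h
  · exact one_ne_zero
  · exact h

/-- On the stratum of `θ` the family is given by the polynomials of a face. -/
theorem toricFamily_eq_facePart (hM : ∀ m ∈ unionSupport F, ∀ i, M i ≤ expDot m (v i))
    {τ : Set (Fin n → ℝ)} {S : Finset (Fin n →₀ ℕ)}
    (hS : ∀ m, m ∈ S ↔ m ∈ unionSupport F ∧ realPoint m ∈ τ) {θ : Fin n → K}
    (hτ : ∀ m ∈ unionSupport F, realPoint m ∈ τ ↔ ∀ i, θ i = 0 → expDot m (v i) = M i)
    (u : Fin n → K) :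
    monomialValue M (fillOnes θ) • toricFamily F ϖ k₀ v M u θ =
      fun i => MvPolynomial.eval (toricPoint ϖ k₀ v u (fillOnes θ)) (facePart (F i) τ) := by
  rw [eval_facePart hS, toricFamily, seriesFamily, tsum_eq_sum (s := S), Finset.smul_sum]
  · refine Finset.sum_congr rfl fun m hm => ?_
    have hm' := (hS m).mp hm
    rw [monomialValue_toricPoint (hM m hm'.1), smul_smul, smul_smul]
    congr 1
    -- On the face the exponent of θᵢ is 0 whenever θᵢ = 0, so replacing θᵢ by 1 there changes
    -- nothing.
    have : monomialValue (fun i => expDot m (v i) - M i) θ =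
        monomialValue (fun i => expDot m (v i) - M i) (fillOnes θ) := by
      refine Finset.prod_congr rfl fun i _ => ?_
      by_cases hi : θ i = 0
      · simp [(hτ m hm'.1).mp hm'.2 i hi]
      · simp [fillOnes, hi]
    rw [this]
    ring
  · intro m hm
    by_cases hsupp : m ∈ unionSupport F
    · have : ¬ ∀ i, θ i = 0 → expDot m (v i) = M i := fun h =>
        hm ((hS m).mpr ⟨hsupp, (hτ m hsupp).mpr h⟩)
      push Not at this
      obtain ⟨i, hi, hne⟩ := this
      have : monomialValue (fun i => expDot m (v i) - M i) θ = 0 := by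
        refine Finset.prod_eq_zero (Finset.mem_univ i) ?_
        rw [hi]
        exact zero_pow (Nat.sub_ne_zero_of_lt (lt_of_le_of_ne (hM m hsupp i) hne.symm))
      rw [this, mul_zero, zero_smul]
    · rw [mem_unionSupport_iff, not_not] at hsupp
      simp [hsupp]

theorem toricPoint_ne_zero {K : Type*} [NontriviallyNormedField K] {ϖ : K}
    {k₀ : Fin n → ℕ}
    {v : Fin n → Fin n → ℕ} (hϖ : ϖ ≠ 0) {u θ : Fin n → K} (hu : ∀ j, u j ≠ 0)
    (hθ : ∀ i, θ i ≠ 0) (j : Fin n) : toricPoint ϖ k₀ v u θ j ≠ 0 :=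
  mul_ne_zero (mul_ne_zero (pow_ne_zero _ hϖ) (hu j))
    (Finset.prod_ne_zero_iff.mpr fun i _ => pow_ne_zero _ (hθ i))

/-- The rank condition on the face belonging to the stratum of `θ` controls the derivative of the
family. -/
theorem exists_hasStrictFDerivAt_toricFamily {K : Type*} [NontriviallyNormedField K]
    [PadicField K] {ϖ : K} {F : Fin l → MvPowerSeries (Fin n) K} (hϖ : ϖ ≠ 0)
    (hM : ∀ m ∈ unionSupport F, ∀ i, M i ≤ expDot m (v i)) (hv : ∀ i, v i ≠ 0)
    {τ : Set (Fin n → ℝ)} {S : Finset (Fin n →₀ ℕ)}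
    (hS : ∀ m, m ∈ S ↔ m ∈ unionSupport F ∧ realPoint m ∈ τ) {u θ : Fin n → K}
    (hτ : ∀ m ∈ unionSupport F, realPoint m ∈ τ ↔ ∀ i, θ i = 0 → expDot m (v i) = M i)
    (hrank : RankCondition F τ) (hu : ∀ j, u j ≠ 0)
    (h0 : toricFamily F ϖ k₀ v M u θ = 0) :
    ∃ A : (Fin n → K) →L[K] (Fin l → K),
      HasStrictFDerivAt (fun u => toricFamily F ϖ k₀ v M u θ) A u ∧
      (Function.Surjective A ∨ Function.Injective A ∧ ∀ i, θ i ≠ 0) := by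
  have := PadicField.charZero K
  set z := toricPoint ϖ k₀ v u (fillOnes θ) with hz
  set κ := monomialValue M (fillOnes θ)
  have hκ : κ ≠ 0 := Finset.prod_ne_zero_iff.mpr fun i _ => pow_ne_zero _ (fillOnes_ne_zero θ i)
  have hz0 (j : Fin n) : z j ≠ 0 := toricPoint_ne_zero hϖ hu (fillOnes_ne_zero θ) j
  -- As a function of u the family is the face map composed with an invertible diagonal map and
  -- multiplied by κ⁻¹, so the rank of the face Jacobian is inherited by its derivative.
  have hg (u : Fin n → K) : toricFamily F ϖ k₀ v M u θ = κ⁻¹ • fun i =>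
      MvPolynomial.eval (toricPoint ϖ k₀ v u (fillOnes θ)) (facePart (F i) τ) := by
    rw [← toricFamily_eq_facePart hM hS hτ u, inv_smul_smul₀ hκ]
  have hzero (i : Fin l) : MvPolynomial.eval z (facePart (F i) τ) = 0 := by
    have := hg u
    rw [h0, eq_comm, smul_eq_zero_iff_right (inv_ne_zero hκ)] at this
    exact congrFun this i
  have hr : (faceJacobian F τ z).rank = min l n := hrank z hz0 hzero
  -- the diagonal map and the derivative
  set d : Fin n → K := fun j => ϖ ^ k₀ j * ∏ i, fillOnes θ i ^ v i j with hd
  have hd0 (j : Fin n) : d j ≠ 0 := mul_ne_zero (pow_ne_zero _ hϖ)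
    (Finset.prod_ne_zero_iff.mpr fun i _ => pow_ne_zero _ (fillOnes_ne_zero θ i))
  let D : (Fin n → K) →L[K] (Fin n → K) :=
    ContinuousLinearMap.pi fun j => d j • ContinuousLinearMap.proj j
  have hD (x : Fin n → K) : D x = toricPoint ϖ k₀ v x (fillOnes θ) := by
    funext j
    simp only [D, toricPoint, ContinuousLinearMap.pi_apply, smul_apply,
      ContinuousLinearMap.proj_apply, smul_eq_mul, hd]
    ring
  let J : (Fin n → K) →L[K] (Fin l → K) := ContinuousLinearMap.pi fun i =>
    ∑ j, MvPolynomial.eval z (MvPolynomial.pderiv j (facePart (F i) τ)) •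
      (ContinuousLinearMap.proj j : (Fin n → K) →L[K] K)
  have hJ (x : Fin n → K) : J x = (faceJacobian F τ z).mulVec x := by
    funext i
    simp [J, faceJacobian, Matrix.mulVec, dotProduct]
  have hDbij : Function.Bijective D := by
    refine ⟨fun x y hxy => funext fun j => ?_, fun y => ⟨fun j => (d j)⁻¹ * y j, ?_⟩⟩
    · have := congrFun hxy j
      simp only [D, ContinuousLinearMap.pi_apply, smul_apply,
        ContinuousLinearMap.proj_apply, smul_eq_mul] at this
      exact mul_left_cancel₀ (hd0 j) this
    · funext j
      simp only [D, ContinuousLinearMap.pi_apply, smul_apply,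
        ContinuousLinearMap.proj_apply, smul_eq_mul]
      exact mul_inv_cancel_left₀ (hd0 j) _
  refine ⟨κ⁻¹ • J.comp D, ?_, ?_⟩
  · have h1 : HasStrictFDerivAt (fun x : Fin n → K => fun i =>
        MvPolynomial.eval x (facePart (F i) τ)) J (D u) := by
      rw [hD]
      exact hasStrictFDerivAt_pi.mpr fun i => hasStrictFDerivAt_eval _ _
    have h2 := (h1.comp u D.hasStrictFDerivAt).const_smul κ⁻¹
    refine h2.congr_of_eventuallyEq (Eventually.of_forall fun x => ?_)
    simp only [hD]
    exact (hg x).symm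
  · rcases surjective_or_injective_of_rank hr with hs | ⟨hln, hi⟩
    · refine Or.inl fun y => ?_
      obtain ⟨x, hx⟩ := hs (κ • y)
      obtain ⟨x', rfl⟩ := hDbij.2 x
      refine ⟨x', ?_⟩
      simp only [smul_apply, ContinuousLinearMap.comp_apply, hJ, hx,
        inv_smul_smul₀ hκ]
    · refine Or.inr ⟨fun x y hxy => hDbij.1 (hi ?_), fun i hi0 => ?_⟩
      · simp only [smul_apply, ContinuousLinearMap.comp_apply, hJ] at hxy
        exact smul_right_injective _ (inv_ne_zero hκ) hxy
      -- If θᵢ = 0, the face polynomials are homogeneous for the weight vᵢ, and Euler's identity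
      -- puts the vector with entries v i j · z j in the kernel. As K has characteristic 0 and no z
      -- j vanishes, injectivity would give vᵢ = 0.
      · have hw : ∀ m ∈ S, expDot m (v i) = M i := fun m hm =>
          (hτ m ((hS m).mp hm).1).mp ((hS m).mp hm).2 i hi0
        have hk := faceJacobian_mulVec_eq_zero hS hw hzero
        rw [← Matrix.mulVec_zero (faceJacobian F τ z)] at hk
        refine hv i (funext fun j => ?_)
        have := congrFun (hi hk) j
        simpa [hz0 j] using this

end Toric

/-! ### Faces, supporting weights and minimizing exponents of the Newton polyhedron -/

section Newton

variable {n : ℕ} {G : Set (Fin n →₀ ℕ)}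

theorem realPoint_dotProduct (m : Fin n →₀ ℕ) (w : Fin n → ℕ) :
    realPoint m ⬝ᵥ (fun j => (w j : ℝ)) = expDot m w := by
  simp [dotProduct, realPoint, expDot]

theorem realPoint_mem_newtonPolyhedron {m : Fin n →₀ ℕ} (hm : m ∈ G) {x : Fin n → ℝ}
    (hx : realPoint m ≤ x) : x ∈ newtonPolyhedron G :=
  subset_convexHull ℝ _ (mem_biUnion hm hx)

theorem isLinearMap_dotProduct (w : Fin n → ℝ) : IsLinearMap ℝ fun x : Fin n → ℝ => x ⬝ᵥ w :=
  ⟨fun x y => add_dotProduct x y w, fun c x => smul_dotProduct c x w⟩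

theorem le_dotProduct_of_mem {w : Fin n → ℝ} (hw : 0 ≤ w) {c : ℝ}
    (hc : ∀ m ∈ G, c ≤ realPoint m ⬝ᵥ w) : newtonPolyhedron G ⊆ {x | c ≤ x ⬝ᵥ w} := by
  refine convexHull_min (iUnion₂_subset fun m hm x hx => ?_)
    (convex_halfSpace_ge (isLinearMap_dotProduct w) c)
  exact (hc m hm).trans (dotProduct_le_dotProduct_of_nonneg_right hx hw)

theorem le_dotProduct_of_mem_closure {w : Fin n → ℝ} (hw : 0 ≤ w) {c : ℝ}
    (hc : ∀ m ∈ G, c ≤ realPoint m ⬝ᵥ w) {x : Fin n → ℝ} (hx : x ∈ closure (newtonPolyhedron G)) :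
    c ≤ x ⬝ᵥ w := by
  have hcl : IsClosed {x : Fin n → ℝ | c ≤ x ⬝ᵥ w} :=
    isClosed_le continuous_const (continuous_id.dotProduct continuous_const)
  exact closure_minimal (le_dotProduct_of_mem hw hc) hcl hx

/-- The points of `Γ` of weight `c`. -/
def weightFace (G : Set (Fin n →₀ ℕ)) (w : Fin n → ℕ) (c : ℕ) : Set (Fin n → ℝ) :=
  {x ∈ newtonPolyhedron G | x ⬝ᵥ (fun j => (w j : ℝ)) = c}

theorem realPoint_mem_weightFace {w : Fin n → ℕ} {c : ℕ} {m : Fin n →₀ ℕ} (hm : m ∈ G) :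
    realPoint m ∈ weightFace G w c ↔ expDot m w = c := by
  simp only [weightFace, mem_ofPred_eq, realPoint_mem_newtonPolyhedron hm le_rfl, true_and,
    realPoint_dotProduct, Nat.cast_inj]

theorem cast_le_dotProduct {w : Fin n → ℕ} {c : ℕ} (hc : ∀ m ∈ G, c ≤ expDot m w)
    {x : Fin n → ℝ} (hx : x ∈ closure (newtonPolyhedron G)) :
    (c : ℝ) ≤ x ⬝ᵥ (fun j => (w j : ℝ)) :=
  le_dotProduct_of_mem_closure (fun _ => Nat.cast_nonneg _)
    (fun m hm => by rw [realPoint_dotProduct]; exact_mod_cast hc m hm) hx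

theorem isFace_weightFace {w : Fin n → ℕ} {c : ℕ} (hc : ∀ m ∈ G, c ≤ expDot m w)
    (hex : ∃ m ∈ G, expDot m w = c) : IsFace (newtonPolyhedron G) (weightFace G w c) := by
  obtain ⟨m₀, hm₀, hmc⟩ := hex
  have h0 := (realPoint_mem_weightFace (w := w) (c := c) hm₀).mpr hmc
  refine ⟨⟨_, h0⟩, fun _ => ?_⟩
  -- The sign is reversed because exposed faces are defined by maxima, whereas a weight selects its
  -- minimum.
  let L : StrongDual ℝ (Fin n → ℝ) :=
    -∑ j, (w j : ℝ) • (ContinuousLinearMap.proj j : (Fin n → ℝ) →L[ℝ] ℝ)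
  have hL (x : Fin n → ℝ) : L x = -(x ⬝ᵥ fun j => (w j : ℝ)) := by
    simp [L, dotProduct, mul_comm]
  refine ⟨L, ?_⟩
  ext x
  simp only [weightFace, mem_ofPred_eq, hL, neg_le_neg_iff]
  refine and_congr_right fun hx => ⟨fun h y hy => ?_, fun h => le_antisymm ?_ ?_⟩
  · rw [h]; exact cast_le_dotProduct hc (subset_closure hy)
  · rw [← h0.2]; exact h _ h0.1
  · exact cast_le_dotProduct hc (subset_closure hx)

theorem finite_setOf_expDot_eq {w : Fin n → ℕ} (hw : ∀ j, 0 < w j) (c : ℕ) :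
    {m : Fin n →₀ ℕ | expDot m w = c}.Finite := by
  refine Set.Finite.of_finite_image (f := fun m : Fin n →₀ ℕ => (m : Fin n → ℕ)) ?_
    DFunLike.coe_injective.injOn
  refine (Set.finite_Iic fun _ : Fin n => c).subset ?_
  rintro _ ⟨m, hm, rfl⟩ j
  rw [← show expDot m w = c from hm]
  exact (Nat.le_mul_of_pos_right _ (hw j)).trans
    (Finset.single_le_sum (f := fun j => m j * w j) (fun _ _ => Nat.zero_le _)
      (Finset.mem_univ j))

/-- For positive weights, a point of m + ℝ₊ⁿ has weight c only if it is m itself and m has weight c.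
The hull of these finitely many exponents, together with the open half-space of larger weight, is
convex and contains Γ. So the face is the hull of a finite set. -/
theorem isCompact_weightFace {w : Fin n → ℕ} (hw : ∀ j, 0 < w j) {c : ℕ}
    (hc : ∀ m ∈ G, c ≤ expDot m w) : IsCompact (weightFace G w c) := by
  set w' : Fin n → ℝ := fun j => (w j : ℝ) with hw'
  set P : Set (Fin n → ℝ) := realPoint '' {m ∈ G | expDot m w = c} with hP
  have hPfin : P.Finite := ((finite_setOf_expDot_eq hw c).subset fun m hm => hm.2).image _
  have hPc : convexHull ℝ P ⊆ {x | x ⬝ᵥ w' = c} := by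
    refine convexHull_min ?_ (convex_hyperplane (isLinearMap_dotProduct w') c)
    rintro _ ⟨m, hm, rfl⟩
    rw [mem_ofPred_eq, realPoint_dotProduct, hm.2]
  set Q : Set (Fin n → ℝ) := convexHull ℝ P ∪ {x | (c : ℝ) < x ⬝ᵥ w'} with hQ
  have hQc : ∀ x ∈ Q, (c : ℝ) ≤ x ⬝ᵥ w' := by
    rintro x (hx | hx)
    · exact (hPc hx).ge
    · exact le_of_lt hx
  have hconv : Convex ℝ Q := by
    refine convex_iff_forall_pos.mpr fun x hx y hy a b ha hb hab => ?_
    have hxc := hQc x hx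
    have hyc := hQc y hy
    have hval : (a • x + b • y) ⬝ᵥ w' = a * (x ⬝ᵥ w') + b * (y ⬝ᵥ w') := by
      rw [add_dotProduct, smul_dotProduct, smul_dotProduct, smul_eq_mul, smul_eq_mul]
    have hc1 : (c : ℝ) = a * c + b * c := by rw [← add_mul, hab, one_mul]
    rcases hx with hx | hx
    · rcases hy with hy | hy
      · exact Or.inl (convex_convexHull ℝ P hx hy ha.le hb.le hab)
      · refine Or.inr ?_
        rw [mem_ofPred_eq, hval, hc1]
        exact add_lt_add_of_le_of_lt (mul_le_mul_of_nonneg_left hxc ha.le)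
          (mul_lt_mul_of_pos_left hy hb)
    · refine Or.inr ?_
      rw [mem_ofPred_eq, hval, hc1]
      exact add_lt_add_of_lt_of_le (mul_lt_mul_of_pos_left hx ha)
        (mul_le_mul_of_nonneg_left hyc hb.le)
  have hsub : newtonPolyhedron G ⊆ Q := by
    refine convexHull_min (iUnion₂_subset fun m hm x hx => ?_) hconv
    by_cases hxm : x = realPoint m ∧ expDot m w = c
    · exact Or.inl (subset_convexHull ℝ _ ⟨m, ⟨hm, hxm.2⟩, hxm.1.symm⟩)
    · refine Or.inr ?_
      rw [mem_ofPred_eq]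
      have h1 : (c : ℝ) ≤ realPoint m ⬝ᵥ w' := by
        rw [realPoint_dotProduct]; exact_mod_cast hc m hm
      have h2 : realPoint m ⬝ᵥ w' ≤ x ⬝ᵥ w' :=
        dotProduct_le_dotProduct_of_nonneg_right hx fun _ => Nat.cast_nonneg _
      refine lt_of_le_of_ne (h1.trans h2) fun heq => hxm ⟨?_, ?_⟩
      · have h3 : ∑ j, realPoint m j * w' j = ∑ j, x j * w' j :=
          le_antisymm h2 (heq.symm.trans_le h1)
        have h4 := (Finset.sum_eq_sum_iff_of_le fun j _ => mul_le_mul_of_nonneg_right (hx j)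
          (Nat.cast_nonneg (α := ℝ) (w j))).mp h3
        funext j
        exact (mul_right_cancel₀ (Nat.cast_ne_zero.mpr (hw j).ne') (h4 j (Finset.mem_univ j))).symm
      · have : (expDot m w : ℝ) = c := by
          rw [← realPoint_dotProduct]
          exact le_antisymm (h2.trans heq.symm.le) h1
        exact_mod_cast this
  have : weightFace G w c = convexHull ℝ P := by
    refine Subset.antisymm (fun x hx => ?_) fun x hx => ⟨?_, hPc hx⟩
    · rcases hsub hx.1 with h | h
      · exact h
      · exact absurd hx.2 (ne_of_gt h)
    · refine convexHull_min ?_ (convex_convexHull ℝ _) hx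
      rintro _ ⟨m, hm, rfl⟩
      exact realPoint_mem_newtonPolyhedron hm.1 le_rfl
  rw [this]
  exact hPfin.isCompact_convexHull ℝ

/-- A supporting hyperplane at a diagonal point which is not interior. -/
theorem exists_supporting_weight {t : ℝ} (hG : G.Nonempty)
    (ht : (fun _ => t) ∉ interior (newtonPolyhedron G)) :
    ∃ κ : Fin n → ℝ, (∀ j, 0 ≤ κ j) ∧ (∃ j, 0 < κ j) ∧
      ∀ m ∈ G, t * ∑ j, κ j ≤ ∑ j, m j * κ j := by
  obtain ⟨m₀, hm₀⟩ := hG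
  have hconv : Convex ℝ (newtonPolyhedron G) := convex_convexHull ℝ _
  have hopen : IsOpen {x : Fin n → ℝ | ∀ j, realPoint m₀ j < x j} := by
    simp only [ofPred_forall]
    exact isOpen_iInter_of_finite fun j => isOpen_lt continuous_const (continuous_apply j)
  have hne : (interior (newtonPolyhedron G)).Nonempty :=
    ⟨fun j => realPoint m₀ j + 1, interior_maximal (fun x hx =>
      realPoint_mem_newtonPolyhedron hm₀ fun j => (hx j).le) hopen fun j => lt_add_one _⟩
  obtain ⟨f, hf⟩ := geometric_hahn_banach_open_point hconv.interior isOpen_interior ht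
  have hle : ∀ x ∈ newtonPolyhedron G, f x ≤ f fun _ => t := by
    intro x hx
    have hx' := subset_closure hx
    rw [← hconv.closure_interior_eq_closure_of_nonempty_interior hne] at hx'
    exact closure_minimal (fun y hy => (hf y hy).le) (isClosed_le f.continuous continuous_const) hx'
  have hfsum (x : Fin n → ℝ) : f x = ∑ j, x j * f (Pi.single j 1) := by
    conv_lhs => rw [← Finset.univ_sum_single x, map_sum]
    refine Finset.sum_congr rfl fun j _ => ?_
    rw [← smul_eq_mul, ← map_smul, ← Pi.single_smul, smul_eq_mul, mul_one]
  -- Γ is stable under adding multiples of the basis vectors, so a functional bounded above on it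
  -- cannot be positive on them; κ is its negative.
  have hneg (j : Fin n) : f (Pi.single j 1) ≤ 0 := by
    by_contra! hpos
    obtain ⟨r, hr⟩ := exists_nat_gt ((f (fun _ => t) - f (realPoint m₀)) / f (Pi.single j 1))
    rw [div_lt_iff₀ hpos] at hr
    have := hle (realPoint m₀ + (r : ℝ) • Pi.single j 1)
      (realPoint_mem_newtonPolyhedron hm₀ (le_add_of_nonneg_right
        (smul_nonneg (Nat.cast_nonneg r) (Pi.single_nonneg.mpr zero_le_one))))
    rw [map_add, map_smul, smul_eq_mul] at this
    linarith
  refine ⟨fun j => -f (Pi.single j 1), fun j => neg_nonneg.mpr (hneg j), ?_, fun m hm => ?_⟩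
  · by_contra! hall
    have h0 (j : Fin n) : f (Pi.single j 1) = 0 := le_antisymm (hneg j) (by linarith [hall j])
    obtain ⟨y, hy⟩ := hne
    have := hf y hy
    rw [hfsum y, hfsum fun _ => t] at this
    simp [h0] at this
  · have := hle _ (realPoint_mem_newtonPolyhedron hm le_rfl)
    rw [hfsum, hfsum fun _ => t] at this
    simp only [realPoint] at this
    simp only [mul_neg, Finset.sum_neg_distrib, Finset.mul_sum]
    exact neg_le_neg this

/-- Dickson's lemma: up to the sign of finitely many linear forms, the set `G` has a common
minimizer for all cone generators. -/
theorem exists_forms_minimizer (hG : G.Nonempty) :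
    ∃ Ls : List (Fin n → ℤ), ∀ v : Fin n → Fin n → ℕ, (∀ L ∈ Ls, IsDefinite L v) →
      ∃ m₀ ∈ G, ∀ m ∈ G, ∀ i, expDot m₀ (v i) ≤ expDot m (v i) := by
  have hanti : IsAntichain (· ≤ ·) {m | Minimal (· ∈ G) m} := setOfPred_minimal_antichain _
  have hfin : {m | Minimal (· ∈ G) m}.Finite := WellQuasiOrderedLE.finite_of_isAntichain hanti
  set B := hfin.toFinset with hB
  have hmin (m : Fin n →₀ ℕ) (hm : m ∈ G) : ∃ b ∈ B, b ≤ m := by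
    obtain ⟨b, hbm, hb⟩ := exists_minimal_le_of_wellFoundedLT (· ∈ G) m hm
    exact ⟨b, hfin.mem_toFinset.mpr hb, hbm⟩
  have hBG (b) (hb : b ∈ B) : b ∈ G := (hfin.mem_toFinset.mp hb).prop
  have hBne : B.Nonempty := by
    obtain ⟨m, hm⟩ := hG
    obtain ⟨b, hb, -⟩ := hmin m hm
    exact ⟨b, hb⟩
  refine ⟨(B ×ˢ B).toList.map fun p j => (p.1 j : ℤ) - p.2 j, fun v hv => ?_⟩
  -- Among the finitely many minimal exponents, m₀ minimizes the sum of the values on all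
  -- generators. If b - m₀ is nonpositive on every generator, minimality of the sum forces equality
  -- on each, so m₀ minimizes on every generator separately.
  obtain ⟨m₀, hm₀, hle⟩ := B.exists_min_image (fun m => ∑ i, expDot m (v i)) hBne
  refine ⟨m₀, hBG m₀ hm₀, fun m hm i => ?_⟩
  obtain ⟨b, hb, hbm⟩ := hmin m hm
  have hbm' : expDot b (v i) ≤ expDot m (v i) :=
    Finset.sum_le_sum fun j _ => Nat.mul_le_mul_right _ (hbm j)
  refine le_trans ?_ hbm'
  have hdef := hv (fun j => (b j : ℤ) - m₀ j)
    (List.mem_map.mpr ⟨(b, m₀), by simp [hb, hm₀], rfl⟩)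
  have hform (i : Fin n) : formValue (fun j => (b j : ℤ) - m₀ j) (v i) =
      (expDot b (v i) : ℤ) - expDot m₀ (v i) := by
    simp [formValue, expDot, sub_mul, Finset.sum_sub_distrib]
  simp only [IsDefinite, hform] at hdef
  rcases hdef with h | h
  · have := h i; omega
  · have h1 : ∀ i ∈ (Finset.univ : Finset (Fin n)), expDot b (v i) ≤ expDot m₀ (v i) :=
      fun i _ => by have := h i; omega
    have h2 := (Finset.sum_eq_sum_iff_of_le h1).mp
      (le_antisymm (Finset.sum_le_sum h1) (hle b hb))
    exact (h2 i (Finset.mem_univ i)).ge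

end Newton

/-! ### Splitting a cone into two halves -/

section ConeSubdivision

variable {n : ℕ}

theorem conePoint_addGenerator (k₀ : Fin n → ℕ) (v : Fin n → Fin n → ℕ) (a : Fin n → ℕ)
    (i j : Fin n) :
    conePoint k₀ (addGenerator v i j) a = conePoint k₀ v (a + Pi.single i (a j)) := by
  have h : addGenerator v i j = v + Pi.single j (v i) := by
    funext p
    by_cases hp : p = j
    · subst hp; simp [addGenerator, add_comm]
    · simp [addGenerator, hp]
  funext p
  simp only [conePoint, h, Pi.add_apply, add_mul, mul_add, Finset.sum_add_distrib]
  congr 2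
  rw [Finset.sum_eq_single j, Finset.sum_eq_single i]
  · simp
  · intro b _ hb; simp [hb]
  · simp
  · intro b _ hb; simp [hb]
  · simp

theorem conePoint_add_generator (k₀ : Fin n → ℕ) (v : Fin n → Fin n → ℕ) (a : Fin n → ℕ)
    (j : Fin n) : conePoint (k₀ + v j) v a = conePoint k₀ v (a + Pi.single j 1) := by
  funext p
  simp only [conePoint, Pi.add_apply, add_mul, Finset.sum_add_distrib]
  rw [Finset.sum_eq_single (f := fun i => (Pi.single j 1 : Fin n → ℕ) i * v i p) j]
  · simp only [Pi.single_eq_same, one_mul]; ring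
  · intro b _ hb; simp [hb]
  · simp

theorem add_single_injective {i j : Fin n} (hij : i ≠ j) :
    Function.Injective fun a : Fin n → ℕ => a + Pi.single i (a j) := by
  intro a b hab
  have hj : a j = b j := by simpa [hij.symm] using congrFun hab j
  simp only [hj] at hab
  exact add_right_cancel hab

theorem conePoint_addGenerator_injective {k₀ : Fin n → ℕ} {v : Fin n → Fin n → ℕ}
    (h : Function.Injective (conePoint k₀ v)) {i j : Fin n} (hij : i ≠ j) :
    Function.Injective (conePoint k₀ (addGenerator v i j)) := by
  intro a b hab
  rw [conePoint_addGenerator, conePoint_addGenerator] at hab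
  exact add_single_injective hij (h hab)

theorem conePoint_add_generator_injective {k₀ : Fin n → ℕ} {v : Fin n → Fin n → ℕ}
    (h : Function.Injective (conePoint k₀ v)) (j : Fin n) :
    Function.Injective (conePoint (k₀ + v j) v) := by
  intro a b hab
  rw [conePoint_add_generator, conePoint_add_generator] at hab
  exact add_right_cancel (h hab)

theorem generator_ne_zero {k₀ : Fin n → ℕ} {v : Fin n → Fin n → ℕ}
    (h : Function.Injective (conePoint k₀ v)) (i : Fin n) : v i ≠ 0 := by
  intro hv
  have h1 := conePoint_add_generator k₀ v 0 i
  rw [hv, add_zero] at h1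
  have := congrFun (h h1) i
  simp at this

variable {K : Type*} [NontriviallyNormedField K] {ϖ : K}

/-- The halves are aⱼ ≤ aᵢ and aᵢ < aⱼ: the smaller coefficient becomes that of vᵢ + vⱼ. The shift
of the vertex by vⱼ accounts for the strict inequality and keeps the halves disjoint. -/
theorem conePiece_eq_union (k₀ : Fin n → ℕ) (v : Fin n → Fin n → ℕ) {i j : Fin n} (hij : i ≠ j) :
    conePiece ϖ k₀ v =
      conePiece ϖ k₀ (addGenerator v i j) ∪ conePiece ϖ (k₀ + v j) (addGenerator v j i) := by
  ext x
  constructor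
  · rintro ⟨a, ha⟩
    rcases le_or_gt (a j) (a i) with hle | hlt
    · refine Or.inl ⟨Function.update a i (a i - a j), fun p => ?_⟩
      rw [ha, conePoint_addGenerator]
      congr 2
      funext p
      by_cases hp : p = i
      · subst hp; simp [hij.symm, hle]
      · simp [hp]
    -- One copy of vⱼ has been moved into the vertex, hence the -1.
    · refine Or.inr ⟨Function.update a j (a j - a i - 1), fun p => ?_⟩
      rw [ha, conePoint_addGenerator]
      have := conePoint_add_generator k₀ v
        (Function.update a j (a j - a i - 1) + Pi.single j (a i)) j
      rw [Function.update_of_ne hij, this]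
      congr 2
      funext p
      by_cases hp : p = j
      · subst hp; simp; omega
      · simp [hp]
  · rintro (⟨a, ha⟩ | ⟨a, ha⟩)
    · exact ⟨_, fun p => by rw [ha, conePoint_addGenerator]⟩
    · exact ⟨_, fun p => by rw [ha, conePoint_addGenerator, conePoint_add_generator]⟩

variable [PadicField K]

theorem disjoint_conePiece (h : IsUniformizer ϖ) {k₀ : Fin n → ℕ} {v : Fin n → Fin n → ℕ}
    (hinj : Function.Injective (conePoint k₀ v)) {i j : Fin n} (hij : i ≠ j) :
    Disjoint (conePiece ϖ k₀ (addGenerator v i j))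
      (conePiece ϖ (k₀ + v j) (addGenerator v j i)) := by
  refine Set.disjoint_left.mpr ?_
  rintro x ⟨a, ha⟩ ⟨b, hb⟩
  have hab : conePoint k₀ (addGenerator v i j) a = conePoint (k₀ + v j) (addGenerator v j i) b :=
    funext fun p => pow_right_injective₀ h.norm_pos h.norm_lt_one.ne ((ha p).symm.trans (hb p))
  rw [conePoint_addGenerator, conePoint_addGenerator, conePoint_add_generator] at hab
  have h1 := hinj hab
  have hi := congrFun h1 i
  have hj := congrFun h1 j
  simp [hij, hij.symm] at hi hj
  omega

theorem measurableSet_conePiece [MeasurableSpace K] [BorelSpace K] (k₀ : Fin n → ℕ)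
    (v : Fin n → Fin n → ℕ) : MeasurableSet (conePiece ϖ k₀ v) := by
  have : conePiece ϖ k₀ v = ⋃ a, ⋂ j, {x | ‖x j‖ = ‖ϖ‖ ^ conePoint k₀ v a j} := by
    ext x
    simp [conePiece]
  rw [this]
  exact MeasurableSet.iUnion fun a => MeasurableSet.iInter fun j =>
    measurableSet_eq_fun (measurable_pi_apply j).norm measurable_const

/-- Existence of the Mellin continuation may be checked on the two halves of a cone. -/
theorem exists_mellin_of_subdivision {l : ℕ} [MeasurableSpace K] [BorelSpace K]
    (h : IsUniformizer ϖ) {k₀ : Fin n → ℕ} {v : Fin n → Fin n → ℕ}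
    (hinj : Function.Injective (conePoint k₀ v)) {i j : Fin n} (hij : i ≠ j) {β : ℝ}
    {U : Set (Fin n → K)} (hU : IsClopen U) {f : (Fin n → K) → Fin l → K} (hf : ContinuousOn f U)
    (h1 : ∃ W, MellinContinues β (((haarK K n).restrict
      (U ∩ conePiece ϖ k₀ (addGenerator v i j))).map fun x => maxAbs (f x)) W)
    (h2 : ∃ W, MellinContinues β (((haarK K n).restrict
      (U ∩ conePiece ϖ (k₀ + v j) (addGenerator v j i))).map fun x => maxAbs (f x)) W) :
    ∃ W, MellinContinues β
      (((haarK K n).restrict (U ∩ conePiece ϖ k₀ v)).map fun x => maxAbs (f x)) W := by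
  obtain ⟨W₁, hW₁⟩ := h1
  obtain ⟨W₂, hW₂⟩ := h2
  have hUm := hU.isOpen.measurableSet
  have hmeas (k₀ : Fin n → ℕ) (v : Fin n → Fin n → ℕ) : AEMeasurable (fun x => maxAbs (f x))
      ((haarK K n).restrict (U ∩ conePiece ϖ k₀ v)) :=
    measurable_maxAbs.comp_aemeasurable ((hf.mono inter_subset_left).aemeasurable
      (hUm.inter (measurableSet_conePiece k₀ v)))
  rw [conePiece_eq_union k₀ v hij, inter_union_distrib_left, Measure.restrict_union
    ((disjoint_conePiece h hinj hij).mono inter_subset_right inter_subset_right)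
    (hUm.inter (measurableSet_conePiece _ _)), AEMeasurable.map_add₀ (hmeas _ _) (hmeas _ _)]
  exact ⟨_, hW₁.add hW₂⟩

end ConeSubdivision

/-! ### No poles to the right of -1/t -/

section Admissible

variable {n : ℕ}

/-- The bounds on `β` which make `Re s > β` a domain of holomorphy for all contributions. -/
structure IsAdmissibleExponent (G : Set (Fin n →₀ ℕ)) (l : ℕ) (β : ℝ) : Prop where
  neg_codim_le : -(l : ℝ) ≤ β
  neg_dim_le : -(n : ℝ) ≤ β
  pos_of_weight : ∀ w : Fin n → ℕ, w ≠ 0 → ∀ c : ℕ, (∀ m ∈ G, c ≤ expDot m w) →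
    ∀ x : ℝ, β < x → 0 < (∑ j, w j : ℕ) + (c : ℝ) * x

/-- A weight w that is at least c on all exponents is at least c on the closure of Γ, so c ≤ t |w|.
For x < 0 this gives |w| + c x ≥ |w| (1 + t x), which is positive when x > -1/t. The bound by -n is
the case of the weight (1, …, 1), for which c = 1 is allowed because 0 is not an exponent. -/
theorem isAdmissibleExponent_neg_one_div {G : Set (Fin n →₀ ℕ)} (h0 : 0 ∉ G) {l : ℕ} (hl : 0 < l)
    (hn : 0 < n) {t : ℝ} (ht : (fun _ => t) ∈ closure (newtonPolyhedron G))
    (htl : 1 / (l : ℝ) ≤ t) : IsAdmissibleExponent G l (-1 / t) := by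
  have hl' : (0 : ℝ) < l := by exact_mod_cast hl
  have hn' : (0 : ℝ) < n := by exact_mod_cast hn
  have ht0 : 0 < t := (one_div_pos.mpr hl').trans_le htl
  have key (w : Fin n → ℕ) (c : ℕ) (hc : ∀ m ∈ G, c ≤ expDot m w) :
      (c : ℝ) ≤ t * (∑ j, w j : ℕ) := by
    refine (cast_le_dotProduct hc ht).trans_eq ?_
    rw [dotProduct, ← Finset.mul_sum, Nat.cast_sum]
  have htn : 1 ≤ t * n := by
    have := key 1 1 fun m hm => ?_
    · simpa using this
    · by_contra! hlt
      have hz : expDot m 1 = 0 := by omega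
      have : m = 0 := by
        ext j
        simpa using (Finset.sum_eq_zero_iff.mp hz) j (Finset.mem_univ j)
      exact h0 (this ▸ hm)
  refine ⟨?_, ?_, fun w hw c hc x hx => ?_⟩
  · rw [le_div_iff₀ ht0]
    have : 1 ≤ l * t := by rwa [div_le_iff₀' hl'] at htl
    linarith
  · rw [le_div_iff₀ ht0]
    linarith
  · have hpos : (0 : ℝ) < (∑ j, w j : ℕ) := by
      rw [Nat.cast_pos, Nat.pos_iff_ne_zero]
      intro h
      exact hw (funext fun j => (Finset.sum_eq_zero_iff.mp h) j (Finset.mem_univ j))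
    have hk := key w c hc
    rw [div_lt_iff₀ ht0] at hx
    rcases le_or_gt 0 x with hx0 | hx0
    · positivity
    · have := mul_le_mul_of_nonpos_right hk hx0.le
      nlinarith

end Admissible

/-! ### Continuation over cones for non-degenerate maps -/

section Pieces

variable {K : Type*} [NontriviallyNormedField K] [PadicField K] {n l : ℕ} {ϖ : K}

/-- `f` is the sum of the series `F` on the polydisc of radius `‖ϖ‖ ^ N`. -/
structure IsSeriesOn (f : (Fin n → K) → Fin l → K) (F : Fin l → MvPowerSeries (Fin n) K) (ϖ : K)
    (N : ℕ) : Prop where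
  tendsto : Tendsto (fun m : Fin n →₀ ℕ => ϖ ^ expDot m (fun _ => N) • coeffVec F m) cofinite (𝓝 0)
  eq_tsum : ∀ x, ‖x‖ ≤ ‖ϖ‖ ^ N → f x = ∑' m : Fin n →₀ ℕ, monomialValue m x • coeffVec F m

variable {f : (Fin n → K) → Fin l → K} {F : Fin l → MvPowerSeries (Fin n) K} {N : ℕ}
  {k₀ : Fin n → ℕ} {v : Fin n → Fin n → ℕ}

theorem IsSeriesOn.exists_isAnalyticFamily (hs : IsSeriesOn f F ϖ N) (h : IsUniformizer ϖ)
    (hk : ∀ j, N ≤ k₀ j) (v : Fin n → Fin n → ℕ) (M : Fin n → ℕ) :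
    ∃ C, IsAnalyticFamily (toricFamily F ϖ k₀ v M) C := by
  refine IgusaZeta.exists_isAnalyticFamily ?_ _ _
  refine squeeze_zero_norm (fun m => ?_) (tendsto_norm_zero.comp hs.tendsto)
  rw [Function.comp_apply, norm_smul, norm_smul, norm_pow, norm_pow]
  refine mul_le_mul_of_nonneg_right ?_ (norm_nonneg _)
  refine pow_le_pow_of_le_one h.norm_pos.le h.norm_lt_one.le ?_
  exact Finset.sum_le_sum fun j _ => Nat.mul_le_mul_left _ (hk j)

/-- For v = 0 and M = 0 the toric family is f itself, rescaled to the unit polydisc, and so f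
inherits its Lipschitz bound. -/
theorem IsSeriesOn.continuousOn (hs : IsSeriesOn f F ϖ N) (h : IsUniformizer ϖ) :
    ContinuousOn f (Metric.closedBall 0 (‖ϖ‖ ^ N)) := by
  obtain ⟨C, hC⟩ := hs.exists_isAnalyticFamily h (k₀ := fun _ => N) (fun _ => le_rfl) 0 0
  have hϖN : (ϖ ^ N) ≠ 0 := pow_ne_zero _ h.ne_zero
  have heq : EqOn f (fun x => toricFamily F ϖ (fun _ => N) 0 0 ((ϖ ^ N)⁻¹ • x) 0)
      (Metric.closedBall 0 (‖ϖ‖ ^ N)) := by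
    intro x hx
    rw [mem_closedBall_zero_iff] at hx
    have h1 := toricFamily_eq (ϖ := ϖ) (F := F) (k₀ := fun _ => N) (v := 0) (M := 0)
      (fun m _ i => Nat.zero_le _) ((ϖ ^ N)⁻¹ • x) 0
    have h2 : toricPoint ϖ (fun _ => N) 0 ((ϖ ^ N)⁻¹ • x) 0 = x := by
      funext j
      simp [toricPoint, mul_inv_cancel_left₀ hϖN]
    rw [h2, ← hs.eq_tsum x hx] at h1
    simpa [monomialValue] using h1.symm
  refine ContinuousOn.congr ?_ heq
  refine (hC.continuousOn (by simp)).comp (continuous_const_smul _).continuousOn fun x hx => ?_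
  rw [mem_closedBall_zero_iff] at hx ⊢
  rw [norm_smul, norm_inv, norm_pow, inv_mul_le_iff₀ (pow_pos h.norm_pos _), mul_one]
  exact hx

/-- The weight vector of the stratum of `θ`. -/
noncomputable def stratumWeight {n : ℕ} (v : Fin n → Fin n → ℕ) (θ : Fin n → K) : Fin n → ℕ := by
  classical exact ∑ i ∈ Finset.univ.filter fun i => θ i = 0, v i

theorem expDot_stratumWeight_le {K : Type*} [NontriviallyNormedField K]
    {v : Fin n → Fin n → ℕ} {m₀ m : Fin n →₀ ℕ}
    (h : ∀ i, expDot m₀ (v i) ≤ expDot m (v i)) (θ : Fin n → K) :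
    expDot m₀ (stratumWeight v θ) ≤ expDot m (stratumWeight v θ) := by
  rw [stratumWeight, expDot_sum, expDot_sum]
  exact Finset.sum_le_sum fun i _ => h i

theorem expDot_stratumWeight_eq_iff {K : Type*} [NontriviallyNormedField K]
    {v : Fin n → Fin n → ℕ} {m₀ m : Fin n →₀ ℕ}
    (h : ∀ i, expDot m₀ (v i) ≤ expDot m (v i)) (θ : Fin n → K) :
    expDot m (stratumWeight v θ) = expDot m₀ (stratumWeight v θ) ↔
      ∀ i, θ i = 0 → expDot m (v i) = expDot m₀ (v i) := by
  rw [stratumWeight, expDot_sum, expDot_sum, eq_comm,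
    Finset.sum_eq_sum_iff_of_le fun i _ => h i]
  simp only [Finset.mem_filter, Finset.mem_univ, true_and, eq_comm]

/-- If the toric point is the origin, each of its coordinates contains a vanishing θᵢ with positive
exponent. This positivity makes the face compact, so the rank condition at the origin is applicable.
-/
theorem stratumWeight_pos (h : IsUniformizer ϖ) {u θ : Fin n → K} (hu : u ∈ unitTorus K n)
    (h0 : toricPoint ϖ k₀ v u θ = 0) (j : Fin n) : 0 < stratumWeight v θ j := by
  have hu0 : u j ≠ 0 := norm_ne_zero_iff.mp (by rw [hu j]; exact one_ne_zero)
  have hj := congrFun h0 j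
  simp only [toricPoint, Pi.zero_apply, mul_eq_zero, pow_ne_zero _ h.ne_zero, hu0, false_or,
    Finset.prod_eq_zero_iff, Finset.mem_univ, true_and, pow_eq_zero_iff'] at hj
  obtain ⟨i, hi, hv⟩ := hj
  rw [stratumWeight, Finset.sum_apply]
  exact Finset.sum_pos' (fun _ _ => Nat.zero_le _) ⟨i, by simp [hi], Nat.pos_of_ne_zero hv⟩

theorem exists_hasStrictFDerivAt_of_rankCondition (h : IsUniformizer ϖ)
    (hinj : Function.Injective (conePoint k₀ v)) {m₀ : Fin n →₀ ℕ}
    (hmin : ∀ m ∈ unionSupport F, ∀ i, expDot m₀ (v i) ≤ expDot m (v i)) {u θ : Fin n → K}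
    (hfin : {m ∈ unionSupport F |
      expDot m (stratumWeight v θ) = expDot m₀ (stratumWeight v θ)}.Finite)
    (hrank : RankCondition F
      (weightFace (unionSupport F) (stratumWeight v θ) (expDot m₀ (stratumWeight v θ))))
    (hu : u ∈ unitTorus K n)
    (h0 : toricFamily F ϖ k₀ v (fun i => expDot m₀ (v i)) u θ = 0) :
    ∃ A : (Fin n → K) →L[K] (Fin l → K),
      HasStrictFDerivAt (fun u => toricFamily F ϖ k₀ v (fun i => expDot m₀ (v i)) u θ) A u ∧
      (Function.Surjective A ∨ Function.Injective A ∧ ∀ i, θ i ≠ 0) := by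
  refine exists_hasStrictFDerivAt_toricFamily h.ne_zero hmin (generator_ne_zero hinj)
    (S := hfin.toFinset) (fun m => ?_) (fun m hm => ?_) hrank
    (fun j => norm_ne_zero_iff.mp (by rw [hu j]; exact one_ne_zero)) h0
  · simp only [Finite.mem_toFinset, mem_ofPred_eq]
    exact and_congr_right fun hm => (realPoint_mem_weightFace hm).symm
  · rw [realPoint_mem_weightFace hm, expDot_stratumWeight_eq_iff (hmin m hm)]

/-- Near a common zero of the toric coordinates and the family, the family is submersive; the
remaining zeros are bounded away from the origin. -/
theorem IsSeriesOn.exists_forall_isSubmersiveAt (hs : IsSeriesOn f F ϖ N) (h : IsUniformizer ϖ)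
    (hk : ∀ j, N ≤ k₀ j) (hinj : Function.Injective (conePoint k₀ v)) (hn : 0 < n)
    (hnd : StronglyNondegenerateAtOrigin F) {m₀ : Fin n →₀ ℕ} (hm₀ : m₀ ∈ unionSupport F)
    (hmin : ∀ m ∈ unionSupport F, ∀ i, expDot m₀ (v i) ≤ expDot m (v i)) :
    ∃ N' ≥ N, ∀ θ ∈ powerVectors ϖ n, ∀ u ∈ unitTorus K n,
      ‖toricPoint ϖ k₀ v u θ‖ ≤ ‖ϖ‖ ^ N' →
      toricFamily F ϖ k₀ v (fun i => expDot m₀ (v i)) u θ = 0 →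
      IsSubmersiveAt (toricFamily F ϖ k₀ v fun i => expDot m₀ (v i)) u θ := by
  obtain ⟨C, hC⟩ := hs.exists_isAnalyticFamily h hk v fun i => expDot m₀ (v i)
  set g := toricFamily F ϖ k₀ v fun i => expDot m₀ (v i) with hg
  -- The bad set of zeros that are not submersive is compact, since submersivity is open. It
  -- contains no point over the origin, so its toric points have norms bounded below.
  set B : Set ((Fin n → K) × (Fin n → K)) :=
    {p ∈ unitTorus K n ×ˢ powerVectors ϖ n | g p.1 p.2 = 0 ∧ ¬ IsSubmersiveAt g p.1 p.2} with hB
  have hcont : ContinuousOn (fun p : (Fin n → K) × (Fin n → K) => g p.1 p.2)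
      (unitTorus K n ×ˢ powerVectors ϖ n) := by
    refine LipschitzOnWith.continuousOn (K := ⟨C, hC.nonneg⟩)
      (LipschitzOnWith.of_dist_le_mul fun p hp p' hp' => ?_)
    rw [dist_eq_norm, Prod.dist_eq, dist_eq_norm, dist_eq_norm]
    exact hC.norm_sub_le _ _ _ _ (norm_le_one_of_mem_unitTorus hp.1)
      (norm_le_one_of_mem_unitTorus hp'.1) (h.norm_le_one_of_mem_powerVectors hp.2)
      (h.norm_le_one_of_mem_powerVectors hp'.2)
  have hcompact : IsCompact (unitTorus K n ×ˢ powerVectors ϖ n) :=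
    isCompact_unitTorus.prod h.isCompact_powerVectors
  have hBc : IsCompact B := by
    have h1 : IsClosed ((unitTorus K n ×ˢ powerVectors ϖ n) ∩
        (fun p : (Fin n → K) × (Fin n → K) => g p.1 p.2) ⁻¹' {0}) :=
      hcont.preimage_isClosed_of_isClosed hcompact.isClosed isClosed_singleton
    have h2 : IsOpen {p : (Fin n → K) × (Fin n → K) | IsSubmersiveAt g p.1 p.2} := by
      refine Metric.isOpen_iff.mpr fun p hp => ?_
      obtain ⟨ε, hε, H⟩ := IsSubmersiveAt.exists_ball hp
      refine ⟨ε, hε, fun p' hp' => ?_⟩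
      rw [Metric.mem_ball, Prod.dist_eq, max_lt_iff] at hp'
      exact H _ hp'.1 _ hp'.2
    refine hcompact.of_isClosed_subset ?_ fun p hp => hp.1
    have : B = ((unitTorus K n ×ˢ powerVectors ϖ n) ∩
        (fun p : (Fin n → K) × (Fin n → K) => g p.1 p.2) ⁻¹' {0}) ∩
        {p : (Fin n → K) × (Fin n → K) | IsSubmersiveAt g p.1 p.2}ᶜ := by
      ext p
      simp only [hB, mem_ofPred_eq, mem_inter_iff, mem_preimage, mem_singleton_iff, mem_compl_iff]
      tauto
    rw [this]
    exact h1.inter h2.isClosed_compl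
  have hB0 : ∀ p ∈ B, toricPoint ϖ k₀ v p.1 p.2 ≠ 0 := by
    rintro ⟨u, θ⟩ ⟨⟨hu, hθ⟩, h0, hns⟩ hzero
    have hw := stratumWeight_pos h hu hzero
    have hc : ∀ m ∈ unionSupport F, expDot m₀ (stratumWeight v θ) ≤ expDot m (stratumWeight v θ) :=
      fun m hm => expDot_stratumWeight_le (hmin m hm) θ
    obtain ⟨A, hA, hsurj | ⟨-, hθ0⟩⟩ := exists_hasStrictFDerivAt_of_rankCondition h hinj hmin
      ((finite_setOf_expDot_eq hw _).subset fun m hm => hm.2)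
      (hnd _ (isFace_weightFace hc ⟨m₀, hm₀, rfl⟩) (isCompact_weightFace hw hc)) hu h0
    · exact hns (hC.isSubmersiveAt (norm_le_one_of_mem_unitTorus hu)
        (h.norm_le_one_of_mem_powerVectors hθ) hA hsurj)
    -- The injective alternative requires every θᵢ ≠ 0, and then the toric point is not the origin.
    · refine toricPoint_ne_zero (k₀ := k₀) (v := v) h.ne_zero (fun j => ?_) hθ0 ⟨0, hn⟩
        (congrFun hzero _)
      exact norm_ne_zero_iff.mp (by rw [hu j]; exact one_ne_zero)
  have hex : ∃ N' ≥ N, ∀ p ∈ B, ‖ϖ‖ ^ N' < ‖toricPoint ϖ k₀ v p.1 p.2‖ := by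
    rcases B.eq_empty_or_nonempty with hemp | hne
    · exact ⟨N, le_rfl, by simp [hemp]⟩
    · obtain ⟨p, hp, hle⟩ := hBc.exists_isMinOn hne
        (continuous_toricPoint ϖ k₀ v).norm.continuousOn
      obtain ⟨N', hN'⟩ := exists_pow_lt_of_lt_one (norm_pos_iff.mpr (hB0 p hp)) h.norm_lt_one
      refine ⟨max N N', le_max_left _ _, fun p' hp' => ?_⟩
      exact ((pow_le_pow_of_le_one h.norm_pos.le h.norm_lt_one.le (le_max_right _ _)).trans_lt
        hN').trans_le (hle hp')
  obtain ⟨N', hNN', H⟩ := hex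
  refine ⟨N', hNN', fun θ hθ u hu hnorm h0 => ?_⟩
  by_contra hns
  exact (H (u, θ) ⟨⟨hu, hθ⟩, h0, hns⟩).not_ge hnorm

variable [MeasurableSpace K] [BorelSpace K]

/-- Each point of the torus falls under one of three cases of tameness: g ≠ 0, a submersive zero, or
a zero with injective derivative over an isolated θ. -/
theorem IsSeriesOn.exists_mellin_conePiece (hs : IsSeriesOn f F ϖ N) (h : IsUniformizer ϖ)
    (hk : ∀ j, N ≤ k₀ j) (hinj : Function.Injective (conePoint k₀ v)) (hl : 0 < l) (hn : 0 < n)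
    {m₀ : Fin n →₀ ℕ} (hmin : ∀ m ∈ unionSupport F, ∀ i, expDot m₀ (v i) ≤ expDot m (v i))
    {β : ℝ} (hβ : IsAdmissibleExponent (unionSupport F) l β) {U : Set (Fin n → K)}
    (hU : IsClopen U) (hUN : U ⊆ Metric.closedBall 0 (‖ϖ‖ ^ N))
    (hgood : ∀ θ ∈ powerVectors ϖ n, ∀ u ∈ unitTorus K n, toricPoint ϖ k₀ v u θ ∈ U →
      toricFamily F ϖ k₀ v (fun i => expDot m₀ (v i)) u θ = 0 →
      IsSubmersiveAt (toricFamily F ϖ k₀ v fun i => expDot m₀ (v i)) u θ ∨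
      ∃ A : (Fin n → K) →L[K] (Fin l → K),
        HasStrictFDerivAt (fun u => toricFamily F ϖ k₀ v (fun i => expDot m₀ (v i)) u θ) A u ∧
        Function.Injective A ∧ ∀ i, θ i ≠ 0) :
    ∃ W, MellinContinues β
      (((haarK K n).restrict (U ∩ conePiece ϖ k₀ v)).map fun x => maxAbs (f x)) W := by
  obtain ⟨C, hC⟩ := hs.exists_isAnalyticFamily h hk v fun i => expDot m₀ (v i)
  have hT : ∀ θ ∈ powerVectors ϖ n, ‖θ‖ ≤ 1 := fun θ hθ => h.norm_le_one_of_mem_powerVectors hθ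
  refine IgusaZeta.exists_mellin_conePiece h k₀ v hinj (fun i => expDot m₀ (v i))
    (fun i => hβ.pos_of_weight (v i) (generator_ne_zero hinj i) _ fun m hm => hmin m hm i) hC hU
    ((hs.continuousOn h).mono hUN) (fun a u _ hau => ?_) fun θ hθ u hu hmem => ?_
  · have h1 := toricFamily_eq (ϖ := ϖ) (k₀ := k₀) hmin u fun i => ϖ ^ a i
    have hnorm := hUN hau
    rw [mem_closedBall_zero_iff] at hnorm
    rw [toricPoint_pow, ← hs.eq_tsum _ hnorm] at h1
    rw [← h1, monomialValue, ← Finset.prod_pow_eq_pow_sum]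
    simp only [pow_mul]
  · have hu1 := norm_le_one_of_mem_unitTorus hu
    by_cases h0 : toricFamily F ϖ k₀ v (fun i => expDot m₀ (v i)) u θ = 0
    · rcases hgood θ hθ u hu hmem h0 with hsub | ⟨A, hA, hAinj, hθ0⟩
      · exact hC.isTameAt_of_isSubmersiveAt hT hu1 hθ h0 hsub hl hβ.neg_codim_le
      · exact isTameAt_of_injective h0 hA hAinj (h.exists_isolated hθ0 hθ) hn hβ.neg_dim_le
    · exact hC.isTameAt_of_ne_zero hT hu1 hθ h0

/-- Mellin transforms over a cone piece continue, for all admissible exponents and all small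
domains. -/
def HasMellinOnPieces (f : (Fin n → K) → Fin l → K) (F : Fin l → MvPowerSeries (Fin n) K) (ϖ : K)
    (N : ℕ) (k₀ : Fin n → ℕ) (v : Fin n → Fin n → ℕ) : Prop :=
  ∀ U : Set (Fin n → K), IsClopen U → U ⊆ Metric.closedBall 0 (‖ϖ‖ ^ N) → ∀ β,
    IsAdmissibleExponent (unionSupport F) l β → ∃ W, MellinContinues β
      (((haarK K n).restrict (U ∩ conePiece ϖ k₀ v)).map fun x => maxAbs (f x)) W

theorem HasMellinOnPieces.mono {N' : ℕ} (H : HasMellinOnPieces f F ϖ N k₀ v)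
    (h : IsUniformizer ϖ) (hN : N ≤ N') : HasMellinOnPieces f F ϖ N' k₀ v :=
  fun U hU hUN => H U hU (hUN.trans (Metric.closedBall_subset_closedBall
    (pow_le_pow_of_le_one h.norm_pos.le h.norm_lt_one.le hN)))

theorem IsSeriesOn.hasMellinOnPieces_of_subdivision {N' : ℕ} (hs : IsSeriesOn f F ϖ N)
    (h : IsUniformizer ϖ) (hN : N ≤ N') (hinj : Function.Injective (conePoint k₀ v)) {i j : Fin n}
    (hij : i ≠ j) (h1 : HasMellinOnPieces f F ϖ N' k₀ (addGenerator v i j))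
    (h2 : HasMellinOnPieces f F ϖ N' (k₀ + v j) (addGenerator v j i)) :
    HasMellinOnPieces f F ϖ N' k₀ v :=
  fun U hU hUN β hβ => exists_mellin_of_subdivision h hinj hij hU
    ((hs.continuousOn h).mono (hUN.trans (Metric.closedBall_subset_closedBall
      (pow_le_pow_of_le_one h.norm_pos.le h.norm_lt_one.le hN))))
    (h1 U hU hUN β hβ) (h2 U hU hUN β hβ)

/-- Polynomial maps satisfying the rank condition on all faces. -/
theorem IsSeriesOn.hasMellinOnPieces_of_finite (hs : IsSeriesOn f F ϖ N) (h : IsUniformizer ϖ)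
    (hfin : (unionSupport F).Finite) (hne : (unionSupport F).Nonempty)
    (hnd : StronglyNondegenerate F) (hl : 0 < l) (hn : 0 < n) :
    ∀ k₀ v, (∀ j, N ≤ k₀ j) → Function.Injective (conePoint k₀ v) →
      HasMellinOnPieces f F ϖ N k₀ v := by
  obtain ⟨Ls, hLs⟩ := exists_forms_minimizer hne
  refine IsSubdivisible.of_isDefinite (fun k₀ v i j hij h1 h2 hk hinj => ?_) Ls
    fun k₀ v hv hk hinj U hU hUN β hβ => ?_
  · exact hs.hasMellinOnPieces_of_subdivision h le_rfl hinj hij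
      (h1 hk (conePoint_addGenerator_injective hinj hij))
      (h2 (fun p => (hk p).trans (Nat.le_add_right _ _)) (conePoint_addGenerator_injective
        (conePoint_add_generator_injective hinj j) hij.symm))
  · obtain ⟨m₀, hm₀, hmin⟩ := hLs v hv
    refine hs.exists_mellin_conePiece h hk hinj hl hn hmin hβ hU hUN fun θ hθ u hu _ h0 => ?_
    obtain ⟨C, hC⟩ := hs.exists_isAnalyticFamily h hk v fun i => expDot m₀ (v i)
    obtain ⟨A, hA, hsurj | hA'⟩ := exists_hasStrictFDerivAt_of_rankCondition h hinj hmin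
      (hfin.subset fun m hm => hm.1) (hnd _ (isFace_weightFace
        (fun m hm => expDot_stratumWeight_le (hmin m hm) θ) ⟨m₀, hm₀, rfl⟩)) hu h0
    · exact Or.inl (hC.isSubmersiveAt (norm_le_one_of_mem_unitTorus hu)
        (h.norm_le_one_of_mem_powerVectors hθ) hA hsurj)
    · exact Or.inr ⟨A, hA, hA'⟩

/-- Analytic maps satisfying the rank condition on the compact faces. -/
theorem IsSeriesOn.exists_hasMellinOnPieces (hs : IsSeriesOn f F ϖ N) (h : IsUniformizer ϖ)
    (hne : (unionSupport F).Nonempty)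
    (hnd : StronglyNondegenerateAtOrigin F) (hl : 0 < l) (hn : 0 < n) :
    ∀ k₀ v, (∀ j, N ≤ k₀ j) → Function.Injective (conePoint k₀ v) →
      ∃ N' ≥ N, HasMellinOnPieces f F ϖ N' k₀ v := by
  obtain ⟨Ls, hLs⟩ := exists_forms_minimizer hne
  refine IsSubdivisible.of_isDefinite (fun k₀ v i j hij h1 h2 hk hinj => ?_) Ls
    fun k₀ v hv hk hinj => ?_
  · obtain ⟨N₁, hN₁, H₁⟩ := h1 hk (conePoint_addGenerator_injective hinj hij)
    obtain ⟨N₂, hN₂, H₂⟩ := h2 (fun p => (hk p).trans (Nat.le_add_right _ _))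
      (conePoint_addGenerator_injective (conePoint_add_generator_injective hinj j) hij.symm)
    exact ⟨max N₁ N₂, hN₁.trans (le_max_left _ _), hs.hasMellinOnPieces_of_subdivision h
      (hN₁.trans (le_max_left _ _)) hinj hij (H₁.mono h (le_max_left _ _))
      (H₂.mono h (le_max_right _ _))⟩
  · obtain ⟨m₀, hm₀, hmin⟩ := hLs v hv
    obtain ⟨N', hN', H⟩ := hs.exists_forall_isSubmersiveAt h hk hinj hn hnd hm₀ hmin
    refine ⟨N', hN', fun U hU hUN β hβ => ?_⟩
    refine hs.exists_mellin_conePiece h hk hinj hl hn hmin hβ hU (hUN.trans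
      (Metric.closedBall_subset_closedBall
        (pow_le_pow_of_le_one h.norm_pos.le h.norm_lt_one.le hN'))) fun θ hθ u hu hmem h0 => ?_
    have := hUN hmem
    rw [mem_closedBall_zero_iff] at this
    exact Or.inl (H θ hθ u hu this h0)

end Pieces

/-! ### A small domain as a single cone piece -/

section Global

variable {K : Type*} [NontriviallyNormedField K] [PadicField K] {n l : ℕ} {ϖ : K}
  {f : (Fin n → K) → Fin l → K} {F : Fin l → MvPowerSeries (Fin n) K} {N : ℕ}

theorem conePoint_const_single (N : ℕ) (a : Fin n → ℕ) :
    conePoint (fun _ => N) (fun i => Pi.single i 1) a = fun j => N + a j := by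
  funext j
  simp [conePoint, Pi.single_apply]

theorem mem_conePiece_const_iff (h : IsUniformizer ϖ) {x : Fin n → K} (hx : ‖x‖ ≤ ‖ϖ‖ ^ N)
    (h0 : ∀ j, x j ≠ 0) : x ∈ conePiece ϖ (fun _ => N) (fun i => Pi.single i 1) := by
  have hex (j : Fin n) : ∃ a : ℕ, ‖x j‖ = ‖ϖ‖ ^ (N + a) := by
    obtain ⟨k, hk⟩ := h.exists_norm_eq (x j) (h0 j)
    have hle : ‖ϖ‖ ^ k ≤ ‖ϖ‖ ^ (N : ℤ) := by
      rw [← hk, zpow_natCast]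
      exact (norm_le_pi_norm x j).trans hx
    have hk' : (N : ℤ) ≤ k := (zpow_le_zpow_iff_right_of_lt_one₀ h.norm_pos h.norm_lt_one).mp hle
    refine ⟨(k - N).toNat, ?_⟩
    rw [hk, ← zpow_natCast]
    congr 1
    push_cast
    omega
  choose a ha using hex
  exact ⟨a, fun j => by rw [conePoint_const_single, ha]⟩

variable [MeasurableSpace K] [BorelSpace K]

/-- The set is unchanged by multiplying xⱼ by ϖ, while this map changes Haar measure by the factor q
> 1. A finite measure with this invariance is 0. -/
theorem haarK_hyperplane_inter_integerBox (h : IsUniformizer ϖ) (j : Fin n) :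
    haarK K n ((integerBox K n : Set (Fin n → K)) ∩ {x | x j = 0}) = 0 := by
  set E := (integerBox K n : Set (Fin n → K)) ∩ {x | x j = 0} with hE
  have hEm : MeasurableSet E := ((integerBox K n).isCompact.isClosed.inter
    (isClosed_eq (continuous_apply j) continuous_const)).measurableSet
  have hpre : monomialScale ϖ (Pi.single j 1) ⁻¹' E = E := by
    ext x
    have hval (i : Fin n) :
        monomialScale ϖ (Pi.single j 1) x i = if i = j then ϖ * x i else x i := by
      by_cases hi : i = j
      · subst hi; simp [monomialScale]
      · simp [monomialScale, hi]
    simp only [hE, mem_preimage, mem_inter_iff, mem_integerBox_iff, mem_ofPred_eq, hval, if_true,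
      mul_eq_zero, h.ne_zero, false_or]
    refine and_congr_left fun hxj => forall_congr' fun i => ?_
    by_cases hi : i = j
    · subst hi; simp [hxj]
    · simp [hi]
  have h1 := congrArg (fun ν => ν E) (h.map_monomialScale (Pi.single j 1 : Fin n → ℕ))
  simp only [Measure.map_apply (continuous_monomialScale ϖ _).measurable hEm, hpre,
    Measure.smul_apply, smul_eq_mul, Finset.sum_pi_single', Finset.mem_univ, if_true, pow_one] at h1
  have hfin : haarK K n E ≠ ∞ := ne_top_of_le_ne_top
    (by rw [haarK_integerBox]; exact ENNReal.one_ne_top) (measure_mono inter_subset_left)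
  by_contra hne
  have h2 : (1 : ℝ≥0∞) = residueCard K := by
    refine (ENNReal.mul_left_inj hne hfin).mp ?_
    rw [one_mul]
    exact h1
  have h3 := one_lt_residueCard K
  have h4 : (residueCard K : ℝ≥0∞) = (1 : ℕ) := by rw [← h2, Nat.cast_one]
  rw [Nat.cast_inj] at h4
  simp [h4] at h3

/-- Up to a null set a small domain is a single cone piece. -/
theorem restrict_inter_conePiece_const (h : IsUniformizer ϖ) {U : Set (Fin n → K)}
    (hUN : U ⊆ Metric.closedBall 0 (‖ϖ‖ ^ N)) :
    (haarK K n).restrict (U ∩ conePiece ϖ (fun _ => N) (fun i => Pi.single i 1)) =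
      (haarK K n).restrict U := by
  refine Measure.restrict_congr_set (ae_eq_set.mpr ⟨?_, ?_⟩)
  · rw [sdiff_eq_empty.mpr inter_subset_left, measure_empty]
  · refine measure_mono_null (t := ⋃ j, (integerBox K n : Set (Fin n → K)) ∩ {x | x j = 0}) ?_
      (measure_iUnion_null fun j => haarK_hyperplane_inter_integerBox h j)
    rintro x ⟨hxU, hx⟩
    have hxN := hUN hxU
    rw [mem_closedBall_zero_iff] at hxN
    by_contra hne
    refine hx ⟨hxU, mem_conePiece_const_iff h hxN fun j hj => hne (mem_iUnion.mpr ⟨j, ?_, hj⟩)⟩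
    rw [integerBox_eq_closedBall, mem_closedBall_zero_iff]
    exact hxN.trans (pow_le_one₀ h.norm_pos.le h.norm_lt_one.le)

end Global

/-! ### The pole at -1/t -/

section LowerBound

theorem sum_mul_measureReal_le_setIntegral {α ι : Type*} [MeasurableSpace α] {μ : Measure α}
    {U : Set α} {G : α → ℝ} (hG : IntegrableOn G U μ) (hG0 : 0 ≤ᵐ[μ.restrict U] G) (t : Finset ι)
    {S : ι → Set α} (hS : ∀ i, MeasurableSet (S i)) (hd : Pairwise (Function.onFun Disjoint S))
    (hSU : ∀ i, S i ⊆ U) (hfin : ∀ i, μ (S i) ≠ ∞) (a : ι → ℝ)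
    (ha : ∀ i, ∀ᵐ x ∂μ.restrict (S i), a i ≤ G x) :
    ∑ i ∈ t, a i * μ.real (S i) ≤ ∫ x in U, G x ∂μ := by
  calc ∑ i ∈ t, a i * μ.real (S i) ≤ ∑ i ∈ t, ∫ x in S i, G x ∂μ := by
        refine Finset.sum_le_sum fun i _ => ?_
        have := setIntegral_mono_ae_restrict (μ := μ) (s := S i) (f := fun _ => a i) (g := G)
          (integrableOn_const (hfin i)) (hG.mono_set (hSU i)) (ha i)
        rwa [setIntegral_const, smul_eq_mul, mul_comm] at this
    _ = ∫ x in ⋃ i ∈ t, S i, G x ∂μ :=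
        (integral_biUnion_finset t (fun i _ => hS i) (fun i _ j _ hij => hd hij)
          fun i _ => hG.mono_set (hSU i)).symm
    _ ≤ ∫ x in U, G x ∂μ := setIntegral_mono_set hG hG0
        (iUnion₂_subset fun i _ => hSU i).eventuallyLE

variable {K : Type*} [NontriviallyNormedField K] [PadicField K] {n l : ℕ} {ϖ : K}
  {f : (Fin n → K) → Fin l → K} {F : Fin l → MvPowerSeries (Fin n) K} {N : ℕ}

/-- A weight vector bounds the map on the shells of points with prescribed orders. -/
theorem IsSeriesOn.exists_norm_le_shell (hs : IsSeriesOn f F ϖ N) (h : IsUniformizer ϖ) :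
    ∃ C > 0, ∀ N₁ ≥ N, ∀ (k : Fin n → ℕ) (d : ℝ), (∀ m ∈ unionSupport F, d ≤ expDot m k) →
      ∀ x : Fin n → K, (∀ j, ‖x j‖ = ‖ϖ‖ ^ (N₁ + k j)) → ‖f x‖ ≤ C * ‖ϖ‖ ^ d := by
  obtain ⟨C, hC0, hC⟩ := exists_norm_le_of_tendsto hs.tendsto
  refine ⟨C + 1, by positivity, fun N₁ hN₁ k d hd x hx => ?_⟩
  have hxN : ‖x‖ ≤ ‖ϖ‖ ^ N := by
    refine (pi_norm_le_iff_of_nonneg (pow_nonneg h.norm_pos.le _)).mpr fun j => ?_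
    rw [hx]
    exact pow_le_pow_of_le_one h.norm_pos.le h.norm_lt_one.le (by omega)
  have hd0 : 0 < ‖ϖ‖ ^ d := Real.rpow_pos_of_pos h.norm_pos _
  rw [hs.eq_tsum x hxN]
  refine IsUltrametricDist.norm_tsum_le_of_forall_le_of_nonneg (by positivity) fun m => ?_
  by_cases hm : m ∈ unionSupport F
  · have hmon : ‖monomialValue m x‖ = ‖ϖ‖ ^ expDot m (fun _ => N₁) * ‖ϖ‖ ^ expDot m k := by
      simp only [monomialValue, norm_prod, norm_pow, hx, expDot, ← Finset.prod_pow_eq_pow_sum,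
        ← Finset.prod_mul_distrib, ← pow_mul, ← pow_add]
      exact Finset.prod_congr rfl fun j _ => by ring
    have h1 : ‖ϖ‖ ^ expDot m k ≤ ‖ϖ‖ ^ d := by
      rw [← Real.rpow_natCast]
      exact Real.rpow_le_rpow_of_exponent_ge h.norm_pos h.norm_lt_one.le (hd m hm)
    have h2 : ‖ϖ‖ ^ expDot m (fun _ => N₁) ≤ ‖ϖ‖ ^ expDot m (fun _ => N) :=
      pow_le_pow_of_le_one h.norm_pos.le h.norm_lt_one.le
        (Finset.sum_le_sum fun j _ => Nat.mul_le_mul_left _ hN₁)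
    have h3 := hC m
    rw [norm_smul, norm_pow] at h3
    calc ‖monomialValue m x • coeffVec F m‖
        = (‖ϖ‖ ^ expDot m (fun _ => N₁) * ‖coeffVec F m‖) * ‖ϖ‖ ^ expDot m k := by
          rw [norm_smul, hmon]; ring
      _ ≤ (C + 1) * ‖ϖ‖ ^ d := by
          refine mul_le_mul ?_ h1 (by positivity) (by positivity)
          exact (mul_le_mul_of_nonneg_right h2 (norm_nonneg _)).trans (h3.trans (by linarith))
  · rw [mem_unionSupport_iff, not_not] at hm
    rw [hm, smul_zero, norm_zero]
    positivity

/-- The approximations `⌈i κ⌉` of the multiples of a weight vector. -/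
theorem le_expDot_ceil {G : Set (Fin n →₀ ℕ)} {κ : Fin n → ℝ} (hκ : ∀ j, 0 ≤ κ j) {t : ℝ}
    (ht : 0 ≤ t) (hsupp : ∀ m ∈ G, t * ∑ j, κ j ≤ ∑ j, m j * κ j) (i : ℕ) {m : Fin n →₀ ℕ}
    (hm : m ∈ G) :
    t * ((∑ j, ⌈i * κ j⌉₊ : ℕ) - n : ℝ) ≤ expDot m fun j => ⌈i * κ j⌉₊ := by
  -- Rounding the n coordinates of i κ up to integers raises their sum by at most n.
  have h1 : ((∑ j, ⌈i * κ j⌉₊ : ℕ) - n : ℝ) ≤ i * ∑ j, κ j := by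
    have : ((∑ j, ⌈i * κ j⌉₊ : ℕ) : ℝ) ≤ ∑ j, (i * κ j + 1) := by
      push_cast
      exact Finset.sum_le_sum fun j _ =>
        (Nat.ceil_lt_add_one (mul_nonneg (Nat.cast_nonneg i) (hκ j))).le
    rw [Finset.sum_add_distrib, ← Finset.mul_sum] at this
    simp at this
    push_cast
    linarith
  calc t * ((∑ j, ⌈i * κ j⌉₊ : ℕ) - n : ℝ) ≤ i * (t * ∑ j, κ j) := by
        nlinarith [mul_le_mul_of_nonneg_left h1 ht]
    _ ≤ i * ∑ j, m j * κ j := mul_le_mul_of_nonneg_left (hsupp m hm) (Nat.cast_nonneg i)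
    _ ≤ expDot m fun j => ⌈i * κ j⌉₊ := by
        rw [expDot, Nat.cast_sum, Finset.mul_sum]
        refine Finset.sum_le_sum fun j _ => ?_
        rw [Nat.cast_mul, mul_left_comm]
        exact mul_le_mul_of_nonneg_left (Nat.le_ceil _) (Nat.cast_nonneg _)

variable [MeasurableSpace K] [BorelSpace K]

theorem haarK_unitTorus_pos : 0 < haarK K n (unitTorus K n) := by
  refine lt_of_lt_of_le (Metric.measure_ball_pos (haarK K n) (fun _ => 1) one_pos)
    (measure_mono (ball_subset_unitTorus (fun j => ?_) le_rfl))
  simp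

theorem haarK_real_unitTorus_pos : 0 < (haarK K n).real (unitTorus K n) :=
  ENNReal.toReal_pos haarK_unitTorus_pos.ne' isCompact_unitTorus.measure_lt_top.ne

theorem haarK_real_shell (h : IsUniformizer ϖ) (k : Fin n → ℕ) :
    (haarK K n).real {x | ∀ j, ‖x j‖ = ‖ϖ‖ ^ k j} =
      ((residueCard K : ℝ)⁻¹) ^ (∑ j, k j) * (haarK K n).real (unitTorus K n) := by
  have := congrArg (fun ν => ν.real univ) (h.restrict_image_monomialScale k (unitTorus K n))
  simp only [measureReal_def, Measure.restrict_apply_univ, Measure.smul_apply, smul_eq_mul,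
    Measure.map_apply (continuous_monomialScale ϖ k).measurable MeasurableSet.univ,
    preimage_univ, ENNReal.toReal_mul, ENNReal.toReal_pow, ENNReal.toReal_inv,
    ENNReal.toReal_natCast, image_monomialScale_unitTorus h] at this
  exact this

/-- The shells along a supporting weight force a pole at `-1 / t`. -/
theorem MellinContinues.unbounded_of_supporting_weight (hs : IsSeriesOn f F ϖ N)
    (h : IsUniformizer ϖ) {t : ℝ} (ht : 0 < t) {κ : Fin n → ℝ} (hκ : ∀ j, 0 ≤ κ j)
    (hκ0 : ∃ j, 0 < κ j) (hsupp : ∀ m ∈ unionSupport F, t * ∑ j, κ j ≤ ∑ j, m j * κ j)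
    {U : Set (Fin n → K)} (hU : IsClopen U) (hUN : U ⊆ Metric.closedBall 0 (‖ϖ‖ ^ N))
    (hU0 : 0 ∈ U) {W : ℂ → ℂ}
    (hW : MellinContinues (-1 / t) (((haarK K n).restrict U).map fun x => maxAbs (f x)) W) :
    ∀ C : ℝ, ∀ᶠ x : ℝ in 𝓝[>] (-1 / t), C ≤ ‖W x‖ := by
  intro B
  obtain ⟨p, hp⟩ := hκ0
  -- normalization of the weight
  obtain ⟨κ, hκ, hκp, hsupp⟩ : ∃ κ' : Fin n → ℝ, (∀ j, 0 ≤ κ' j) ∧ κ' p = 1 ∧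
      ∀ m ∈ unionSupport F, t * ∑ j, κ' j ≤ ∑ j, m j * κ' j := by
    refine ⟨fun j => κ j / κ p, fun j => div_nonneg (hκ j) hp.le, div_self hp.ne', fun m hm => ?_⟩
    simp only [← mul_div_assoc, ← Finset.sum_div]
    exact div_le_div_of_nonneg_right (hsupp m hm) hp.le
  have hfm : AEMeasurable (fun x => maxAbs (f x)) ((haarK K n).restrict U) :=
    measurable_maxAbs.comp_aemeasurable
      (((hs.continuousOn h).mono hUN).aemeasurable hU.isOpen.measurableSet)
  obtain ⟨N₁, hN₁, hball⟩ : ∃ N₁ ≥ N, Metric.closedBall (0 : Fin n → K) (‖ϖ‖ ^ N₁) ⊆ U := by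
    obtain ⟨ε, hε, hεU⟩ := Metric.isOpen_iff.mp hU.isOpen 0 hU0
    obtain ⟨k, hk⟩ := exists_pow_lt_of_lt_one hε h.norm_lt_one
    refine ⟨max N k, le_max_left _ _, (Metric.closedBall_subset_ball ?_).trans hεU⟩
    exact (pow_le_pow_of_le_one h.norm_pos.le h.norm_lt_one.le (le_max_right _ _)).trans_lt hk
  obtain ⟨C, hC, hbound⟩ := hs.exists_norm_le_shell h
  obtain ⟨c, hc, hcq, hmax⟩ := h.exists_maxAbs_eq_rpow
  set Q : ℝ := (residueCard K : ℝ) with hQ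
  have hQ1 : 1 < Q := one_lt_residueCard_real K
  have hQ0 : 0 < Q := by linarith
  set k : ℕ → Fin n → ℕ := fun i j => ⌈i * κ j⌉₊ with hk
  set e : ℕ → ℕ := fun i => ∑ j, k i j with he
  set S : ℕ → Set (Fin n → K) := fun i => {x | ∀ j, ‖x j‖ = ‖ϖ‖ ^ (N₁ + k i j)} with hS
  -- This is the bound on the shell in the normalized absolute value; the exponent c converts the
  -- norm, and the -n is the loss from rounding.
  set y : ℕ → ℝ := fun i => C ^ c * Q ^ (-(t * (e i - n))) with hy
  have hy0 (i : ℕ) : 0 < y i := mul_pos (Real.rpow_pos_of_pos hC _) (Real.rpow_pos_of_pos hQ0 _)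
  have hle (i : ℕ) (x : Fin n → K) (hx : x ∈ S i) : maxAbs (f x) ≤ y i := by
    have h1 := hbound N₁ hN₁ (k i) _ (fun m hm => le_expDot_ceil hκ ht.le hsupp i hm) x hx
    rw [hmax]
    refine (Real.rpow_le_rpow (norm_nonneg _) h1 hc.le).trans_eq ?_
    rw [Real.mul_rpow hC.le (Real.rpow_nonneg h.norm_pos.le _), ← Real.rpow_mul h.norm_pos.le,
      mul_comm _ c, Real.rpow_mul h.norm_pos.le, hcq, Real.inv_rpow hQ0.le, ← Real.rpow_neg hQ0.le]
  have hSU (i : ℕ) : S i ⊆ U := fun x hx => hball (by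
    rw [mem_closedBall_zero_iff, pi_norm_le_iff_of_nonneg (pow_nonneg h.norm_pos.le _)]
    intro j
    rw [hx j]
    exact pow_le_pow_of_le_one h.norm_pos.le h.norm_lt_one.le (Nat.le_add_right _ _))
  -- The normalization κ p = 1 makes the order of the p-th coordinate N₁ + i, so the shells are
  -- disjoint.
  have hSd : Pairwise (Function.onFun Disjoint S) := by
    intro i i' hne
    refine Set.disjoint_left.mpr fun x hx hx' => hne ?_
    have := pow_right_injective₀ h.norm_pos h.norm_lt_one.ne ((hx p).symm.trans (hx' p))
    simpa [hk, hκp] using this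
  have hSm (i : ℕ) : MeasurableSet (S i) := by
    simp only [hS, ofPred_forall]
    exact MeasurableSet.iInter fun j =>
      measurableSet_eq_fun (measurable_pi_apply j).norm measurable_const
  have hUfin : haarK K n U ≠ ∞ := by
    refine ne_top_of_le_ne_top ?_ (measure_mono hUN)
    exact (isCompact_closedBall (0 : Fin n → K) _).measure_lt_top.ne
  set T := (haarK K n).real (unitTorus K n) with hT
  have hT0 : 0 < T := haarK_real_unitTorus_pos
  have hSr (i : ℕ) : (haarK K n).real (S i) = Q⁻¹ ^ (n * N₁ + e i) * T := by
    rw [hS, haarK_real_shell h, Finset.sum_add_distrib]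
    simp [he, hQ, hT]
  -- the lower bound for the integral
  have hlow (J : ℕ) (s : ℝ) (hs1 : -1 / t < s) (hs0 : s < 0) :
      ∑ i ∈ Finset.range J, y i ^ s * (haarK K n).real (S i) ≤ ‖W s‖ := by
    have hint := hW.integrable s (by simpa using hs1)
    have heq := hW.integral_eq s (by simpa using hs1)
    have hpos := ae_of_ae_map hfm hW.pos
    have hcpow : Measurable fun x : ℝ => ((x : ℂ)) ^ (s : ℂ) := by fun_prop
    rw [integral_map hfm hcpow.aestronglyMeasurable] at heq
    rw [integrable_map_measure hcpow.aestronglyMeasurable hfm] at hint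
    have hre : ∀ᵐ x ∂(haarK K n).restrict U,
        ((maxAbs (f x) : ℝ) : ℂ) ^ (s : ℂ) = ((maxAbs (f x) ^ s : ℝ) : ℂ) := by
      filter_upwards [hpos] with x hx
      rw [Complex.ofReal_cpow hx.le]
    rw [integral_congr_ae hre, integral_complex_ofReal] at heq
    have hint' : Integrable (fun x => maxAbs (f x) ^ s) ((haarK K n).restrict U) := by
      have := (hint.congr hre).re
      simpa using this
    rw [← heq, Complex.norm_real]
    refine le_trans ?_ (Real.le_norm_self _)
    refine sum_mul_measureReal_le_setIntegral hint' ?_ _ hSm hSd hSU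
      (fun i => ne_top_of_le_ne_top hUfin (measure_mono (hSU i))) _ fun i => ?_
    · filter_upwards [hpos] with x hx using Real.rpow_nonneg hx.le _
    · filter_upwards [ae_restrict_of_ae_restrict_of_subset (hSU i) hpos, ae_restrict_mem (hSm i)]
        with x hx hxS
      exact Real.rpow_le_rpow_of_nonpos hx (hle i x hxS) hs0.le
  -- the value at the end point does not depend on the shell
  set D : ℝ := (C ^ c * Q ^ (t * n)) ^ (-1 / t) * Q⁻¹ ^ (n * N₁) * T with hD
  have hD0 : 0 < D := by positivity
  have hval (i : ℕ) : y i ^ (-1 / t) * (haarK K n).real (S i) = D := by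
    have h1 : y i = (C ^ c * Q ^ (t * n)) * Q ^ (-(t * e i)) := by
      rw [hy, mul_assoc, ← Real.rpow_add hQ0]
      ring_nf
    have h2 : (Q ^ (-(t * e i))) ^ (-1 / t) = Q ^ e i := by
      rw [← Real.rpow_mul hQ0.le, ← Real.rpow_natCast]
      congr 1
      field_simp
    rw [h1, Real.mul_rpow (by positivity) (by positivity), h2, hSr, pow_add, hD]
    have h3 : Q ^ e i * Q⁻¹ ^ e i = 1 := by rw [← mul_pow, mul_inv_cancel₀ hQ0.ne', one_pow]
    linear_combination ((C ^ c * Q ^ (t * n)) ^ (-1 / t) * Q⁻¹ ^ (n * N₁) * T) * h3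
  -- At s = -1/t, J shells together give J · D > B. The finite sum is continuous in s, so it still
  -- exceeds B slightly to the right of -1/t, where it bounds the transform from below.
  obtain ⟨J, hJ⟩ := exists_nat_gt (B / D)
  rw [div_lt_iff₀ hD0] at hJ
  have hcont : ContinuousAt (fun s : ℝ => ∑ i ∈ Finset.range J, y i ^ s * (haarK K n).real (S i))
      (-1 / t) := by
    refine tendsto_finsetSum _ fun i _ => ?_
    exact ((Real.continuousAt_const_rpow (hy0 i).ne').mul continuousAt_const)
  have hlim : B < ∑ i ∈ Finset.range J, y i ^ (-1 / t) * (haarK K n).real (S i) := by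
    simp only [hval, Finset.sum_const, Finset.card_range, nsmul_eq_mul]
    exact hJ
  have hneg : -1 / t < 0 := div_neg_of_neg_of_pos (by norm_num) ht
  filter_upwards [self_mem_nhdsWithin, nhdsWithin_le_nhds (hcont.eventually_const_lt hlim),
    nhdsWithin_le_nhds (Iio_mem_nhds hneg)] with s hs1 hs2 hs0
  exact hs2.le.trans (hlow J s hs1 hs0)

end LowerBound

/-! ### Analytic and polynomial maps -/

section Conclusion

variable {K : Type*} [NontriviallyNormedField K] [PadicField K] {n l : ℕ} {ϖ : K}
  {f : (Fin n → K) → Fin l → K} {F : Fin l → MvPowerSeries (Fin n) K} {N : ℕ}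

theorem IsSeriesOn.zero_notMem_unionSupport (hs : IsSeriesOn f F ϖ N) (h : IsUniformizer ϖ)
    (hf0 : f 0 = 0) : 0 ∉ unionSupport F := by
  rw [mem_unionSupport_iff, not_not]
  have h1 := hs.eq_tsum 0 (by rw [norm_zero]; exact pow_nonneg h.norm_pos.le _)
  rw [tsum_eq_single 0, hf0] at h1
  · simpa [monomialValue] using h1.symm
  · intro m hm
    obtain ⟨j, hj⟩ : ∃ j, m j ≠ 0 := by
      by_contra! hall
      exact hm (Finsupp.ext hall)
    rw [monomialValue, Finset.prod_eq_zero (Finset.mem_univ j), zero_smul]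
    rw [Pi.zero_apply, zero_pow hj]

/-- Convergence at the single point (ϖ^N, …, ϖ^N) already gives the decay of the rescaled
coefficients. -/
theorem IsAnalyticMapAtOrigin.exists_isSeriesOn (hf : IsAnalyticMapAtOrigin f F)
    (h : IsUniformizer ϖ) : ∃ N, IsSeriesOn f F ϖ N := by
  obtain ⟨ε, hε, H⟩ := Metric.eventually_nhds_iff_ball.mp (eventually_all.mpr hf.hasSum)
  obtain ⟨N, hN⟩ := exists_pow_lt_of_lt_one hε h.norm_lt_one
  have hsum (x : Fin n → K) (hx : ‖x‖ ≤ ‖ϖ‖ ^ N) :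
      HasSum (fun m : Fin n →₀ ℕ => monomialValue m x • coeffVec F m) (f x) := by
    refine Pi.hasSum.mpr fun i => ?_
    have := H x (by rw [mem_ball_zero_iff]; exact hx.trans_lt hN) i
    simpa only [Pi.smul_apply, smul_eq_mul, coeffVec, monomialValue, mul_comm] using this
  refine ⟨N, ⟨?_, fun x hx => (hsum x hx).tsum_eq.symm⟩⟩
  have h1 := (hsum (fun _ => ϖ ^ N) ?_).summable.tendsto_cofinite_zero
  · refine h1.congr fun m => ?_
    congr 1
    simp only [monomialValue, expDot, ← Finset.prod_pow_eq_pow_sum, ← pow_mul, mul_comm]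
  · refine (pi_norm_le_iff_of_nonneg (pow_nonneg h.norm_pos.le _)).mpr fun j => ?_
    rw [norm_pow]

theorem unionSupport_polySeries_finite {K : Type*} [Field K] (P : Fin l → MvPolynomial (Fin n) K) :
    (unionSupport (polySeries P)).Finite := by
  refine (Set.finite_iUnion fun i => (P i).support.finite_toSet).subset fun m hm => ?_
  obtain ⟨i, hi⟩ := hm
  refine mem_iUnion.mpr ⟨i, ?_⟩
  simpa [polySeries] using hi

theorem isSeriesOn_polyMap (P : Fin l → MvPolynomial (Fin n) K) (ϖ : K) :
    IsSeriesOn (polyMap P) (polySeries P) ϖ 0 := by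
  have hfin := unionSupport_polySeries_finite P
  have hzero (m : Fin n →₀ ℕ) (hm : m ∉ hfin.toFinset) : coeffVec (polySeries P) m = 0 := by
    rwa [hfin.mem_toFinset, mem_unionSupport_iff, not_not] at hm
  refine ⟨?_, fun x _ => ?_⟩
  · refine tendsto_const_nhds.congr' (f₁ := fun _ => 0) ?_
    filter_upwards [hfin.toFinset.finite_toSet.compl_mem_cofinite] with m hm
    rw [hzero m hm, smul_zero]
  · rw [tsum_eq_sum (s := hfin.toFinset) fun m hm => by rw [hzero m hm, smul_zero]]
    funext i
    rw [polyMap, MvPolynomial.eval_eq', Finset.sum_apply]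
    simp only [Pi.smul_apply, smul_eq_mul, monomialValue, coeffVec, polySeries,
      MvPolynomial.coeff_coe]
    rw [Finset.sum_subset (s₁ := (P i).support) (s₂ := hfin.toFinset)]
    · exact Finset.sum_congr rfl fun m _ => mul_comm _ _
    · intro m hm
      exact hfin.mem_toFinset.mpr ⟨i, by simpa [polySeries] using hm⟩
    · intro m _ hm
      rw [MvPolynomial.notMem_support_iff.mp hm, zero_mul]

variable [MeasurableSpace K] [BorelSpace K]

/-- Continuation on the cone pieces and a supporting weight give the largest pole. -/
theorem IsSeriesOn.isLargestPoleRealPart (hs : IsSeriesOn f F ϖ N) (h : IsUniformizer ϖ) {N' : ℕ}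
    (hN' : N ≤ N') (H : HasMellinOnPieces f F ϖ N' (fun _ => N) fun i => Pi.single i 1)
    (hne : (unionSupport F).Nonempty) (hf0 : f 0 = 0) (hn : 0 < n) {U : Set (Fin n → K)}
    (hU : IsClopen U) (hUN : U ⊆ Metric.closedBall 0 (‖ϖ‖ ^ N')) (hU0 : 0 ∈ U) {t : ℝ}
    (ht : (fun _ => t) ∈ frontier (mapPolyhedron F)) (htl : 1 / (l : ℝ) ≤ t) :
    IsLargestPoleRealPart (zetaIntegral U f) (-1 / t) := by
  have hl : 0 < l := by
    obtain ⟨m, i, -⟩ := hne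
    exact i.pos
  have ht0 : 0 < t := (one_div_pos.mpr (Nat.cast_pos.mpr hl)).trans_le htl
  have hneg : -1 / t < 0 := div_neg_of_neg_of_pos (by norm_num) ht0
  have hUN₀ : U ⊆ Metric.closedBall 0 (‖ϖ‖ ^ N) := hUN.trans (Metric.closedBall_subset_closedBall
    (pow_le_pow_of_le_one h.norm_pos.le h.norm_lt_one.le hN'))
  -- The frontier point is used twice: as a point of the closure it bounds the poles, and as a
  -- non-interior point it gives the supporting weight that forces one.
  have hβ := isAdmissibleExponent_neg_one_div (hs.zero_notMem_unionSupport h hf0) hl hn ht.1 htl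
  obtain ⟨W, hW⟩ := H U hU hUN _ hβ
  rw [restrict_inter_conePiece_const h hUN₀] at hW
  obtain ⟨κ, hκ, hκ0, hsupp⟩ := exists_supporting_weight hne ht.2
  refine isLargestPoleRealPart_of_unbounded hW.meromorphic hW.analytic (fun s hsre => ?_)
    (hW.unbounded_of_supporting_weight hs h ht0 hκ hκ0 hsupp hU hUN₀ hU0)
  have hfm : AEMeasurable (fun x => maxAbs (f x)) ((haarK K n).restrict U) :=
    measurable_maxAbs.comp_aemeasurable
      (((hs.continuousOn h).mono hUN₀).aemeasurable hU.isOpen.measurableSet)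
  have hcpow : Measurable fun x : ℝ => ((x : ℂ)) ^ s := by fun_prop
  rw [← hW.integral_eq s (hneg.trans hsre), integral_map hfm hcpow.aestronglyMeasurable]
  rfl

theorem conePoint_const_single_injective (N : ℕ) :
    Function.Injective (conePoint (fun _ : Fin n => N) fun i => Pi.single i 1) := by
  intro a b hab
  rw [conePoint_const_single, conePoint_const_single] at hab
  exact funext fun j => Nat.add_left_cancel (congrFun hab j)

theorem exists_nhds_isLargestPoleRealPart (hf : IsAnalyticMapAtOrigin f F)
    (hnd : StronglyNondegenerateAtOrigin F) :
    ∃ V ∈ 𝓝 (0 : Fin n → K), ∀ U ⊆ V, IsOpen U → IsCompact U → 0 ∈ U →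
      ∀ t : ℝ, (fun _ => t) ∈ frontier (mapPolyhedron F) → 1 / (l : ℝ) ≤ t →
        IsLargestPoleRealPart (zetaIntegral U f) (-1 / t) := by
  obtain ⟨ϖ, h⟩ := exists_isUniformizer K
  obtain ⟨N, hs⟩ := hf.exists_isSeriesOn h
  have hn : 0 < n := by
    rw [Nat.pos_iff_ne_zero]
    rintro rfl
    exact hf.not_const (Eventually.of_forall fun x => by rw [Subsingleton.elim x 0])
  have hne : (unionSupport F).Nonempty := by
    rw [nonempty_iff_ne_empty]
    intro hemp
    refine hf.not_const ?_
    filter_upwards [Metric.closedBall_mem_nhds 0 (pow_pos h.norm_pos N)] with x hx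
    rw [mem_closedBall_zero_iff] at hx
    rw [hf.map_zero, hs.eq_tsum x hx]
    have hz (m : Fin n →₀ ℕ) : coeffVec F m = 0 := by
      have : m ∉ unionSupport F := by simp [hemp]
      rwa [mem_unionSupport_iff, not_not] at this
    simp [hz]
  have hl : 0 < l := by
    obtain ⟨m, i, -⟩ := hne
    exact i.pos
  obtain ⟨N', hN', H⟩ := hs.exists_hasMellinOnPieces h hne hnd hl hn (fun _ => N)
    (fun i => Pi.single i 1) (fun _ => le_rfl) (conePoint_const_single_injective N)
  exact ⟨_, Metric.closedBall_mem_nhds 0 (pow_pos h.norm_pos N'), fun U hUV hUo hUc hU0 t ht htl =>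
    hs.isLargestPoleRealPart h hN' H hne hf.map_zero hn ⟨hUc.isClosed, hUo⟩ hUV hU0 ht htl⟩

/-- A polynomial is its own series on the whole unit polydisc and has finite support, so N = 0
works. The rank condition on all faces replaces shrinking the domain. -/
theorem isLargestPoleRealPart_polyMap (P : Fin l → MvPolynomial (Fin n) K)
    (hP0 : polyMap P 0 = 0) (hnc : ¬ ∀ x, polyMap P x = polyMap P 0)
    (hnd : StronglyNondegenerate (polySeries P)) {t : ℝ}
    (ht : (fun _ => t) ∈ frontier (mapPolyhedron (polySeries P))) (htl : 1 / (l : ℝ) ≤ t) :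
    IsLargestPoleRealPart
      (zetaIntegral (integerBox K n : Set (Fin n → K)) (polyMap P)) (-1 / t) := by
  obtain ⟨ϖ, h⟩ := exists_isUniformizer K
  have hs := isSeriesOn_polyMap P ϖ
  have hn : 0 < n := by
    rw [Nat.pos_iff_ne_zero]
    rintro rfl
    exact hnc fun x => by rw [Subsingleton.elim x 0]
  have hne : (unionSupport (polySeries P)).Nonempty := by
    rw [nonempty_iff_ne_empty]
    intro hemp
    have hPz (i : Fin l) : P i = 0 := by
      ext m
      by_contra hm
      have : m ∈ unionSupport (polySeries P) := ⟨i, by simpa [polySeries] using hm⟩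
      simp [hemp] at this
    exact hnc fun x => funext fun i => by simp [polyMap, hPz]
  have hl : 0 < l := by
    obtain ⟨m, i, -⟩ := hne
    exact i.pos
  have H := hs.hasMellinOnPieces_of_finite h (unionSupport_polySeries_finite P) hne hnd hl hn
    (fun _ => 0) (fun i => Pi.single i 1) (fun _ => le_rfl) (conePoint_const_single_injective 0)
  refine hs.isLargestPoleRealPart h le_rfl H hne hP0 hn ?_ ?_ ?_ ht htl
  · rw [integerBox_eq_closedBall]
    exact IsUltrametricDist.isClopen_closedBall 0 one_ne_zero
  · rw [integerBox_eq_closedBall, pow_zero]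
  · rw [integerBox_eq_closedBall]
    simp

end Conclusion

end IgusaZeta

theorem mainTheorem9 {K : Type*} [NontriviallyNormedField K] [IgusaZeta.PadicField K]
    [MeasurableSpace K] [BorelSpace K] (n l : ℕ) :
    (∀ (f : (Fin n → K) → (Fin l → K)) (F : Fin l → MvPowerSeries (Fin n) K),
      IgusaZeta.IsAnalyticMapAtOrigin f F →
      IgusaZeta.StronglyNondegenerateAtOrigin F →
      ∃ V ∈ nhds (0 : Fin n → K), ∀ U ⊆ V, IsOpen U → IsCompact U → 0 ∈ U →
        ∀ t : ℝ, (fun _ => t) ∈ frontier (IgusaZeta.mapPolyhedron F) → 1 / (l : ℝ) ≤ t →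
          IgusaZeta.IsLargestPoleRealPart (IgusaZeta.zetaIntegral U f) (-1 / t)) ∧
    (∀ P : Fin l → MvPolynomial (Fin n) K,
      IgusaZeta.polyMap P 0 = 0 →
      (¬ ∀ x, IgusaZeta.polyMap P x = IgusaZeta.polyMap P 0) →
      IgusaZeta.StronglyNondegenerate (IgusaZeta.polySeries P) →
      ∀ t : ℝ, (fun _ => t) ∈ frontier (IgusaZeta.mapPolyhedron (IgusaZeta.polySeries P)) →
        1 / (l : ℝ) ≤ t →
          IgusaZeta.IsLargestPoleRealPart
            (IgusaZeta.zetaIntegral (IgusaZeta.integerBox K n : Set (Fin n → K))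
              (IgusaZeta.polyMap P)) (-1 / t)) :=
  ⟨fun _ _ hf hnd => IgusaZeta.exists_nhds_isLargestPoleRealPart hf hnd,
    fun P hP0 hnc hnd _ ht htl => IgusaZeta.isLargestPoleRealPart_polyMap P hP0 hnc hnd ht htl⟩
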